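/- Let $F$ be an algebraically closed field of characteristic $p>0$, let $G$ be a finite group with $p\nmid |G|$, let $V_1,\dots,V_r$ be a complete set of pairwise non-isomorphic finite dimensional simple $FG$-modules, $d_k=\dim_F V_k$, and $c_k=|G|/d_k\in\mathbb I\setminus\{0\}$, where $\mathbb I=\{0,1,\dots,p-1\}=\mathbb F_p\subseteq F$. Let $n\ge 0$. The wreath Hecke algebra $\mathcal H_n(G)$ is the $F$-algebra generated by the group $G^n$, by $s_1,\dots,s_{n-1}$ and by $x_1,\dots,x_n$, subject to the Coxeter relations of $S_n$ for the $s_i$ and to $$x_ix_j=x_jx_i,\quad x_ig=gx_i,\quad s_ig={}^{s_i}g\,s_i,\quad s_ix_i=x_{i+1}s_i-t_{i,i+1},\quad s_ix_j=x_js_i\ (j\ne i,i+1),$$ where $g\in G^n$, ${}^{s_i}g$ is $g$ with its $i$-th and $(i+1)$-st components exchanged, and $t_{ij}=\sum_{h\in G}h^{(i)}(h^{-1})^{(j)}$, with $h^{(i)}\in G^n$ the element $h$ in the $i$-th factor. For $\lambda=(\lambda_i)_{i\in\mathbb I}$ with $\lambda_i\in\mathbb Z_{\ge0}$ let $\mathcal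 H_n^\lambda(G)$ be the quotient of $\mathcal H_n(G)$ by the two-sided ideal generated by $\prod_{i\in\mathbb I}(x_1-i)^{\lambda_i}$ (no relation is imposed if $n=0$). For $G=\{1\}$ write $\mathcal H_n$ and $\mathcal H_n^\lambda$ (the degenerate affine and degenerate cyclotomic Hecke algebras), with polynomial generators $y_i$ instead of $x_i$. For $1\le k\le r$ let $\lambda[k]$ be the weight with $\lambda[k]_i=\lambda_{ic_k}$ for $i\in\mathbb I$. With $\widehat n=(n_1,\dots,n_r)$ running over all $r$-tuples of non-negative integers of sum $n$, put $$A_{n,r}=\bigoplus_{\widehat n}\mathcal H_{n_1}\otimes\cdots\otimes\mathcal H_{n_r},\qquad A_{n,r}^\lambda=\bigoplus_{\widehat n}\mathcal H_{n_1}^{\lambda[1]}\otimes\cdots\otimes\mathcal H_{n_r}^{\lambda[r]}.$$ For an algebra $R$ let $R\text{-}\mathbf{mod}$ be the category of finite dimensional left $R$-modules. Put $V(\widehat n)=V_1^{\otimes n_1}\otimes\cdots\otimes V_r^{\otimes n_r}$, an $FG^n$-module, and for $M\in\mathcal H_n(G)\text{-}\mathbf{mod}$ let $I_{\widehat n}M$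 be the sum of all $FG^n$-submodules of $M$ isomorphic to $V(\widehat n)$. Let $\mathcal F:\mathcal H_n(G)\text{-}\mathbf{mod}\to A_{n,r}\text{-}\mathbf{mod}$ be the functor $$\mathcal F(M)=\bigoplus_{\widehat n}\mathrm{Hom}_{FG^n}(V(\widehat n),I_{\widehat n}M),$$ where the summand $\mathcal H_{n_1}\otimes\cdots\otimes\mathcal H_{n_r}$ acts on $\mathrm{Hom}_{FG^n}(V(\widehat n),I_{\widehat n}M)$ by $$(\pi\diamond\phi)(v_1\otimes\cdots\otimes v_n)=\pi\,\phi(v_{\pi(1)}\otimes\cdots\otimes v_{\pi(n)}),\qquad (y_j\diamond\phi)(v)=c_k^{-1}\,x_j\,\phi(v)$$ for $\pi\in S_{n_1}\times\cdots\times S_{n_r}\subseteq S_n$ and for $n_1+\dots+n_{k-1}<j\le n_1+\dots+n_k$ (the $y_j$ of the tensor factors being numbered consecutively), and where $\mathcal F$ acts on morphisms by composition. **Theorem.** The functor $\mathcal F$ is well defined and is an equivalence of categories $\mathcal H_n(G)\text{-}\mathbf{mod}\to A_{n,r}\text{-}\mathbf{mod}$, and for every $\lambda$ it induces an equivalence of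 categories $$\mathcal F^\lambda:\mathcal H_n^\lambda(G)\text{-}\mathbf{mod}\longrightarrow A_{n,r}^\lambda\text{-}\mathbf{mod};$$ that is, there is such an equivalence $\mathcal F^\lambda$ which followed by inflation along $A_{n,r}\to A_{n,r}^\lambda$ is isomorphic to inflation along $\mathcal H_n(G)\to\mathcal H_n^\lambda(G)$ followed by $\mathcal F$. -/

import Mathlib

open CategoryTheory Polynomial
open scoped TensorProduct ModuleCat

universe u

noncomputable section

namespace WreathHecke

/-! ### Wreath Hecke algebras -/

/-- The position `i` (counted from `0`) of the simple transposition `s_i = (i, i+1)`. -/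
def lo {n : ℕ} (i : Fin (n - 1)) : Fin n := ⟨i.1, by omega⟩

/-- The position `i + 1` of the simple transposition `s_i = (i, i+1)`. -/
def hi {n : ℕ} (i : Fin (n - 1)) : Fin n := ⟨i.1 + 1, by omega⟩

/-- The generators of the wreath Hecke algebra: the elements of `G^n`, the simple transpositions
`s_1, …, s_{n-1}` and the polynomial generators `x_1, …, x_n` (all counted from `0`). -/
inductive Gen (G : Type u) (n : ℕ) : Type u
  | g (a : Fin n → G) : Gen G n
  | s (i : Fin (n - 1)) : Gen G n
  | x (i : Fin n) : Gen G n

section Affine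

variable (F : Type u) [Field F] (G : Type u) [Group G] [Fintype G] (n : ℕ)

/-- The generator `a ∈ G^n` in the free algebra. -/
def fg {G : Type u} {n : ℕ} (a : Fin n → G) : FreeAlgebra F (Gen G n) := FreeAlgebra.ι F (Gen.g a)

/-- The generator `s_i` in the free algebra. -/
def fs {n : ℕ} (i : Fin (n - 1)) : FreeAlgebra F (Gen G n) := FreeAlgebra.ι F (Gen.s i)

/-- The generator `x_i` in the free algebra. -/
def fx {n : ℕ} (i : Fin n) : FreeAlgebra F (Gen G n) := FreeAlgebra.ι F (Gen.x i)

/-- `t_{ij} = ∑_{h ∈ G} h^{(i)} (h⁻¹)^{(j)}`. -/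
def ft {n : ℕ} (i j : Fin n) : FreeAlgebra F (Gen G n) :=
  ∑ h : G, fg F (Pi.mulSingle i h * Pi.mulSingle j h⁻¹)

/-- The defining relations of the wreath Hecke algebra. The first two say that the generators
from `G^n` multiply as in the group `G^n`. -/
inductive Rel : FreeAlgebra F (Gen G n) → FreeAlgebra F (Gen G n) → Prop
  | g_one : Rel (fg F 1) 1
  | g_mul (a b : Fin n → G) : Rel (fg F (a * b)) (fg F a * fg F b)
  | x_comm (i j : Fin n) : Rel (fx F G i * fx F G j) (fx F G j * fx F G i)
  | x_g (i : Fin n) (a : Fin n → G) : Rel (fx F G i * fg F a) (fg F a * fx F G i)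
  | s_sq (i : Fin (n - 1)) : Rel (fs F G i * fs F G i) 1
  | s_comm (i j : Fin (n - 1)) (h : i.1 + 1 < j.1 ∨ j.1 + 1 < i.1) :
      Rel (fs F G i * fs F G j) (fs F G j * fs F G i)
  | braid (i j : Fin (n - 1)) (h : i.1 + 1 = j.1) :
      Rel (fs F G i * fs F G j * fs F G i) (fs F G j * fs F G i * fs F G j)
  | s_x (i : Fin (n - 1)) :
      Rel (fs F G i * fx F G (lo i)) (fx F G (hi i) * fs F G i - ft F G (lo i) (hi i))
  | s_x_far (i : Fin (n - 1)) (j : Fin n) (h₁ : j ≠ lo i) (h₂ : j ≠ hi i) :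
      Rel (fs F G i * fx F G j) (fx F G j * fs F G i)
  | s_g (i : Fin (n - 1)) (a : Fin n → G) :
      Rel (fs F G i * fg F a) (fg F (fun m => a (Equiv.swap (lo i) (hi i) m)) * fs F G i)

/-- The wreath Hecke algebra `H_n(G)` over `F`. -/
def Affine : Type u := RingQuot (Rel F G n)

instance : Ring (Affine F G n) := inferInstanceAs (Ring (RingQuot (Rel F G n)))

instance : Algebra F (Affine F G n) := inferInstanceAs (Algebra F (RingQuot (Rel F G n)))

/-- The canonical map from the free algebra on the generators. -/
def toAffine : FreeAlgebra F (Gen G n) →ₐ[F] Affine F G n := RingQuot.mkAlgHom F (Rel F G n)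

variable {G n}

/-- The image of `a ∈ G^n` in `H_n(G)`. -/
def ofG (a : Fin n → G) : Affine F G n := toAffine F G n (fg F a)

variable (G)

/-- The generator `s_i` of `H_n(G)`. -/
def s (i : Fin (n - 1)) : Affine F G n := toAffine F G n (fs F G i)

/-- The generator `x_i` of `H_n(G)`. -/
def x (i : Fin n) : Affine F G n := toAffine F G n (fx F G i)

end Affine

/-- The degenerate affine Hecke algebra `H_n`, i.e. the wreath Hecke algebra of the trivial
group; there `t_{i,i+1} = 1`, so that `s_i y_i = y_{i+1} s_i - 1`. -/
abbrev DegAffine (F : Type u) [Field F] (n : ℕ) : Type u := Affine F PUnit.{u + 1} n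

/-! ### Cyclotomic quotients -/

section Cyclotomic

variable (F : Type u) [Field F] (p : ℕ) [Fact p.Prime] [CharP F p]

/-- The polynomial `g_λ(X) = ∏_{i ∈ 𝕀} (X - i)^{λ_i}`, where `𝕀 = {0, …, p-1} = 𝔽_p ⊆ F`. -/
def cycPoly (lam : ZMod p → ℕ) : F[X] :=
  ∏ i : ZMod p, (X - C (ZMod.castHom (dvd_refl p) F i)) ^ lam i

variable (G : Type u) [Group G] [Fintype G] (n : ℕ) (lam : ZMod p → ℕ)

/-- The relation `g_λ(x_1) = 0`. There is no relation if `n = 0`. -/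
inductive CycRel : Affine F G n → Affine F G n → Prop
  | g_lam (i : Fin n) (h : i.1 = 0) : CycRel (aeval (x F G i) (cycPoly F p lam)) 0

/-- The cyclotomic wreath Hecke algebra `H_n^λ(G)`: the quotient of `H_n(G)` by the two-sided
ideal generated by `g_λ(x_1)`. -/
def Cyc : Type u := RingQuot (CycRel F p G n lam)

instance : Ring (Cyc F p G n lam) := inferInstanceAs (Ring (RingQuot (CycRel F p G n lam)))

instance : Algebra F (Cyc F p G n lam) :=
  inferInstanceAs (Algebra F (RingQuot (CycRel F p G n lam)))

/-- The canonical surjection `H_n(G) → H_n^λ(G)`. -/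
def toCyc : Affine F G n →ₐ[F] Cyc F p G n lam := RingQuot.mkAlgHom F (CycRel F p G n lam)

/-- The degenerate cyclotomic Hecke algebra
`H_n^μ = H_n / ⟨∏_{i ∈ 𝕀} (y_1 - i)^{μ_i}⟩`, where `μ_i = ⟨h_i, μ⟩`. -/
abbrev DegCyc : Type u := Cyc F p PUnit.{u + 1} n lam

end Cyclotomic

/-! ### Compositions and the algebras `A_{n,r}` and `A_{n,r}^λ` -/

/-- The set of compositions `n̂ = (n_1, …, n_r)` of `n` into `r` parts (zero parts allowed). -/
abbrev Comp (r n : ℕ) : Type := {m : Fin r → ℕ // ∑ k, m k = n}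

section Blocks

variable {r n : ℕ} (nh : Comp r n)

/-- The bijection which lays the blocks of sizes `n_1, …, n_r` one after the other; it sends the
`j`-th place of the `k`-th block to the place `n_1 + ⋯ + n_{k-1} + j`. -/
def place : (Σ k, Fin (nh.1 k)) ≃ Fin n := finSigmaFinEquiv.trans (finCongr nh.2)

theorem place_hi (k : Fin r) (j : Fin (nh.1 k - 1)) :
    (place nh ⟨k, hi j⟩).1 = (place nh ⟨k, lo j⟩).1 + 1 := by
  simp [place, lo, hi, finSigmaFinEquiv_apply, add_assoc]

/-- The index in `S_n` of the `j`-th simple transposition of the `k`-th factor of the Young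
subgroup `S_{n_1} × ⋯ × S_{n_r}`. -/
def simplePlace (k : Fin r) (j : Fin (nh.1 k - 1)) : Fin (n - 1) :=
  ⟨(place nh ⟨k, lo j⟩).1, by
    have h := place_hi nh k j
    have h' := (place nh ⟨k, hi j⟩).2
    omega⟩

end Blocks

section Target

variable (F : Type u) [Field F] (r n : ℕ)

/-- `A_{n̂,r} = H_{n_1} ⊗ ⋯ ⊗ H_{n_r}`. -/
abbrev AHat {r n : ℕ} (nh : Comp r n) : Type u := ⨂[F] k : Fin r, DegAffine F (nh.1 k)

/-- `A_{n,r} = ⨁_{n̂} A_{n̂,r}`, a finite direct sum of algebras. -/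
abbrev A : Type u := ∀ nh : Comp r n, AHat F nh

variable (p : ℕ) [Fact p.Prime] [CharP F p] (mu : Fin r → ZMod p → ℕ)

/-- `⨁_{n̂} H_{n_1}^{μ[1]} ⊗ ⋯ ⊗ H_{n_r}^{μ[r]}`. -/
abbrev ACyc : Type u := ∀ nh : Comp r n, ⨂[F] k : Fin r, DegCyc F p (nh.1 k) (mu k)

/-- The tensor product of a family of algebra homomorphisms. -/
def tensorMap {ι : Type} {B C : ι → Type u} [∀ i, Ring (B i)] [∀ i, Algebra F (B i)]
    [∀ i, Ring (C i)] [∀ i, Algebra F (C i)] (f : ∀ i, B i →ₐ[F] C i) :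
    (⨂[F] i, B i) →ₐ[F] ⨂[F] i, C i :=
  PiTensorProduct.liftAlgHom
    ((PiTensorProduct.tprod F).compLinearMap fun i => (f i).toLinearMap)
    (by
      simp only [MultilinearMap.compLinearMap_apply, PiTensorProduct.one_def]
      congr 1
      funext i
      simp)
    (by
      intro a b
      simp only [MultilinearMap.compLinearMap_apply, PiTensorProduct.tprod_mul_tprod]
      congr 1
      funext i
      simp)

/-- The canonical surjection from `A_{n,r}` onto its cyclotomic quotient. -/
def toACyc : A F r n →ₐ[F] ACyc F r n p mu :=
  AlgHom.pi fun nh =>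
    (tensorMap F fun k => toCyc F p PUnit.{u + 1} (nh.1 k) (mu k)).comp (Pi.evalAlgHom F _ nh)

end Target

/-! ### Categories of finite dimensional modules -/

section Modules

variable (F : Type u) [Field F]

/-- The category of left modules over the `F`-algebra `B` that are finite dimensional over `F`. -/
abbrev FDMod (B : Type u) [Ring B] [Algebra F B] : Type (u + 1) :=
  ObjectProperty.FullSubcategory fun M : ModuleCat.{u} B => Module.Finite F M

theorem finite_restrictScalars {B C : Type u} [Ring B] [Algebra F B] [Ring C] [Algebra F C]
    (f : B →ₐ[F] C) (M : ModuleCat.{u} C) (hM : Module.Finite F M) :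
    Module.Finite F ((ModuleCat.restrictScalars f.toRingHom).obj M) := by
  let e : M →ₗ[F] ((ModuleCat.restrictScalars f.toRingHom).obj M) :=
    { toFun := fun m => m
      map_add' := fun _ _ => rfl
      map_smul' := fun c m => by
        change algebraMap F C c • m = f (algebraMap F B c) • m
        rw [f.commutes] }
  exact Module.Finite.of_surjective e fun m => ⟨m, rfl⟩

/-- Restriction of finite dimensional modules along an algebra homomorphism (inflation, if the
homomorphism is surjective). -/
def inflation {B C : Type u} [Ring B] [Algebra F B] [Ring C] [Algebra F C] (f : B →ₐ[F] C) :
    FDMod F C ⥤ FDMod F B :=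
  ObjectProperty.lift _
    (ObjectProperty.ι (fun M : ModuleCat.{u} C => Module.Finite F M) ⋙
      ModuleCat.restrictScalars f.toRingHom)
    fun M => finite_restrictScalars F f M.obj M.property

end Modules

/-! ### The functor -/

section Hom

variable {F : Type u} [Field F] {G : Type u} [Group G] [Fintype G] {r n : ℕ}
  {V : Fin r → Type u} [∀ k, AddCommGroup (V k)] [∀ k, Module F (V k)]
  (ρ : ∀ k, Representation F G (V k))

/-- `V(n̂) = V_1^{⊗ n_1} ⊗ ⋯ ⊗ V_r^{⊗ n_r}`. -/
abbrev VHat (F : Type u) [Field F] {r n : ℕ} (V : Fin r → Type u) [∀ k, AddCommGroup (V k)]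
    [∀ k, Module F (V k)] (nh : Comp r n) : Type u :=
  ⨂[F] a : (Σ k, Fin (nh.1 k)), V a.1

/-- The action of `G^n` on `V(n̂)`: the `i`-th component of `g` acts on the `i`-th factor. -/
def gAct (nh : Comp r n) (g : Fin n → G) : VHat F V nh →ₗ[F] VHat F V nh :=
  PiTensorProduct.map fun a => ρ a.1 (g (place nh a))

section

variable (M : Type u) [AddCommGroup M] [Module F M] [Module (Affine F G n) M]

/-- A linear map `V(n̂) → M` is `G^n`-equivariant. -/
def IsEquivariant (nh : Comp r n) (φ : VHat F V nh →ₗ[F] M) : Prop :=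
  ∀ (g : Fin n → G) (v : VHat F V nh), φ (gAct ρ nh g v) = ofG F g • φ v

/-- `I_{n̂} M`, the isotypical subspace of `V(n̂)` in `M`: the sum of all `FG^n`-submodules of `M`
isomorphic to `V(n̂)`. -/
def isotypical (nh : Comp r n) : Submodule F M :=
  sSup {W | ∃ φ : VHat F V nh →ₗ[F] M,
    IsEquivariant ρ M nh φ ∧ Function.Injective φ ∧ LinearMap.range φ = W}

variable [IsScalarTower F (Affine F G n) M]

/-- `Hom_{FG^n}(V(n̂), I_{n̂} M)`. -/
def HomHat (nh : Comp r n) : Submodule F (VHat F V nh →ₗ[F] M) where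
  carrier := {φ | IsEquivariant ρ M nh φ ∧ ∀ v, φ v ∈ isotypical ρ M nh}
  add_mem' := by
    rintro φ ψ ⟨h₁, h₂⟩ ⟨h₃, h₄⟩
    refine ⟨fun g v => ?_, fun v => Submodule.add_mem _ (h₂ v) (h₄ v)⟩
    rw [LinearMap.add_apply, LinearMap.add_apply, h₁ g v, h₃ g v, smul_add]
  zero_mem' := ⟨fun g v => by simp, fun v => Submodule.zero_mem _⟩
  smul_mem' := by
    rintro c φ ⟨h₁, h₂⟩
    refine ⟨fun g v => ?_, fun v => Submodule.smul_mem _ c (h₂ v)⟩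
    rw [LinearMap.smul_apply, LinearMap.smul_apply, h₁ g v, ← algebraMap_smul (Affine F G n) c,
      ← algebraMap_smul (Affine F G n) c, ← mul_smul, ← mul_smul,
      Algebra.commutes]

end

/-- `c_k = |G| / d_k`, where `d_k = dim V_k`, as an element of `𝔽_p`. -/
def cScalar (F : Type u) [Field F] (p : ℕ) [Fact p.Prime] (G : Type u) [Fintype G] {r : ℕ}
    (V : Fin r → Type u) [∀ k, AddCommGroup (V k)] [∀ k, Module F (V k)] (k : Fin r) : ZMod p :=
  (Fintype.card G : ZMod p) / (Module.finrank F (V k) : ZMod p)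

/-- The weight `λ[k]`: its value at `i` is `λ_{i c_k}`. -/
def scaledWeight (F : Type u) [Field F] {p : ℕ} [Fact p.Prime] (G : Type u) [Fintype G] {r : ℕ}
    (V : Fin r → Type u) [∀ k, AddCommGroup (V k)] [∀ k, Module F (V k)] (lam : ZMod p → ℕ)
    (k : Fin r) : ZMod p → ℕ :=
  fun i => lam (i * cScalar F p G V k)

/-- `(v_a) ↦ (v_{π(a)})` for an element `π` of the Young subgroup `S_{n_1} × ⋯ × S_{n_r}`. -/
def permute {nh : Comp r n} (π : ∀ k, Equiv.Perm (Fin (nh.1 k)))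
    (v : ∀ a : (Σ k, Fin (nh.1 k)), V a.1) : ∀ a : (Σ k, Fin (nh.1 k)), V a.1 :=
  fun a => v ⟨a.1, π a.1 a.2⟩

/-- A functor `T : H_n(G)-mod ⥤ A_{n,r}-mod` *is* the functor
`M ↦ ⨁_{n̂} Hom_{FG^n}(V(n̂), I_{n̂} M)`. Here `A_{n̂,r}` acts on the summand for `n̂` by
`(s ⋄ φ)(⊗ v_a) = s φ(⊗ v_{s(a)})` for a simple transposition `s` of the Young subgroup and by
`(y ⋄ φ)(v) = c_k⁻¹ x φ(v)` for a polynomial generator `y` of the `k`-th tensor factor and the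
generator `x` of `H_n(G)` at the same place; on morphisms the functor is composition. -/
structure IsHomFunctor (p : ℕ) [Fact p.Prime] [CharP F p]
    (T : FDMod F (Affine F G n) ⥤ FDMod F (A F r n)) where
  /-- the action of `A_{n̂,r}` on `Hom_{FG^n}(V(n̂), I_{n̂} M)` -/
  act (M : FDMod F (Affine F G n)) (nh : Comp r n) :
    AHat F nh →ₐ[F] Module.End F (HomHat ρ M.obj nh)
  act_s (M : FDMod F (Affine F G n)) (nh : Comp r n) (k : Fin r) (j : Fin (nh.1 k - 1))
    (φ : HomHat ρ M.obj nh) (v : ∀ a : (Σ k, Fin (nh.1 k)), V a.1) :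
    (act M nh (PiTensorProduct.singleAlgHom k (s F PUnit.{u + 1} j)) φ).1
        (PiTensorProduct.tprod F v) =
      s F G (simplePlace nh k j) •
        φ.1 (PiTensorProduct.tprod F
          (permute (Pi.mulSingle k (Equiv.swap (lo j) (hi j))) v))
  act_y (M : FDMod F (Affine F G n)) (nh : Comp r n) (k : Fin r) (j : Fin (nh.1 k))
    (φ : HomHat ρ M.obj nh) (v : VHat F V nh) :
    (act M nh (PiTensorProduct.singleAlgHom k (x F PUnit.{u + 1} j)) φ).1 v =
      (ZMod.castHom (dvd_refl p) F (cScalar F p G V k))⁻¹ •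
        (x F G (place nh ⟨k, j⟩) • φ.1 v)
  /-- the identification of `T(M)` with the direct sum of the spaces of homomorphisms -/
  iso (M : FDMod F (Affine F G n)) :
    (T.obj M).obj ≃ₗ[F] ∀ nh : Comp r n, HomHat ρ M.obj nh
  iso_smul (M : FDMod F (Affine F G n)) (a : A F r n) (u : (T.obj M).obj) (nh : Comp r n) :
    iso M (a • u) nh = act M nh (a nh) (iso M u nh)
  iso_map {M N : FDMod F (Affine F G n)} (f : M ⟶ N) (u : (T.obj M).obj) (nh : Comp r n)
    (v : VHat F V nh) :
    (iso N ((T.map f).hom.hom u) nh).1 v = f.hom.hom ((iso M u nh).1 v)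

end Hom

end WreathHecke

end

noncomputable section

set_option linter.unusedSectionVars false

/-! Since `p` does not divide `|G|`, every `FG^n`-module splits according to colourings `Fin n → Fin
r`, which record the simple module sitting in each position. Everything rests on the action of
`t_{ij}` on `V_k ⊗ V_l`: by Schur orthogonality it is zero for `k ≠ l` and `c_k` times the flip for
`k = l` (`tAct_of_colour_ne`, `tAct_of_block`). Hence inside a block, "`s_i` combined with the flip"
and `c_k⁻¹ x` satisfy the degenerate affine relations on `Hom(V(n̂), M)` (`homS_homY_lo`), while at
adjacent positions of different colours `s_i` exchanges `x_i` and `x_{i+1}` without any correction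
(`LabelEquivariant.x_s_smul`).

A colouring amounts to a composition `n̂` together with a shuffle `α`, that is, a minimal
representative of a coset of the Young subgroup (`labelEquiv`). A reduced word of a shuffle
exchanges only positions of different colours (`mixed_of_descent`), so the corresponding element
`w_α` of `H_n(G)` carries the standard component of a module to the one of `α` and intertwines the
polynomial generators (`x_smul_permElt`). The diagonal matrix units of `FG^n` sum to one
(`sum_matUnit`), so a module `M` is the direct sum of the spaces `w_α (V(n̂) ⊗ Hom(V(n̂), M))`, and
the generators act there by formulas in terms of `α`, `V(n̂)` and the `A_{n,r}`-action on the
homomorphisms. Hence morphisms between the spaces of homomorphisms extend uniquely (full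
faithfulness), and the same formulas build a module from any given `A_{n,r}`-module
(`affineRelations_induced`, `unitHom_bijective`; essential surjectivity).

Cyclotomic modules form full subcategories cut out by the vanishing of polynomials in first
generators, so these conditions only have to be matched (`exists_equivalence_of_essImage`,
`essImage_iff`). Some shuffle puts the first place of any given nonempty block in the first
position, hence `g_λ(x_1)` kills `M` exactly when `g_λ(c_k y)` kills the homomorphisms for the first
`y` of every block `k`; and `g_λ(c_k Y)` is a nonzero multiple of `g_{λ[k]}(Y)` (`cycPoly_eq_comp`).
-/

namespace WreathHecke

/-! ### Schur orthogonality and the regular character. -/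

section Schur

variable {F : Type u} [Field F] {G : Type u} [Group G] [Fintype G] {r : ℕ}
  {V : Fin r → Type u} [∀ k, AddCommGroup (V k)] [∀ k, Module F (V k)]

open Classical in
/-- The Schur orthogonality relations for the matrix coefficients of a family of representations
of `G`, with Schur elements `c k`, together with the decomposition of the regular character. -/
structure SchurRelations (ρ : ∀ k, Representation F G (V k)) (c : Fin r → F) : Prop where
  ne_zero (k : Fin r) : c k ≠ 0
  nontrivial (k : Fin r) : Nontrivial (V k)
  same (k : Fin r) (ξ : Module.Dual F (V k)) (u v : V k) :
    ∑ h : G, ξ (ρ k h⁻¹ v) • ρ k h u = c k • ξ u • v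
  diff (k l : Fin r) (hkl : k ≠ l) (ξ : Module.Dual F (V l)) (u : V k) (v : V l) :
    ∑ h : G, ξ (ρ l h⁻¹ v) • ρ k h u = 0
  regular (g : G) :
    ∑ k, (c k)⁻¹ * LinearMap.trace F (V k) (ρ k g) = if g = 1 then 1 else 0

/-- The average (up to a scalar) of a linear map between representations. -/
def averageIntertwining {W W' : Type u} [AddCommGroup W] [Module F W] [AddCommGroup W']
    [Module F W'] (σ : Representation F G W) (τ : Representation F G W') (Y : W →ₗ[F] W') :
    σ.IntertwiningMap τ where
  toLinearMap := ∑ h : G, τ h ∘ₗ Y ∘ₗ σ h⁻¹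
  isIntertwining' g := by
    ext v
    simp only [LinearMap.comp_apply, LinearMap.sum_apply, map_sum]
    refine Fintype.sum_equiv (Equiv.mulLeft g⁻¹) _ _ fun h => ?_
    simp [← Module.End.mul_apply, ← map_mul]

theorem averageIntertwining_apply {W W' : Type u} [AddCommGroup W] [Module F W] [AddCommGroup W']
    [Module F W'] (σ : Representation F G W) (τ : Representation F G W') (Y : W →ₗ[F] W') (v : W) :
    averageIntertwining σ τ Y v = ∑ h : G, τ h (Y (σ h⁻¹ v)) := by
  change (∑ h : G, τ h ∘ₗ Y ∘ₗ σ h⁻¹) v = _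
  simp [LinearMap.sum_apply]

/-- By Schur's lemma the average of `Y` is a scalar, which is found by taking traces. The dimension
stays undivided on the left because its nonvanishing in `F` is itself deduced from this identity. -/
theorem finrank_smul_sum_conj [IsAlgClosed F] {W : Type u} [AddCommGroup W] [Module F W]
    [FiniteDimensional F W] (σ : Representation F G W) (hσ : σ.IsIrreducible) (Y : W →ₗ[F] W)
    (v : W) :
    (Module.finrank F W : F) • ∑ h : G, σ h (Y (σ h⁻¹ v)) =
      ((Fintype.card G : F) * LinearMap.trace F W Y) • v := by
  obtain ⟨a, ha⟩ :=
    (Representation.IsIrreducible.algebraMap_intertwiningMap_bijective_of_isAlgClosed (ρ := σ)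
      ).2 (averageIntertwining σ σ Y)
  have h1 : ∀ w, ∑ h : G, σ h (Y (σ h⁻¹ w)) = a • w := fun w => by
    rw [← averageIntertwining_apply, ← ha]; rfl
  have h2 : (∑ h : G, σ h ∘ₗ Y ∘ₗ σ h⁻¹) = a • LinearMap.id := by
    ext w; simpa [LinearMap.sum_apply] using h1 w
  have h3 := congrArg (LinearMap.trace F W) h2
  have h4 : ∀ h : G, LinearMap.trace F W (σ h ∘ₗ Y ∘ₗ σ h⁻¹) = LinearMap.trace F W Y := fun h => by
    rw [← LinearMap.comp_assoc, LinearMap.trace_comp_comm', ← LinearMap.comp_assoc]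
    congr 1
    ext w
    simp only [LinearMap.comp_apply, ← Module.End.mul_apply, ← mul_assoc, ← map_mul]
    simp
  simp only [map_sum, h4, map_smul, LinearMap.trace_id] at h3
  rw [h1, smul_smul, mul_comm, ← smul_eq_mul, ← h3]
  simp

/-- If the dimension vanished in `F`, averaging a rank one operator of nonzero trace `ξ v` would
give `|G| ξ(v) v = 0`. -/
theorem finrank_ne_zero_of_irreducible [IsAlgClosed F] (hG : (Fintype.card G : F) ≠ 0) {W : Type u}
    [AddCommGroup W] [Module F W] [FiniteDimensional F W] (σ : Representation F G W)
    (hσ : σ.IsIrreducible) [Nontrivial W] : (Module.finrank F W : F) ≠ 0 := by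
  intro h0
  obtain ⟨v, hv⟩ := exists_ne (0 : W)
  obtain ⟨ξ, hξ⟩ := not_forall.1 (mt (Module.forall_dual_apply_eq_zero_iff F v).1 hv)
  have := finrank_smul_sum_conj σ hσ (ξ.smulRight v) v
  rw [h0, zero_smul, LinearMap.trace_smulRight] at this
  exact smul_ne_zero (mul_ne_zero hG hξ) hv this.symm


theorem sum_coefficient_same [IsAlgClosed F] {W : Type u} [AddCommGroup W] [Module F W]
    [FiniteDimensional F W] (σ : Representation F G W) (hσ : σ.IsIrreducible)
    (hd : (Module.finrank F W : F) ≠ 0) (ξ : Module.Dual F W) (u v : W) :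
    ∑ h : G, ξ (σ h⁻¹ v) • σ h u =
      ((Fintype.card G : F) / (Module.finrank F W : F)) • ξ u • v := by
  have h := finrank_smul_sum_conj σ hσ (ξ.smulRight u) v
  simp only [LinearMap.smulRight_apply, map_smul, LinearMap.trace_smulRight] at h
  rw [smul_smul, div_mul_eq_mul_div, ← inv_mul_eq_div, ← smul_smul, ← h, inv_smul_smul₀ hd]

/-- The average of a rank one map is an intertwiner between non-isomorphic irreducible
representations, hence zero. -/
theorem sum_coefficient_diff {W W' : Type u} [AddCommGroup W] [Module F W] [AddCommGroup W']
    [Module F W'] (σ : Representation F G W) (τ : Representation F G W')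
    (hσ : σ.IsIrreducible) (hτ : τ.IsIrreducible) (h : IsEmpty (σ.Equiv τ))
    (ξ : Module.Dual F W) (u : W') (v : W) : ∑ h : G, ξ (σ h⁻¹ v) • τ h u = 0 := by
  have h1 : averageIntertwining σ τ (ξ.smulRight u) = 0 := Subsingleton.elim _ _
  have h2 := averageIntertwining_apply σ τ (ξ.smulRight u) v
  rw [h1] at h2
  simpa using h2.symm

variable (ρ : ∀ k, Representation F G (V k)) (c : Fin r → F)

/-- Expanding the traces in bases leaves orthogonality sums: those with `k ≠ l` vanish, and for `k =
l` the coordinates reassemble `u`. Thus one explicit element of the group algebra acts as the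
identity on every `V l`. -/
theorem sum_regular_smul [∀ k, FiniteDimensional F (V k)] (hc : ∀ k, c k ≠ 0)
    (same : ∀ (k : Fin r) (ξ : Module.Dual F (V k)) (u v : V k),
      ∑ h : G, ξ (ρ k h⁻¹ v) • ρ k h u = c k • ξ u • v)
    (diff : ∀ (k l : Fin r) (_ : k ≠ l) (ξ : Module.Dual F (V l)) (u : V k) (v : V l),
      ∑ h : G, ξ (ρ l h⁻¹ v) • ρ k h u = 0) (l : Fin r) (u : V l) :
    ∑ g : G, (∑ k, (c k)⁻¹ * LinearMap.trace F (V k) (ρ k g⁻¹)) • ρ l g u = u := by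
  have key : ∀ k, ∑ g : G, ((c k)⁻¹ * LinearMap.trace F (V k) (ρ k g⁻¹)) • ρ l g u =
      if k = l then u else 0 := fun k => by
    let b := Module.finBasis F (V k)
    have h1 : ∀ g : G, LinearMap.trace F (V k) (ρ k g⁻¹) = ∑ i, b.coord i (ρ k g⁻¹ (b i)) :=
      fun g => by
        rw [LinearMap.trace_eq_matrix_trace F b]
        simp [Matrix.trace, LinearMap.toMatrix_apply]
    simp only [h1, ← smul_smul, ← Finset.smul_sum, Finset.sum_smul]
    rw [Finset.sum_comm]
    split_ifs with hkl
    · subst hkl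
      rw [Finset.sum_congr rfl fun i _ => same k (b.coord i) u (b i), ← Finset.smul_sum]
      simp only [Module.Basis.coord_apply, Module.Basis.sum_repr]
      exact inv_smul_smul₀ (hc k) u
    · rw [Finset.sum_eq_zero fun i _ => diff l k (Ne.symm hkl) (b.coord i) u (b i), smul_zero]
  simp only [Finset.sum_smul]
  rw [Finset.sum_comm]
  simp [key]

theorem asAlgebraHom_ofModule' {M : Type u} [AddCommGroup M] [Module F M]
    [Module (MonoidAlgebra F G) M] [IsScalarTower F (MonoidAlgebra F G) M] (a : MonoidAlgebra F G)
    (m : M) : (Representation.ofModule' (k := F) (G := G) M).asAlgebraHom a m = a • m := by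
  rw [Representation.asAlgebraHom, Representation.ofModule', Equiv.apply_symm_apply]
  rfl

theorem isIrreducible_ofModule' {M : Type u} [AddCommGroup M] [Module F M]
    [Module (MonoidAlgebra F G) M] [IsScalarTower F (MonoidAlgebra F G) M]
    [IsSimpleModule (MonoidAlgebra F G) M] :
    (Representation.ofModule' (k := F) (G := G) M).IsIrreducible := by
  rw [Representation.irreducible_iff_isSimpleModule_asModule]
  let ρM := Representation.ofModule' (k := F) (G := G) M
  let e : ρM.asModule ≃ₗ[MonoidAlgebra F G] M :=
    { ρM.asModuleEquiv with
      map_smul' := fun a m => by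
        change ρM.asModuleEquiv (a • m) = a • ρM.asModuleEquiv m
        rw [Representation.asModuleEquiv_map_smul, asAlgebraHom_ofModule'] }
  exact IsSimpleModule.congr e

theorem regular_smul_simple [∀ k, FiniteDimensional F (V k)] (hc : ∀ k, c k ≠ 0)
    (same : ∀ (k : Fin r) (ξ : Module.Dual F (V k)) (u v : V k),
      ∑ h : G, ξ (ρ k h⁻¹ v) • ρ k h u = c k • ξ u • v)
    (diff : ∀ (k l : Fin r) (_ : k ≠ l) (ξ : Module.Dual F (V l)) (u : V k) (v : V l),
      ∑ h : G, ξ (ρ l h⁻¹ v) • ρ k h u = 0)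
    (hcomplete : ∀ (W : Type u) [AddCommGroup W] [Module F W] [FiniteDimensional F W]
      (σ : Representation F G W), σ.IsIrreducible →
        ∃ k, Nonempty (Representation.Equiv σ (ρ k)))
    (S : Type u) [AddCommGroup S] [Module F S] [FiniteDimensional F S]
    [Module (MonoidAlgebra F G) S] [IsScalarTower F (MonoidAlgebra F G) S]
    [IsSimpleModule (MonoidAlgebra F G) S] (m : S) :
    (∑ g : G, MonoidAlgebra.single g (∑ k, (c k)⁻¹ * LinearMap.trace F (V k) (ρ k g⁻¹))) • m =
      m := by
  obtain ⟨l, ⟨e⟩⟩ := hcomplete _ (Representation.ofModule' (k := F) (G := G) S)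
    isIrreducible_ofModule'
  have h1 := sum_regular_smul ρ c hc same diff l (e m)
  rw [← asAlgebraHom_ofModule', map_sum, LinearMap.sum_apply]
  apply e.toLinearEquiv.injective
  rw [map_sum]
  refine Eq.trans (Finset.sum_congr rfl fun g _ => ?_) h1
  rw [Representation.asAlgebraHom_single, LinearMap.smul_apply, map_smul]
  congr 1
  exact LinearMap.congr_fun (e.isIntertwining' g) m

/-- By Maschke's theorem the regular module is the sum of its simple submodules, each isomorphic to
some `V l`, so the element `e` fixes all of `FG`. Comparing coefficients in `e * 1 = 1` gives the
formula. -/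
theorem sum_trace_eq [∀ k, FiniteDimensional F (V k)] (hG : (Fintype.card G : F) ≠ 0)
    (hc : ∀ k, c k ≠ 0)
    (same : ∀ (k : Fin r) (ξ : Module.Dual F (V k)) (u v : V k),
      ∑ h : G, ξ (ρ k h⁻¹ v) • ρ k h u = c k • ξ u • v)
    (diff : ∀ (k l : Fin r) (_ : k ≠ l) (ξ : Module.Dual F (V l)) (u : V k) (v : V l),
      ∑ h : G, ξ (ρ l h⁻¹ v) • ρ k h u = 0)
    (hcomplete : ∀ (W : Type u) [AddCommGroup W] [Module F W] [FiniteDimensional F W]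
      (σ : Representation F G W), σ.IsIrreducible →
        ∃ k, Nonempty (Representation.Equiv σ (ρ k)))
    [DecidableEq G] (g : G) :
    ∑ k, (c k)⁻¹ * LinearMap.trace F (V k) (ρ k g) = if g = 1 then 1 else 0 := by
  have : NeZero (Nat.card G : F) := ⟨by rwa [Nat.card_eq_fintype_card]⟩
  have hfin : Module.Finite F (MonoidAlgebra F G) :=
    Module.Finite.equiv (MonoidAlgebra.coeffLinearEquiv F).symm
  let e : MonoidAlgebra F G := ∑ g : G,
    MonoidAlgebra.single g (∑ k, (c k)⁻¹ * LinearMap.trace F (V k) (ρ k g⁻¹))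
  have he : ∀ m, e * m = m := fun m => by
    have hm : m ∈ sSup {S : Submodule (MonoidAlgebra F G) (MonoidAlgebra F G) |
        IsSimpleModule (MonoidAlgebra F G) S} := by
      rw [IsSemisimpleModule.sSup_simples_eq_top]; trivial
    rw [sSup_eq_iSup'] at hm
    refine Submodule.iSup_induction _ (motive := fun m => e * m = m) hm ?_ (mul_zero _) ?_
    · rintro ⟨S, hS⟩ m hm
      have : IsSimpleModule (MonoidAlgebra F G) S := hS
      have : FiniteDimensional F S := inferInstanceAs (Module.Finite F (S.restrictScalars F))
      exact congrArg Subtype.val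
        (regular_smul_simple ρ c hc same diff hcomplete S ⟨m, hm⟩)
    · intro x y hx hy
      rw [mul_add, hx, hy]
  -- The coefficient is taken at `g⁻¹` because `e` is built from the traces of the inverses.
  have h1 := congrArg (fun m => MonoidAlgebra.coeff m g⁻¹) (he 1)
  simpa [e, MonoidAlgebra.coeff_sum, MonoidAlgebra.one_def, Finsupp.single_apply,
    eq_comm (a := (1 : G))] using h1

theorem schurRelations [IsAlgClosed F] [∀ k, FiniteDimensional F (V k)]
    (hG : (Fintype.card G : F) ≠ 0) (hsimple : ∀ k, (ρ k).IsIrreducible)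
    (hdistinct : ∀ k l, k ≠ l → IsEmpty (Representation.Equiv (ρ k) (ρ l)))
    (hcomplete : ∀ (W : Type u) [AddCommGroup W] [Module F W] [FiniteDimensional F W]
      (σ : Representation F G W), σ.IsIrreducible →
        ∃ k, Nonempty (Representation.Equiv σ (ρ k))) :
    SchurRelations ρ fun k => (Fintype.card G : F) / (Module.finrank F (V k) : F) := by
  have hnt : ∀ k, Nontrivial (V k) := fun k => by
    by_contra h
    rw [not_nontrivial_iff_subsingleton] at h
    have := (hsimple k).1
    obtain ⟨x, y, hxy⟩ := this
    exact hxy (Subrepresentation.toSubmodule_injective (Subsingleton.elim _ _))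
  have hd : ∀ k, (Module.finrank F (V k) : F) ≠ 0 := fun k =>
    finrank_ne_zero_of_irreducible hG (ρ k) (hsimple k)
  have hc : ∀ k, (Fintype.card G : F) / (Module.finrank F (V k) : F) ≠ 0 := fun k =>
    div_ne_zero hG (hd k)
  have same := fun k => sum_coefficient_same (ρ k) (hsimple k) (hd k)
  have diff : ∀ (k l : Fin r) (_ : k ≠ l) (ξ : Module.Dual F (V l)) (u : V k) (v : V l),
      ∑ h : G, ξ (ρ l h⁻¹ v) • ρ k h u = 0 := fun k l hkl =>
    sum_coefficient_diff (ρ l) (ρ k) (hsimple l) (hsimple k) (hdistinct l k hkl.symm)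
  refine ⟨hc, hnt, same, diff, fun g => ?_⟩
  classical
  convert sum_trace_eq ρ _ hG hc same diff hcomplete g

end Schur

/-! ### The Coxeter presentation of the symmetric group. -/

section SymmetricGroup

variable {n : ℕ}

/-- The simple transposition `(i, i+1)`. -/
def simpleSwap (i : Fin (n - 1)) : Equiv.Perm (Fin n) := Equiv.swap (lo i) (hi i)

theorem lo_ne_hi (i : Fin (n - 1)) : lo i ≠ hi i := by
  simp [lo, hi, Fin.ext_iff]

@[simp] theorem simpleSwap_lo (i : Fin (n - 1)) : simpleSwap i (lo i) = hi i :=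
  Equiv.swap_apply_left _ _

@[simp] theorem simpleSwap_hi (i : Fin (n - 1)) : simpleSwap i (hi i) = lo i :=
  Equiv.swap_apply_right _ _

theorem simpleSwap_of_ne {i : Fin (n - 1)} {b : Fin n} (h₁ : b ≠ lo i) (h₂ : b ≠ hi i) :
    simpleSwap i b = b :=
  Equiv.swap_apply_of_ne_of_ne h₁ h₂

@[simp] theorem simpleSwap_inv (i : Fin (n - 1)) : (simpleSwap i)⁻¹ = simpleSwap i :=
  Equiv.swap_inv _ _

@[simp] theorem simpleSwap_mul_self (i : Fin (n - 1)) : simpleSwap i * simpleSwap i = 1 :=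
  Equiv.swap_mul_self _ _

@[simp] theorem simpleSwap_mul_cancel (i : Fin (n - 1)) (w : Equiv.Perm (Fin n)) :
    simpleSwap i * (simpleSwap i * w) = w := by
  rw [← mul_assoc, simpleSwap_mul_self, one_mul]

@[simp] theorem simpleSwap_apply_self (i : Fin (n - 1)) (b : Fin n) :
    simpleSwap i (simpleSwap i b) = b := by
  rw [← Equiv.Perm.mul_apply, simpleSwap_mul_self, Equiv.Perm.one_apply]

/-- The one-line notation of `w⁻¹` has a descent at `i`. -/
def Descent (w : Equiv.Perm (Fin n)) (i : Fin (n - 1)) : Prop := w⁻¹ (hi i) < w⁻¹ (lo i)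

theorem Descent.of_not {w : Equiv.Perm (Fin n)} {i : Fin (n - 1)} (h : ¬ Descent w i) :
    Descent (simpleSwap i * w) i := by
  have h1 : w⁻¹ (lo i) ≠ w⁻¹ (hi i) := fun h => lo_ne_hi i (w⁻¹.injective h)
  simp only [Descent, not_lt] at h ⊢
  simpa [mul_inv_rev] using lt_of_le_of_ne h h1

/-- A statistic which decreases when a descent is removed. -/
def disorder (w : Equiv.Perm (Fin n)) : ℕ := ∑ b : Fin n, (w⁻¹ b : ℕ) * (n - (b : ℕ))

/-- The two sums differ by `w⁻¹ (lo i) - w⁻¹ (hi i)`, which is positive at a descent. -/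
theorem disorder_lt {w : Equiv.Perm (Fin n)} {i : Fin (n - 1)} (h : Descent w i) :
    disorder (simpleSwap i * w) < disorder w := by
  have h1 : disorder (simpleSwap i * w) =
      ∑ b : Fin n, (w⁻¹ b : ℕ) * (n - (simpleSwap i b : ℕ)) :=
    Fintype.sum_equiv (simpleSwap i) _ _ fun b => by simp [mul_inv_rev]
  -- The comparison is kept additive, with a correction on each side, to avoid truncated subtraction
  -- of the summands.
  have h2 : ∀ b : Fin n, (w⁻¹ b : ℕ) * (n - (simpleSwap i b : ℕ)) +
      (if b = lo i then (w⁻¹ b : ℕ) else 0) =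
      (w⁻¹ b : ℕ) * (n - (b : ℕ)) + if b = hi i then (w⁻¹ b : ℕ) else 0 := fun b => by
    have hn := (hi i).2
    have hl : ((lo i : Fin n) : ℕ) = i := rfl
    have hh : ((hi i : Fin n) : ℕ) = i + 1 := rfl
    have e : n - (i : ℕ) = (n - (i + 1 : ℕ)) + 1 := by omega
    by_cases hb1 : b = lo i
    · subst hb1
      rw [simpleSwap_lo, if_pos rfl, if_neg (lo_ne_hi i), hl, hh, e]; ring
    by_cases hb2 : b = hi i
    · subst hb2
      rw [simpleSwap_hi, if_pos rfl, if_neg (lo_ne_hi i).symm, hl, hh, e]; ring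
    rw [simpleSwap_of_ne hb1 hb2, if_neg hb1, if_neg hb2]
  have h3 := Finset.sum_congr (s₁ := Finset.univ) rfl fun b _ => h2 b
  simp only [Finset.sum_add_distrib, Finset.sum_ite_eq', Finset.mem_univ, if_true] at h3
  have h4 : (w⁻¹ (hi i) : ℕ) < w⁻¹ (lo i) := h
  rw [h1]
  change _ < ∑ b : Fin n, (w⁻¹ b : ℕ) * (n - (b : ℕ))
  omega

theorem eq_one_of_no_descent {w : Equiv.Perm (Fin n)} (h : ∀ i, ¬ Descent w i) : w = 1 := by
  rcases n with _ | m
  · exact Subsingleton.elim _ _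
  have hm : StrictMono (w⁻¹ : Equiv.Perm (Fin (m + 1))) := by
    refine Fin.strictMono_iff_lt_succ.2 fun i => ?_
    exact lt_of_le_of_ne (not_lt.1 (h i)) fun h => lo_ne_hi (n := m + 1) i (w⁻¹.injective h)
  have := Subsingleton.elim (StrictMono.orderIsoOfSurjective _ hm w⁻¹.surjective)
    (OrderIso.refl _)
  have h2 : w⁻¹ = 1 := Equiv.ext fun b => congrArg (fun e : Fin (m + 1) ≃o Fin (m + 1) => e b) this
  simpa using h2

variable {U : Type*} [Monoid U] (t : Fin (n - 1) → U)

/-- The product of the elements `t i` along a reduced word for `w`. -/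
def wordProd (w : Equiv.Perm (Fin n)) : U := by
  classical exact
  if h : ∃ i, Descent w i then t h.choose * wordProd (simpleSwap h.choose * w) else 1
termination_by disorder w
decreasing_by exact disorder_lt h.choose_spec

theorem wordProd_one : wordProd t 1 = 1 := by
  rw [wordProd, dif_neg]
  rintro ⟨i, hi'⟩
  simp only [Descent, inv_one, Equiv.Perm.one_apply, lo, hi, Fin.lt_def] at hi'
  omega

/-- The Coxeter relations of the symmetric group. -/
structure CoxeterRelations : Prop where
  sq (i : Fin (n - 1)) : t i * t i = 1
  comm (i j : Fin (n - 1)) (h : i.1 + 1 < j.1 ∨ j.1 + 1 < i.1) : t i * t j = t j * t i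
  braid (i j : Fin (n - 1)) (h : i.1 + 1 = j.1) : t i * t j * t i = t j * t i * t j

theorem simpleSwap_far {i j : Fin (n - 1)} (h : i.1 + 1 < j.1 ∨ j.1 + 1 < i.1) :
    simpleSwap i (lo j) = lo j ∧ simpleSwap i (hi j) = hi j := by
  constructor <;> apply simpleSwap_of_ne <;> simp only [lo, hi, ne_eq, Fin.mk.injEq] <;> omega

theorem simpleSwap_mul_comm {i j : Fin (n - 1)} (h : i.1 + 1 < j.1 ∨ j.1 + 1 < i.1) :
    simpleSwap i * simpleSwap j = simpleSwap j * simpleSwap i := by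
  have h1 := Equiv.mul_swap_eq_swap_mul (simpleSwap i) (lo j) (hi j)
  rw [(simpleSwap_far h).1, (simpleSwap_far h).2] at h1
  exact h1

theorem hi_eq_lo {i j : Fin (n - 1)} (h : i.1 + 1 = j.1) : hi i = lo j := Fin.ext h

theorem simpleSwap_braid {i j : Fin (n - 1)} (h : i.1 + 1 = j.1) :
    simpleSwap i * simpleSwap j * simpleSwap i = simpleSwap j * simpleSwap i * simpleSwap j := by
  have h1 : lo i ≠ hi j := by simp only [lo, hi, ne_eq, Fin.mk.injEq]; omega
  have a := Equiv.swap_mul_swap_mul_swap (lo_ne_hi j).symm h1.symm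
  have b := Equiv.swap_mul_swap_mul_swap (x := lo i) (y := hi i) (z := hi j) (lo_ne_hi i) h1
  rw [← hi_eq_lo h, Equiv.swap_comm (hi i) (lo i), Equiv.swap_comm (hi j)] at a
  simp only [simpleSwap]
  rw [← hi_eq_lo h, a, b, Equiv.swap_comm]

variable {t}

theorem Descent.of_far {w : Equiv.Perm (Fin n)} {i j : Fin (n - 1)} (hw : Descent w j)
    (h : i.1 + 1 < j.1 ∨ j.1 + 1 < i.1) : Descent (simpleSwap i * w) j := by
  simpa [Descent, mul_inv_rev, (simpleSwap_far h).1, (simpleSwap_far h).2] using hw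

theorem lo_ne_of_adjacent {i j : Fin (n - 1)} (h : i.1 + 1 = j.1) : lo i ≠ lo j ∧ lo i ≠ hi j := by
  constructor <;> simp only [lo, hi, ne_eq, Fin.mk.injEq] <;> omega

/-- The recursion strips an arbitrarily chosen descent; the Coxeter relations make the choice
irrelevant. Given two descents, both can be stripped in either order if they are far apart, and
three letters can be stripped in two ways if they are adjacent. -/
theorem wordProd_descent (ht : CoxeterRelations t) {w : Equiv.Perm (Fin n)} {i : Fin (n - 1)}
    (h : Descent w i) : wordProd t w = t i * wordProd t (simpleSwap i * w) := by
  induction hm : disorder w using Nat.strong_induction_on generalizing w i with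
  | _ m ih =>
  subst hm
  -- Here `w⁻¹` decreases along three consecutive positions, so the letters `i, j, i` and `j, i, j`
  -- can both be stripped, leaving the same permutation.
  have adjacent : ∀ i j : Fin (n - 1), i.1 + 1 = j.1 → Descent w i → Descent w j →
      t i * wordProd t (simpleSwap i * w) = t j * wordProd t (simpleSwap j * w) := by
    intro i j hij hi' hj'
    have e := hi_eq_lo hij
    obtain ⟨e1, e2⟩ := lo_ne_of_adjacent hij
    have e3 : simpleSwap j (lo i) = lo i := simpleSwap_of_ne e1 e2
    have e4 : simpleSwap i (hi j) = hi j :=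
      simpleSwap_of_ne e2.symm (by rw [e]; exact (lo_ne_hi j).symm)
    have e5 : simpleSwap j (hi i) = hi j := by rw [e, simpleSwap_lo]
    have e6 : simpleSwap i (lo j) = lo i := by rw [← e, simpleSwap_hi]
    have d1 : w⁻¹ (hi i) < w⁻¹ (lo i) := hi'
    have d2 : w⁻¹ (hi j) < w⁻¹ (hi i) := by rw [e]; exact hj'
    have d3 : Descent (simpleSwap i * w) j := by
      simpa [Descent, mul_inv_rev, e4, e6] using d2.trans d1
    have d4 : Descent (simpleSwap j * w) i := by
      simpa [Descent, mul_inv_rev, e3, e5] using d2.trans d1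
    have d5 : Descent (simpleSwap j * (simpleSwap i * w)) i := by
      simpa [Descent, mul_inv_rev, e3, e4, e5] using d2
    have d6 : Descent (simpleSwap i * (simpleSwap j * w)) j := by
      simpa [Descent, mul_inv_rev, e3, e4, e6, e] using d1
    have l1 := disorder_lt hi'
    have l2 := disorder_lt hj'
    rw [ih _ l1 d3 rfl, ih _ ((disorder_lt d3).trans l1) d5 rfl, ih _ l2 d4 rfl,
      ih _ ((disorder_lt d4).trans l2) d6 rfl]
    simp only [← mul_assoc]
    rw [ht.braid i j hij, simpleSwap_braid hij]
  have h0 : ∃ i, Descent w i := ⟨i, h⟩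
  rw [wordProd, dif_pos h0]
  generalize hj : h0.choose = j
  have hj' : Descent w j := hj ▸ h0.choose_spec
  have l1 := disorder_lt h
  have l2 := disorder_lt hj'
  rcases lt_trichotomy (i : ℕ) j with hlt | heq | hlt
  · rcases Nat.lt_or_ge (i + 1) j with h2 | h2
    · rw [ih _ l2 (h.of_far (Or.inr h2)) rfl, ih _ l1 (hj'.of_far (Or.inl h2)) rfl,
        ← mul_assoc, ← mul_assoc, ← mul_assoc, ← mul_assoc, ht.comm i j (Or.inl h2),
        simpleSwap_mul_comm (Or.inl h2)]
    · exact (adjacent i j (by omega) h hj').symm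
  · rw [Fin.ext heq]
  · rcases Nat.lt_or_ge (j + 1) i with h2 | h2
    · rw [ih _ l2 (h.of_far (Or.inl h2)) rfl, ih _ l1 (hj'.of_far (Or.inr h2)) rfl,
        ← mul_assoc, ← mul_assoc, ← mul_assoc, ← mul_assoc, ht.comm i j (Or.inr h2),
        simpleSwap_mul_comm (Or.inr h2)]
    · exact adjacent j i (by omega) hj' h

theorem wordProd_simpleSwap_mul (ht : CoxeterRelations t) (w : Equiv.Perm (Fin n))
    (i : Fin (n - 1)) : wordProd t (simpleSwap i * w) = t i * wordProd t w := by
  by_cases h : Descent w i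
  · rw [wordProd_descent ht h, ← mul_assoc, ht.sq, one_mul]
  · rw [wordProd_descent ht (Descent.of_not h), simpleSwap_mul_cancel]

/-- The step retains the descent as a hypothesis because, for a shuffle, it forces the exchanged
positions to have different colours. -/
theorem perm_induction {P : Equiv.Perm (Fin n) → Prop} (one : P 1)
    (step : ∀ w i, Descent w i → P (simpleSwap i * w) → P w) (w : Equiv.Perm (Fin n)) : P w := by
  induction hm : disorder w using Nat.strong_induction_on generalizing w with
  | _ m ih =>
  subst hm
  by_cases h : ∃ i, Descent w i
  · obtain ⟨i, h⟩ := h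
    exact step w i h (ih _ (disorder_lt h) _ rfl)
  · rw [eq_one_of_no_descent (not_exists.1 h)]
    exact one

theorem wordProd_mul (ht : CoxeterRelations t) (w w' : Equiv.Perm (Fin n)) :
    wordProd t (w * w') = wordProd t w * wordProd t w' := by
  induction w using perm_induction with
  | one => rw [wordProd_one, one_mul, one_mul]
  | step w i h ih =>
    rw [wordProd_descent ht h, mul_assoc, ← ih, mul_assoc, ← wordProd_simpleSwap_mul ht,
      simpleSwap_mul_cancel]

/-- The homomorphism from the symmetric group defined by elements which satisfy the Coxeter
relations. -/
def coxeterHom (ht : CoxeterRelations t) : Equiv.Perm (Fin n) →* U where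
  toFun := wordProd t
  map_one' := wordProd_one t
  map_mul' := wordProd_mul ht

theorem coxeterHom_simpleSwap (ht : CoxeterRelations t) (i : Fin (n - 1)) :
    coxeterHom ht (simpleSwap i) = t i := by
  change wordProd t (simpleSwap i) = _
  rw [← mul_one (simpleSwap i), wordProd_simpleSwap_mul ht, wordProd_one, mul_one]

end SymmetricGroup

/-! ### Shuffles, colourings and the places of the blocks. -/

section Shuffles

variable {r n : ℕ}

/-- The labellings of the places of the blocks by `Fin n` that are increasing on every block. -/
abbrev Shuffle (nh : Comp r n) : Type :=
  {α : (Σ k, Fin (nh.1 k)) ≃ Fin n // ∀ k, StrictMono fun j => α ⟨k, j⟩}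

theorem place_strictMono (nh : Comp r n) (k : Fin r) : StrictMono fun j => place nh ⟨k, j⟩ := by
  intro j j' h
  simp only [place, Equiv.trans_apply, finCongr_apply, Fin.lt_def, Fin.val_cast,
    finSigmaFinEquiv_apply]
  exact Nat.add_lt_add_left h _

/-- The standard labelling. -/
def placeShuffle (nh : Comp r n) : Shuffle nh := ⟨place nh, place_strictMono nh⟩

theorem place_lo (nh : Comp r n) (k : Fin r) (j : Fin (nh.1 k - 1)) :
    place nh ⟨k, lo j⟩ = lo (simplePlace nh k j) := rfl

theorem place_hi' (nh : Comp r n) (k : Fin r) (j : Fin (nh.1 k - 1)) :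
    place nh ⟨k, hi j⟩ = hi (simplePlace nh k j) := Fin.ext (place_hi nh k j)

/-- A simple transposition reverses the order of a single pair. Consequently exchanging positions of
different colours keeps a labelling increasing on each block. -/
theorem simpleSwap_lt {i : Fin (n - 1)} {x y : Fin n} (h : x < y) (hne : x = lo i → y ≠ hi i) :
    simpleSwap i x < simpleSwap i y := by
  have hl : ((lo i : Fin n) : ℕ) = i := rfl
  have hh : ((hi i : Fin n) : ℕ) = i + 1 := rfl
  have hne' : (x : ℕ) = i → (y : ℕ) ≠ i + 1 := fun h1 h2 => hne (Fin.ext h1) (Fin.ext h2)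
  have key : ∀ b : Fin n, ((simpleSwap i b : Fin n) : ℕ) =
      if (b : ℕ) = i then (i : ℕ) + 1 else if (b : ℕ) = i + 1 then (i : ℕ) else b := fun b => by
    by_cases h1 : b = lo i
    · subst h1; simp [hl, hh]
    by_cases h2 : b = hi i
    · subst h2; simp [hl, hh]
    have h1' : (b : ℕ) ≠ i := fun h => h1 (Fin.ext h)
    have h2' : (b : ℕ) ≠ i + 1 := fun h => h2 (Fin.ext h)
    rw [simpleSwap_of_ne h1 h2, if_neg h1', if_neg h2']
  rw [Fin.lt_def] at h ⊢
  rw [key, key]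
  split_ifs <;> omega

/-- The colouring of `Fin n` determined by a labelling. -/
def colour {nh : Comp r n} (α : (Σ k, Fin (nh.1 k)) ≃ Fin n) (i : Fin n) : Fin r := (α.symm i).1

theorem colour_apply {nh : Comp r n} (α : (Σ k, Fin (nh.1 k)) ≃ Fin n) (a : Σ k, Fin (nh.1 k)) :
    colour α (α a) = a.1 := by rw [colour, Equiv.symm_apply_apply]

/-- The adjacent positions `i` and `i + 1` have different colours. -/
abbrev Mixed {nh : Comp r n} (α : (Σ k, Fin (nh.1 k)) ≃ Fin n) (i : Fin (n - 1)) : Prop :=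
  colour α (lo i) ≠ colour α (hi i)

/-- Exchange adjacent positions of different colours in a shuffle. -/
def Shuffle.swap {nh : Comp r n} (α : Shuffle nh) (i : Fin (n - 1)) (h : Mixed α.1 i) :
    Shuffle nh :=
  ⟨α.1.trans (simpleSwap i), fun k j j' hj => by
    refine simpleSwap_lt (α.2 k hj) fun h1 h2 => h ?_
    rw [← h1, ← h2, colour_apply, colour_apply]⟩

theorem colour_swap {nh : Comp r n} (α : (Σ k, Fin (nh.1 k)) ≃ Fin n) (i : Fin (n - 1))
    (b : Fin n) : colour (α.trans (simpleSwap i)) b = colour α (simpleSwap i b) := by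
  change (α.symm ((simpleSwap i)⁻¹ b)).1 = _
  rw [simpleSwap_inv]; rfl

/-- The labelling is increasing on the block, so a place strictly between the two would need a label
strictly between `i` and `i + 1`. -/
theorem exists_of_not_mixed {nh : Comp r n} (α : Shuffle nh) (i : Fin (n - 1))
    (h : ¬ Mixed α.1 i) :
    ∃ (k : Fin r) (j : Fin (nh.1 k - 1)), α.1 ⟨k, lo j⟩ = lo i ∧ α.1 ⟨k, hi j⟩ = hi i := by
  rw [not_not] at h
  obtain ⟨⟨k, j⟩, h1⟩ := α.1.surjective (lo i)
  obtain ⟨⟨k', j'⟩, h2⟩ := α.1.surjective (hi i)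
  rw [← h1, ← h2, colour_apply, colour_apply] at h
  obtain rfl : k = k' := h
  have hl : ((lo i : Fin n) : ℕ) = i := rfl
  have hh : ((hi i : Fin n) : ℕ) = i + 1 := rfl
  have hlt : j < j' := (α.2 k).lt_iff_lt.1 (by
    change α.1 _ < α.1 _; rw [h1, h2, Fin.lt_def]; omega)
  have hj' : (j' : ℕ) = j + 1 := by
    by_contra hne
    have hjn := j'.2
    have hlt' : (j : ℕ) < j' := hlt
    have h3 : α.1 ⟨k, j⟩ < α.1 ⟨k, ⟨j + 1, by omega⟩⟩ := α.2 k (by rw [Fin.lt_def]; simp)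
    have h4 : α.1 ⟨k, ⟨j + 1, by omega⟩⟩ < α.1 ⟨k, j'⟩ :=
      α.2 k (by rw [Fin.lt_def]; change (j : ℕ) + 1 < j'; omega)
    rw [h1, Fin.lt_def] at h3
    rw [h2, Fin.lt_def] at h4
    omega
  have hjn := j'.2
  refine ⟨k, ⟨j, by omega⟩, h1, ?_⟩
  rw [← h2]
  congr 2
  exact Fin.ext hj'.symm

theorem not_mixed_of {nh : Comp r n} {α : (Σ k, Fin (nh.1 k)) ≃ Fin n} {i : Fin (n - 1)}
    {k : Fin r} {j j' : Fin (nh.1 k)} (h1 : α ⟨k, j⟩ = lo i) (h2 : α ⟨k, j'⟩ = hi i) :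
    ¬ Mixed α i := by
  rw [not_not, ← h1, ← h2, colour_apply, colour_apply]

/-- The permutation which carries the standard labelling to a given one. -/
def labelPerm {nh : Comp r n} (α : (Σ k, Fin (nh.1 k)) ≃ Fin n) : Equiv.Perm (Fin n) :=
  (place nh).symm.trans α

theorem labelPerm_place {nh : Comp r n} : labelPerm (place nh) = 1 := Equiv.symm_trans_self _

theorem labelPerm_apply {nh : Comp r n} (α : (Σ k, Fin (nh.1 k)) ≃ Fin n)
    (a : Σ k, Fin (nh.1 k)) : labelPerm α (place nh a) = α a := by
  simp [labelPerm]

/-- Both the standard labelling and `α` are increasing on every block, so inversions occur only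
between different blocks. Stripping descents from a shuffle therefore uses mixed exchanges only and
never leaves the shuffles. -/
theorem mixed_of_descent {nh : Comp r n} (α : Shuffle nh) (i : Fin (n - 1))
    (h : Descent (labelPerm α.1) i) : Mixed α.1 i := by
  intro hm
  obtain ⟨k, j, h1, h2⟩ := exists_of_not_mixed α i (not_not.2 hm)
  have key : ∀ a, (labelPerm α.1)⁻¹ (α.1 a) = place nh a := fun a => by
    rw [← labelPerm_apply]; exact Equiv.symm_apply_apply _ _
  rw [Descent, ← h1, ← h2, key, key] at h
  exact absurd (place_strictMono nh k (show lo j < hi j by simp [lo, hi, Fin.lt_def])) h.asymm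

/-- Conjugation of a transposition relabels its two entries. A simple transposition inside one
colour thus passes through `labelPerm α` and becomes a simple transposition of the Young subgroup.
-/
theorem simpleSwap_mul_labelPerm {nh : Comp r n} {α : (Σ k, Fin (nh.1 k)) ≃ Fin n}
    {i : Fin (n - 1)} {k : Fin r} {j : Fin (nh.1 k - 1)} (h1 : α ⟨k, lo j⟩ = lo i)
    (h2 : α ⟨k, hi j⟩ = hi i) :
    simpleSwap i * labelPerm α = labelPerm α * simpleSwap (simplePlace nh k j) := by
  rw [simpleSwap, simpleSwap, Equiv.mul_swap_eq_swap_mul, ← place_lo, ← place_hi', labelPerm_apply,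
    labelPerm_apply, h1, h2]

/-- The shuffles of all compositions. -/
abbrev Label (r n : ℕ) : Type := Σ nh : Comp r n, Shuffle nh

/-- The block sizes are the cardinalities of the colour classes, and an increasing enumeration is
determined by its range. -/
theorem Label.ext_colour {x y : Label r n} (h : colour x.2.1 = colour y.2.1) : x = y := by
  obtain ⟨nh, α⟩ := x
  obtain ⟨nh', β⟩ := y
  simp only at h
  have key : ∀ (mh : Comp r n) (γ : Shuffle mh) (k : Fin r),
      Set.range (fun j => γ.1 ⟨k, j⟩) = {i | colour γ.1 i = k} := fun mh γ k => by
    ext i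
    constructor
    · rintro ⟨j, rfl⟩
      exact colour_apply _ _
    · rintro rfl
      exact ⟨(γ.1.symm i).2, γ.1.apply_symm_apply i⟩
  have hcard : ∀ k, nh.1 k = nh'.1 k := fun k => by
    have h1 := Set.ncard_range_of_injective (α.2 k).injective
    have h2 := Set.ncard_range_of_injective (β.2 k).injective
    rw [key, Nat.card_eq_fintype_card, Fintype.card_fin] at h1 h2
    rw [← h1, ← h2, h]
  obtain rfl : nh = nh' := Subtype.ext (funext hcard)
  congr 1
  refine Subtype.ext (Equiv.ext fun ⟨k, j⟩ => ?_)
  have : (fun j => α.1 ⟨k, j⟩) = fun j => β.1 ⟨k, j⟩ :=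
    (StrictMono.range_inj (α.2 k) (β.2 k)).1 (by rw [key, key, h])
  exact congrFun this j

theorem Label.exists_colour (f : Fin n → Fin r) : ∃ x : Label r n, colour x.2.1 = f := by
  classical
  let S : Fin r → Finset (Fin n) := fun k => Finset.univ.filter fun i => f i = k
  have hS : ∑ k, (S k).card = n := by
    rw [← Finset.card_eq_sum_card_fiberwise (s := Finset.univ) (t := Finset.univ) (f := f)
      fun _ _ => Finset.mem_univ _]
    simp
  let nh : Comp r n := ⟨fun k => (S k).card, hS⟩
  let e : (Σ k, Fin (nh.1 k)) → Fin n := fun a => (S a.1).orderEmbOfFin rfl a.2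
  have he : ∀ a, f (e a) = a.1 := fun a =>
    (Finset.mem_filter.1 ((S a.1).orderEmbOfFin_mem rfl a.2)).2
  have hinj : Function.Injective e := by
    rintro ⟨k, j⟩ ⟨k', j'⟩ h
    have hk : k = k' := (he ⟨k, j⟩).symm.trans ((congrArg f h).trans (he ⟨k', j'⟩))
    subst hk
    exact congrArg (Sigma.mk k) (((S k).orderEmbOfFin rfl).injective h)
  have hbij : Function.Bijective e := (Fintype.bijective_iff_injective_and_card e).2
    ⟨hinj, by simpa using hS⟩
  refine ⟨⟨nh, Equiv.ofBijective e hbij, fun k => ((S k).orderEmbOfFin rfl).strictMono⟩, ?_⟩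
  funext i
  obtain ⟨a, rfl⟩ := hbij.surjective i
  rw [he]
  exact colour_apply (Equiv.ofBijective e hbij) a

/-- Labels are the same as colourings. -/
def labelEquiv : Label r n ≃ (Fin n → Fin r) :=
  Equiv.ofBijective (fun x => colour x.2.1) ⟨fun _ _ => Label.ext_colour, Label.exists_colour⟩

instance : Finite (Label r n) := Finite.of_equiv _ labelEquiv.symm

instance : Fintype (Label r n) := Fintype.ofFinite _

instance : Finite (Comp r n) :=
  Finite.of_surjective (fun x : Label r n => x.1) fun nh => ⟨⟨nh, placeShuffle nh⟩, rfl⟩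

instance : Fintype (Comp r n) := Fintype.ofFinite _

end Shuffles

/-! ### The action of `G^n`, of place permutations and of `t_{ij}` on `V(n̂)`. -/

section TensorAction

variable {F : Type u} [Field F] {G : Type u} [Group G] [Fintype G] {r n : ℕ}
  {V : Fin r → Type u} [∀ k, AddCommGroup (V k)] [∀ k, Module F (V k)]
  (ρ : ∀ k, Representation F G (V k))

/-- The action of `G^n` on `V(n̂)` through a labelling of the tensor factors. -/
def labelAct {nh : Comp r n} (α : (Σ k, Fin (nh.1 k)) ≃ Fin n) (g : Fin n → G) :
    VHat F V nh →ₗ[F] VHat F V nh :=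
  PiTensorProduct.map fun a => ρ a.1 (g (α a))

section

variable {nh : Comp r n} (α : (Σ k, Fin (nh.1 k)) ≃ Fin n)

@[simp] theorem labelAct_tprod (g : Fin n → G) (v : ∀ a : (Σ k, Fin (nh.1 k)), V a.1) :
    labelAct ρ α g (PiTensorProduct.tprod F v) =
      PiTensorProduct.tprod F fun a => ρ a.1 (g (α a)) (v a) :=
  PiTensorProduct.map_tprod _ _

theorem labelAct_one : labelAct ρ α 1 = 1 := by
  simp [labelAct]

theorem labelAct_mul (g h : Fin n → G) :
    labelAct ρ α (g * h) = labelAct ρ α g * labelAct ρ α h := by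
  simp [labelAct, PiTensorProduct.map_mul]

theorem labelAct_trans (w : Equiv.Perm (Fin n)) (g : Fin n → G) :
    labelAct ρ (α.trans w) g = labelAct ρ α (fun m => g (w m)) := rfl

theorem permute_update (π : ∀ k, Equiv.Perm (Fin (nh.1 k))) (v : ∀ a : (Σ k, Fin (nh.1 k)), V a.1)
    [DecidableEq (Σ k, Fin (nh.1 k))]
    (a : Σ k, Fin (nh.1 k)) (x : V a.1) :
    permute (nh := nh) π (Function.update v a x) =
      Function.update (permute π v) ⟨a.1, (π a.1)⁻¹ a.2⟩ x := by
  funext b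
  by_cases h : b = ⟨a.1, (π a.1)⁻¹ a.2⟩
  · subst h
    rw [Function.update_self]
    -- The type of an entry depends on its place, so values are compared heterogeneously until the
    -- places are identified.
    have : ∀ c : Σ k, Fin (nh.1 k), c = a → HEq (Function.update v a x c) x := by
      rintro c rfl; rw [Function.update_self]
    exact eq_of_heq (this ⟨a.1, π a.1 ((π a.1)⁻¹ a.2)⟩ (by simp))
  · rw [Function.update_of_ne h, permute, permute, Function.update_of_ne]
    rintro rfl
    exact h (by simp)

variable (F V) in
/-- The place permutations of `V(n̂)` inside the blocks. -/
def permV (π : ∀ k, Equiv.Perm (Fin (nh.1 k))) : VHat F V nh →ₗ[F] VHat F V nh :=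
  PiTensorProduct.lift
    { toFun := fun v => PiTensorProduct.tprod F (permute π v)
      map_update_add' := fun v a x y => by
        simp only [permute_update, MultilinearMap.map_update_add]
      map_update_smul' := fun v a c x => by
        simp only [permute_update, MultilinearMap.map_update_smul] }

@[simp] theorem permV_tprod (π : ∀ k, Equiv.Perm (Fin (nh.1 k)))
    (v : ∀ a : (Σ k, Fin (nh.1 k)), V a.1) :
    permV F V π (PiTensorProduct.tprod F v) = PiTensorProduct.tprod F (permute π v) := by
  rw [permV, PiTensorProduct.lift.tprod]; rfl

theorem permV_one : permV F V (1 : ∀ k, Equiv.Perm (Fin (nh.1 k))) = 1 := by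
  refine PiTensorProduct.ext (MultilinearMap.ext fun v => ?_)
  simp only [LinearMap.compMultilinearMap_apply, permV_tprod]
  rfl

/-- Reindexing a family is contravariant in the permutation, hence the reversed order. -/
theorem permV_mul (π π' : ∀ k, Equiv.Perm (Fin (nh.1 k))) :
    permV F V π * permV F V π' = permV F V (π' * π) := by
  refine PiTensorProduct.ext (MultilinearMap.ext fun v => ?_)
  simp only [LinearMap.compMultilinearMap_apply, Module.End.mul_apply, permV_tprod]
  rfl

theorem permV_labelAct (π : ∀ k, Equiv.Perm (Fin (nh.1 k))) (g : Fin n → G) (u : VHat F V nh) :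
    permV F V π (labelAct ρ α g u) =
      labelAct ρ ((Equiv.sigmaCongrRight π).trans α) g (permV F V π u) := by
  induction u using PiTensorProduct.induction_on with
  | smul_tprod c v => simp only [map_smul, labelAct_tprod, permV_tprod]; rfl
  | add x y hx hy => simp only [map_add, hx, hy]

/-- The simple transposition `j` of the block `k`, as an element of the Young subgroup. -/
def blockSwap (nh : Comp r n) (k : Fin r) (j : Fin (nh.1 k - 1)) :
    ∀ k, Equiv.Perm (Fin (nh.1 k)) :=
  Pi.mulSingle k (simpleSwap j)

theorem sigmaCongrRight_mulSingle_swap (k : Fin r) (j j' : Fin (nh.1 k)) :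
    Equiv.sigmaCongrRight (Pi.mulSingle k (Equiv.swap j j')) =
      Equiv.swap (⟨k, j⟩ : Σ k, Fin (nh.1 k)) ⟨k, j'⟩ := by
  ext1 ⟨l, m⟩
  by_cases h : l = k
  · subst h
    simp only [Equiv.sigmaCongrRight_apply, Pi.mulSingle_eq_same]
    rw [Equiv.swap_apply_def, Equiv.swap_apply_def]
    simp only [Sigma.mk.injEq, heq_eq_eq, true_and]
    split_ifs <;> rfl
  · rw [Equiv.swap_apply_of_ne_of_ne (by simp [h]) (by simp [h])]
    simp [Pi.mulSingle_eq_of_ne h]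

theorem sigmaCongrRight_blockSwap_trans {i : Fin (n - 1)} {k : Fin r} {j : Fin (nh.1 k - 1)}
    (h1 : α ⟨k, lo j⟩ = lo i) (h2 : α ⟨k, hi j⟩ = hi i) :
    (Equiv.sigmaCongrRight (blockSwap nh k j)).trans α = α.trans (simpleSwap i) := by
  ext1 a
  rw [blockSwap, simpleSwap, sigmaCongrRight_mulSingle_swap, simpleSwap, ← h1, ← h2,
    Equiv.trans_apply, Equiv.trans_apply, Equiv.swap_apply_def, Equiv.swap_apply_def]
  simp only [EmbeddingLike.apply_eq_iff_eq]
  split_ifs <;> rfl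

end

variable {c : Fin r → F} (hρ : SchurRelations ρ c)

include hρ

/-- Expanding the second argument in a basis produces matrix coefficients, to which the Schur
relation applies. With `B` the tensor product this says that `∑ h ⊗ h⁻¹` is `c k` times the flip. -/
theorem sum_bilinear_same {X : Type u} [AddCommGroup X] [Module F X] {k : Fin r}
    [FiniteDimensional F (V k)] (B : V k →ₗ[F] V k →ₗ[F] X) (x y : V k) :
    ∑ h : G, B (ρ k h x) (ρ k h⁻¹ y) = c k • B y x := by
  let b := Module.finBasis F (V k)
  have h1 : ∀ h : G, B (ρ k h x) (ρ k h⁻¹ y) =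
      ∑ i, B (b.coord i (ρ k h⁻¹ y) • ρ k h x) (b i) := fun h => by
    conv_lhs => rw [← b.sum_repr (ρ k h⁻¹ y), map_sum]
    simp
  simp only [h1]
  rw [Finset.sum_comm]
  simp only [← LinearMap.sum_apply, ← map_sum]
  rw [Finset.sum_congr rfl fun i _ => by rw [hρ.same k (b.coord i) x y]]
  conv_rhs => rw [← b.sum_repr x, map_sum, Finset.smul_sum]
  simp

theorem sum_bilinear_diff {X : Type u} [AddCommGroup X] [Module F X] {k l : Fin r} (hkl : k ≠ l)
    [FiniteDimensional F (V l)] (B : V k →ₗ[F] V l →ₗ[F] X) (x : V k) (y : V l) :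
    ∑ h : G, B (ρ k h x) (ρ l h⁻¹ y) = 0 := by
  let b := Module.finBasis F (V l)
  have h1 : ∀ h : G, B (ρ k h x) (ρ l h⁻¹ y) =
      ∑ i, B (b.coord i (ρ l h⁻¹ y) • ρ k h x) (b i) := fun h => by
    conv_lhs => rw [← b.sum_repr (ρ l h⁻¹ y), map_sum]
    simp
  simp only [h1]
  rw [Finset.sum_comm]
  simp only [← LinearMap.sum_apply, ← map_sum]
  rw [Finset.sum_congr rfl fun i _ => by rw [hρ.diff k l hkl (b.coord i) x y]]
  simp

omit hρ

variable {nh : Comp r n} (α : (Σ k, Fin (nh.1 k)) ≃ Fin n)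

/-- The pure tensors as a bilinear function of two of their factors. -/
def twoFactors (v : ∀ a : (Σ k, Fin (nh.1 k)), V a.1) {a a' : Σ k, Fin (nh.1 k)} (h : a ≠ a') :
    V a.1 →ₗ[F] V a'.1 →ₗ[F] VHat F V nh :=
  LinearMap.mk₂ F
    (fun x y => PiTensorProduct.tprod F (Function.update (Function.update v a x) a' y))
    (fun x x' y => by
      simp only [Function.update_comm h]
      rw [MultilinearMap.map_update_add])
    (fun d x y => by
      simp only [Function.update_comm h]
      rw [MultilinearMap.map_update_smul])
    (fun x y y' => by rw [MultilinearMap.map_update_add])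
    (fun d x y => by rw [MultilinearMap.map_update_smul])

theorem labelAct_two (v : ∀ a : (Σ k, Fin (nh.1 k)), V a.1) {a a' : Σ k, Fin (nh.1 k)}
    (h : a ≠ a') (x y : G) :
    labelAct ρ α (Pi.mulSingle (α a) x * Pi.mulSingle (α a') y) (PiTensorProduct.tprod F v) =
      twoFactors v h (ρ a.1 x (v a)) (ρ a'.1 y (v a')) := by
  rw [labelAct_tprod, twoFactors, LinearMap.mk₂_apply]
  congr 1
  funext b
  by_cases h2 : b = a'
  · subst h2
    simp [h.symm]
  by_cases h1 : b = a
  · subst h1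
    simp [h]
  simp [h1, h2]

/-- The action of `t_{αa, αa'}` on `V(n̂)`. -/
def tAct (i i' : Fin n) : VHat F V nh →ₗ[F] VHat F V nh :=
  ∑ h : G, labelAct ρ α (Pi.mulSingle i h * Pi.mulSingle i' h⁻¹)

include hρ

variable [∀ k, FiniteDimensional F (V k)]

theorem tAct_of_colour_ne {i i' : Fin n} (h : colour α i ≠ colour α i') : tAct ρ α i i' = 0 := by
  obtain ⟨a, rfl⟩ := α.surjective i
  obtain ⟨a', rfl⟩ := α.surjective i'
  rw [colour_apply, colour_apply] at h
  have hne : a ≠ a' := fun h' => h (congrArg _ h')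
  refine PiTensorProduct.ext (MultilinearMap.ext fun v => ?_)
  simp only [tAct, LinearMap.compMultilinearMap_apply, LinearMap.sum_apply,
    labelAct_two ρ α v hne]
  exact sum_bilinear_diff ρ hρ h _ _ _

/-- Only two tensor factors are moved, so `twoFactors` reduces the claim to the flip on `V k ⊗ V k`.
This is where the constants `c k` enter the action of the Hecke algebra. -/
theorem tAct_of_block (k : Fin r) {j j' : Fin (nh.1 k)} (h : j ≠ j') :
    tAct ρ α (α ⟨k, j⟩) (α ⟨k, j'⟩) = c k • permV F V (Pi.mulSingle k (Equiv.swap j j')) := by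
  have hne : (⟨k, j⟩ : Σ k, Fin (nh.1 k)) ≠ ⟨k, j'⟩ := fun h' => h (by simpa using h')
  refine PiTensorProduct.ext (MultilinearMap.ext fun v => ?_)
  simp only [tAct, LinearMap.compMultilinearMap_apply, LinearMap.sum_apply,
    labelAct_two ρ α v hne, LinearMap.smul_apply, permV_tprod]
  refine (sum_bilinear_same ρ hρ (k := k) (twoFactors (a := ⟨k, j⟩) (a' := ⟨k, j'⟩) v hne)
    (v ⟨k, j⟩) (v ⟨k, j'⟩)).trans ?_
  congr 1
  rw [twoFactors, LinearMap.mk₂_apply]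
  congr 1
  funext ⟨l, m⟩
  rw [permute]
  by_cases hl : l = k
  · subst hl
    have e : ∀ m, (Pi.mulSingle (M := fun k => Equiv.Perm (Fin (nh.1 k))) l (Equiv.swap j j') l) m =
        Equiv.swap j j' m := fun m => by rw [Pi.mulSingle_eq_same]
    have e' : v ⟨l, (Pi.mulSingle (M := fun k => Equiv.Perm (Fin (nh.1 k))) l
        (Equiv.swap j j') l) m⟩ = v ⟨l, Equiv.swap j j' m⟩ := by rw [e]
    refine Eq.trans ?_ e'.symm
    by_cases h2 : m = j'
    · subst h2
      rw [Function.update_self, Equiv.swap_apply_right]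
    by_cases h1 : m = j
    · subst h1
      rw [Function.update_of_ne hne, Function.update_self, Equiv.swap_apply_left]
    rw [Function.update_of_ne (by simpa using h2), Function.update_of_ne (by simpa using h1),
      Equiv.swap_apply_of_ne_of_ne h1 h2]
  · rw [Function.update_of_ne (by simp [hl]), Function.update_of_ne (by simp [hl]),
      Pi.mulSingle_eq_of_ne hl]
    rfl

end TensorAction

/-! ### Matrix units in the group algebra of `G^n`. -/

section MatrixUnits

variable {F : Type u} [Field F] {G : Type u} [Group G] [Fintype G] {r n : ℕ}
  {V : Fin r → Type u} [∀ k, AddCommGroup (V k)] [∀ k, Module F (V k)]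
  [∀ k, FiniteDimensional F (V k)]
  (ρ : ∀ k, Representation F G (V k)) (c : Fin r → F)

variable (F V) in
/-- The index set of the standard basis of `V(n̂)`. -/
abbrev HatIndex (nh : Comp r n) : Type :=
  ∀ a : (Σ k, Fin (nh.1 k)), Fin (Module.finrank F (V a.1))

variable (F V) in
/-- A basis of `V(n̂)` which consists of pure tensors. -/
def hatBasis (nh : Comp r n) : Module.Basis (HatIndex F V nh) F (VHat F V nh) :=
  Basis.piTensorProduct fun a => Module.finBasis F (V a.1)

instance (nh : Comp r n) : Module.Finite F (VHat F V nh) :=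
  Module.Finite.of_basis (hatBasis F V nh)

theorem hatBasis_coord_tprod (nh : Comp r n) (q : HatIndex F V nh)
    (v : ∀ a : (Σ k, Fin (nh.1 k)), V a.1) :
    (hatBasis F V nh).coord q (PiTensorProduct.tprod F v) =
      ∏ a, (Module.finBasis F (V a.1)).coord (q a) (v a) := by
  simp [hatBasis]

variable {nh nh' : Comp r n} (α : (Σ k, Fin (nh.1 k)) ≃ Fin n) (β : (Σ k, Fin (nh'.1 k)) ≃ Fin n)

/-- The sum over `G^n` factorises position by position. In the position `β b` the factor `b` of `u`
meets the factor `α.symm (β b)` of `v`. -/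
theorem sum_tprod_coefficient (q : HatIndex F V nh) (v : ∀ a : (Σ k, Fin (nh.1 k)), V a.1)
    (u : ∀ a : (Σ k, Fin (nh'.1 k)), V a.1) :
    ∑ g : Fin n → G, (hatBasis F V nh).coord q (labelAct ρ α g⁻¹ (PiTensorProduct.tprod F v)) •
        labelAct ρ β g (PiTensorProduct.tprod F u) =
      PiTensorProduct.tprod F fun b => ∑ h : G,
        (Module.finBasis F (V (α.symm (β b)).1)).coord (q (α.symm (β b)))
          (ρ (α.symm (β b)).1 h⁻¹ (v (α.symm (β b)))) • ρ b.1 h (u b) := by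
  classical
  rw [MultilinearMap.map_sum]
  refine Fintype.sum_equiv (Equiv.arrowCongr β.symm (Equiv.refl G)) _ _ fun g => ?_
  rw [MultilinearMap.map_smul_univ, labelAct_tprod, labelAct_tprod, hatBasis_coord_tprod]
  congr 1
  let ξ : (Σ k, Fin (nh.1 k)) → G → F := fun a h =>
    (Module.finBasis F (V a.1)).coord (q a) (ρ a.1 h⁻¹ (v a))
  refine Fintype.prod_equiv (α.trans β.symm) _ _ fun a => ?_
  change ξ a (g (α a)) = ξ (α.symm (β (β.symm (α a)))) (g (β (β.symm (α a))))
  rw [Equiv.apply_symm_apply, Equiv.symm_apply_apply]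

theorem coefficient_induction
    (q : HatIndex F V nh)
    (L : VHat F V nh →ₗ[F] VHat F V nh' →ₗ[F] VHat F V nh')
    (h : ∀ v u, ∑ g : Fin n → G,
      (hatBasis F V nh).coord q (labelAct ρ α g⁻¹ (PiTensorProduct.tprod F v)) •
        labelAct ρ β g (PiTensorProduct.tprod F u) =
        L (PiTensorProduct.tprod F v) (PiTensorProduct.tprod F u))
    (v : VHat F V nh) (u : VHat F V nh') :
    ∑ g : Fin n → G, (hatBasis F V nh).coord q (labelAct ρ α g⁻¹ v) • labelAct ρ β g u = L v u := by
  induction v using PiTensorProduct.induction_on with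
  | add x y hx hy =>
    simp only [map_add, add_smul, Finset.sum_add_distrib, hx, hy, LinearMap.add_apply]
  | smul_tprod d v =>
    simp only [map_smul, smul_eq_mul, mul_smul, ← Finset.smul_sum, LinearMap.smul_apply]
    congr 1
    induction u using PiTensorProduct.induction_on with
    | add x y hx hy => simp only [map_add, smul_add, Finset.sum_add_distrib, hx, hy]
    | smul_tprod d u =>
      simp only [map_smul, smul_comm _ d, ← Finset.smul_sum, h]

variable {c} (hρ : SchurRelations ρ c)

include hρ

theorem sum_hat_same (q : HatIndex F V nh) (v u : VHat F V nh) :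
    ∑ g : Fin n → G, (hatBasis F V nh).coord q (labelAct ρ α g⁻¹ v) • labelAct ρ α g u =
      (∏ a : (Σ k, Fin (nh.1 k)), c a.1) • (hatBasis F V nh).coord q u • v := by
  refine coefficient_induction ρ α α q ((∏ a : (Σ k, Fin (nh.1 k)), c a.1) •
    ((LinearMap.lsmul F (VHat F V nh)).comp ((hatBasis F V nh).coord q)).flip) (fun v u => ?_) v u
  rw [sum_tprod_coefficient]
  -- Keeping `a` apart from `b` avoids transporting vectors along `α.symm (α b) = b`.
  have key : ∀ b a : Σ k, Fin (nh.1 k), a = b → ∑ h : G,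
      (Module.finBasis F (V a.1)).coord (q a) (ρ a.1 h⁻¹ (v a)) • ρ b.1 h (u b) =
        c b.1 • (Module.finBasis F (V b.1)).coord (q b) (u b) • v b := by
    rintro b _ rfl
    exact hρ.same _ _ _ _
  rw [show (fun b : Σ k, Fin (nh.1 k) => _) = _ from
    funext fun b => key b _ (α.symm_apply_apply b)]
  rw [MultilinearMap.map_smul_univ, MultilinearMap.map_smul_univ, ← hatBasis_coord_tprod]
  rfl

/-- The colourings disagree at some position, and orthogonality makes the tensor factor at that
position zero. -/
theorem sum_hat_diff (h : colour α ≠ colour β) (q : HatIndex F V nh) (v : VHat F V nh)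
    (u : VHat F V nh') :
    ∑ g : Fin n → G, (hatBasis F V nh).coord q (labelAct ρ α g⁻¹ v) • labelAct ρ β g u = 0 := by
  refine coefficient_induction ρ α β q 0 (fun v u => ?_) v u
  obtain ⟨i, hi⟩ := Function.ne_iff.1 h
  rw [sum_tprod_coefficient]
  refine MultilinearMap.map_coord_zero _ (β.symm i) ?_
  refine hρ.diff _ _ (fun h' => hi ?_) _ _ _
  rw [colour, colour, h', Equiv.apply_symm_apply]

omit hρ
variable (c)

/-- The element of the group algebra of `G^n`, inside the wreath Hecke algebra, that acts on
`V(n̂)` as the rank one operator `u ↦ u_q • v`. -/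
def matUnit (q : HatIndex F V nh) : VHat F V nh →ₗ[F] Affine F G n :=
  (∏ a : (Σ k, Fin (nh.1 k)), c a.1)⁻¹ •
    ∑ g : Fin n → G, ((hatBasis F V nh).coord q ∘ₗ labelAct ρ α g⁻¹).smulRight (ofG F g)

theorem matUnit_apply (q : HatIndex F V nh) (v : VHat F V nh) :
    matUnit ρ c α q v = (∏ a : (Σ k, Fin (nh.1 k)), c a.1)⁻¹ •
      ∑ g : Fin n → G, (hatBasis F V nh).coord q (labelAct ρ α g⁻¹ v) • ofG F g := by
  simp [matUnit, LinearMap.sum_apply]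

theorem ofG_mul (g h : Fin n → G) : ofG F (g * h) = ofG F g * ofG F h := by
  rw [ofG, ofG, ofG, ← map_mul]
  exact RingQuot.mkAlgHom_rel F (Rel.g_mul g h)

theorem ofG_one : ofG F (1 : Fin n → G) = 1 := by
  rw [← map_one (toAffine F G n)]
  exact RingQuot.mkAlgHom_rel F Rel.g_one

theorem ofG_mul_matUnit (h : Fin n → G) (q : HatIndex F V nh) (v : VHat F V nh) :
    ofG F h * matUnit ρ c α q v = matUnit ρ c α q (labelAct ρ α h v) := by
  rw [matUnit_apply, matUnit_apply, mul_smul_comm, Finset.mul_sum]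
  congr 1
  refine Fintype.sum_equiv (Equiv.mulLeft h) _ _ fun g => ?_
  rw [mul_smul_comm, ← ofG_mul, Equiv.coe_mulLeft, mul_inv_rev, labelAct_mul,
    Module.End.mul_apply, ← Module.End.mul_apply (labelAct ρ α h⁻¹), ← labelAct_mul,
    inv_mul_cancel, labelAct_one, Module.End.one_apply]

include hρ in
-- The coefficient of `g` is a sum over colourings of products, over the positions, of traces
-- divided by Schur elements. It factorises into values of the regular character, which vanish
-- unless every component of `g` is trivial.
theorem sum_matUnit :
    ∑ x : Label r n, ∑ q : HatIndex F V x.1, matUnit ρ c x.2.1 q (hatBasis F V x.1 q) = 1 := by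
  classical
  have key : ∀ (x : Label r n) (g : Fin n → G), (∏ a : (Σ k, Fin (x.1.1 k)), c a.1)⁻¹ *
      ∑ q : HatIndex F V x.1, (hatBasis F V x.1).coord q
        (labelAct ρ x.2.1 g⁻¹ (hatBasis F V x.1 q)) =
      ∏ i, (c (labelEquiv x i))⁻¹ * LinearMap.trace F _ (ρ (labelEquiv x i) (g i)⁻¹) := by
    intro x g
    have h1 : ∀ q : HatIndex F V x.1, (hatBasis F V x.1).coord q
        (labelAct ρ x.2.1 g⁻¹ (hatBasis F V x.1 q)) =
        ∏ a, (Module.finBasis F (V a.1)).coord (q a)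
          (ρ a.1 (g (x.2.1 a))⁻¹ (Module.finBasis F (V a.1) (q a))) := fun q => by
      conv_lhs => enter [2]; rw [hatBasis, Basis.piTensorProduct_apply]
      rw [labelAct_tprod, hatBasis_coord_tprod]
      rfl
    simp only [h1]
    rw [← Fintype.prod_sum fun (a : Σ k, Fin (x.1.1 k)) j =>
      (Module.finBasis F (V a.1)).coord j
        (ρ a.1 (g (x.2.1 a))⁻¹ (Module.finBasis F (V a.1) j)), ← Finset.prod_inv_distrib,
      ← Finset.prod_mul_distrib]
    refine Fintype.prod_equiv x.2.1 _ _ fun a => ?_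
    have h2 : labelEquiv x (x.2.1 a) = a.1 := colour_apply _ _
    rw [h2]
    congr 1
    rw [LinearMap.trace_eq_matrix_trace F (Module.finBasis F (V a.1))]
    simp [Matrix.trace, LinearMap.toMatrix_apply]
  simp only [matUnit_apply, ← Finset.smul_sum]
  have h3 : ∀ x : Label r n, (∏ a : (Σ k, Fin (x.1.1 k)), c a.1)⁻¹ •
      ∑ q : HatIndex F V x.1, ∑ g : Fin n → G, (hatBasis F V x.1).coord q
        (labelAct ρ x.2.1 g⁻¹ (hatBasis F V x.1 q)) • ofG F g =
      ∑ g : Fin n → G, (∏ i, (c (labelEquiv x i))⁻¹ *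
        LinearMap.trace F _ (ρ (labelEquiv x i) (g i)⁻¹)) • ofG F g := fun x => by
    rw [Finset.sum_comm, Finset.smul_sum]
    refine Finset.sum_congr rfl fun g _ => ?_
    rw [← key, mul_smul, Finset.sum_smul]
  simp only [h3]
  rw [Finset.sum_comm]
  have h4 : ∀ g : Fin n → G, ∑ x : Label r n, (∏ i, (c (labelEquiv x i))⁻¹ *
        LinearMap.trace F _ (ρ (labelEquiv x i) (g i)⁻¹)) • ofG F g =
      (if g = 1 then (1 : F) else 0) • ofG F g := fun g => by
    rw [← Finset.sum_smul]
    congr 1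
    -- Labels are traded for arbitrary colourings, so that the sum of products becomes a product of
    -- sums.
    rw [Fintype.sum_equiv labelEquiv _ (fun f => ∏ i, (c (f i))⁻¹ *
      LinearMap.trace F _ (ρ (f i) (g i)⁻¹)) fun _ => rfl,
      ← Fintype.prod_sum fun i k => (c k)⁻¹ * LinearMap.trace F _ (ρ k (g i)⁻¹)]
    simp only [hρ.regular, inv_eq_one]
    rw [Fintype.prod_ite_zero]
    simp [funext_iff]
  simp only [h4]
  simp [ofG_one]

end MatrixUnits

/-! ### The presentation of the wreath Hecke algebra and its universal property. -/

section Presentation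

variable {F : Type u} [Field F] {G : Type u} [Group G] [Fintype G] {n : ℕ}

theorem x_comm (i j : Fin n) : x F G i * x F G j = x F G j * x F G i := by
  simp only [x, ← map_mul]
  exact RingQuot.mkAlgHom_rel F (Rel.x_comm i j)

theorem x_mul_ofG (i : Fin n) (a : Fin n → G) : x F G i * ofG F a = ofG F a * x F G i := by
  simp only [x, ofG, ← map_mul]
  exact RingQuot.mkAlgHom_rel F (Rel.x_g i a)

theorem s_coxeter : CoxeterRelations (fun i : Fin (n - 1) => s F G i) where
  sq i := by
    simp only [s, ← map_mul]
    exact (RingQuot.mkAlgHom_rel F (Rel.s_sq i)).trans (map_one _)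
  comm i j h := by
    simp only [s, ← map_mul]
    exact RingQuot.mkAlgHom_rel F (Rel.s_comm i j h)
  braid i j h := by
    simp only [s, ← map_mul]
    exact RingQuot.mkAlgHom_rel F (Rel.braid i j h)

theorem s_mul_x_lo (i : Fin (n - 1)) : s F G i * x F G (lo i) = x F G (hi i) * s F G i -
    ∑ h : G, ofG F (Pi.mulSingle (lo i) h * Pi.mulSingle (hi i) h⁻¹) := by
  simp only [s, x, ofG, ← map_mul, ← map_sum, ← map_sub]
  exact RingQuot.mkAlgHom_rel F (Rel.s_x i)

theorem s_mul_x_far (i : Fin (n - 1)) (j : Fin n) (h₁ : j ≠ lo i) (h₂ : j ≠ hi i) :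
    s F G i * x F G j = x F G j * s F G i := by
  simp only [s, x, ← map_mul]
  exact RingQuot.mkAlgHom_rel F (Rel.s_x_far i j h₁ h₂)

theorem s_mul_ofG (i : Fin (n - 1)) (a : Fin n → G) :
    s F G i * ofG F a = ofG F (fun m => a (simpleSwap i m)) * s F G i := by
  simp only [s, ofG, ← map_mul]
  exact RingQuot.mkAlgHom_rel F (Rel.s_g i a)

theorem Affine.induction {P : Affine F G n → Prop} (algebraMap : ∀ d : F, P (algebraMap F _ d))
    (ofG : ∀ a, P (ofG F a)) (s : ∀ i, P (s F G i)) (x : ∀ i, P (x F G i))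
    (mul : ∀ a b, P a → P b → P (a * b)) (add : ∀ a b, P a → P b → P (a + b))
    (a : Affine F G n) : P a := by
  obtain ⟨a, rfl⟩ := RingQuot.mkAlgHom_surjective F (Rel F G n) a
  change P (toAffine F G n a)
  induction a using FreeAlgebra.induction with
  | grade0 d => rw [AlgHom.commutes]; exact algebraMap d
  | grade1 y =>
    cases y with
    | g a => exact ofG a
    | s i => exact s i
    | x i => exact x i
  | mul a b ha hb => rw [map_mul]; exact mul _ _ ha hb
  | add a b ha hb => rw [map_add]; exact add _ _ ha hb

variable {B : Type*} [Ring B] [Algebra F B]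

/-- The defining relations of the wreath Hecke algebra, for elements of an algebra. -/
structure AffineRelations (gB : (Fin n → G) → B) (sB : Fin (n - 1) → B) (xB : Fin n → B) :
    Prop where
  g_one : gB 1 = 1
  g_mul (a b : Fin n → G) : gB (a * b) = gB a * gB b
  x_comm (i j : Fin n) : xB i * xB j = xB j * xB i
  x_g (i : Fin n) (a : Fin n → G) : xB i * gB a = gB a * xB i
  coxeter : CoxeterRelations sB
  s_x (i : Fin (n - 1)) : sB i * xB (lo i) = xB (hi i) * sB i -
    ∑ h : G, gB (Pi.mulSingle (lo i) h * Pi.mulSingle (hi i) h⁻¹)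
  s_x_far (i : Fin (n - 1)) (j : Fin n) (h₁ : j ≠ lo i) (h₂ : j ≠ hi i) :
    sB i * xB j = xB j * sB i
  s_g (i : Fin (n - 1)) (a : Fin n → G) : sB i * gB a = gB (fun m => a (simpleSwap i m)) * sB i

variable {gB : (Fin n → G) → B} {sB : Fin (n - 1) → B} {xB : Fin n → B}

/-- The values of a homomorphism on the generators. -/
def Gen.elim (gB : (Fin n → G) → B) (sB : Fin (n - 1) → B) (xB : Fin n → B) : Gen G n → B
  | .g a => gB a
  | .s i => sB i
  | .x i => xB i

variable (F) in
/-- The homomorphism from the wreath Hecke algebra given by elements which satisfy the defining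
relations. -/
def liftAffine (h : AffineRelations gB sB xB) : Affine F G n →ₐ[F] B :=
  RingQuot.liftAlgHom F ⟨FreeAlgebra.lift F (Gen.elim gB sB xB), by
    have hg : ∀ a, FreeAlgebra.lift F (Gen.elim gB sB xB) (fg F a) = gB a :=
      fun a => FreeAlgebra.lift_ι_apply _ _
    have hs : ∀ i, FreeAlgebra.lift F (Gen.elim gB sB xB) (fs F G i) = sB i :=
      fun i => FreeAlgebra.lift_ι_apply _ _
    have hx : ∀ i, FreeAlgebra.lift F (Gen.elim gB sB xB) (fx F G i) = xB i :=
      fun i => FreeAlgebra.lift_ι_apply _ _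
    intro a b hab
    cases hab with
    | g_one => simp only [hg, map_one, h.g_one]
    | g_mul a b => simp only [map_mul, hg, h.g_mul]
    | x_comm i j => simp only [map_mul, hx, h.x_comm i j]
    | x_g i a => simp only [map_mul, hx, hg, h.x_g i a]
    | s_sq i => simp only [map_mul, hs, map_one, h.coxeter.sq]
    | s_comm i j hij => simp only [map_mul, hs, h.coxeter.comm i j hij]
    | braid i j hij => simp only [map_mul, hs, h.coxeter.braid i j hij]
    | s_x i => simp only [map_mul, map_sub, ft, map_sum, hs, hx, hg, h.s_x]
    | s_x_far i j h₁ h₂ => simp only [map_mul, hs, hx, h.s_x_far i j h₁ h₂]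
    | s_g i a =>
      simp only [map_mul, hs, hg]
      exact h.s_g i a⟩

theorem liftAffine_toAffine (h : AffineRelations gB sB xB) (a : FreeAlgebra F (Gen G n)) :
    liftAffine F h (toAffine F G n a) = FreeAlgebra.lift F (Gen.elim gB sB xB) a :=
  RingQuot.liftAlgHom_mkAlgHom_apply _ _ _ _

@[simp] theorem liftAffine_ofG (h : AffineRelations gB sB xB) (a : Fin n → G) :
    liftAffine F h (ofG F a) = gB a :=
  (liftAffine_toAffine h _).trans (FreeAlgebra.lift_ι_apply _ _)

@[simp] theorem liftAffine_s (h : AffineRelations gB sB xB) (i : Fin (n - 1)) :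
    liftAffine F h (s F G i) = sB i :=
  (liftAffine_toAffine h _).trans (FreeAlgebra.lift_ι_apply _ _)

@[simp] theorem liftAffine_x (h : AffineRelations gB sB xB) (i : Fin n) :
    liftAffine F h (x F G i) = xB i :=
  (liftAffine_toAffine h _).trans (FreeAlgebra.lift_ι_apply _ _)

theorem Affine.commute_of_generators
    (f : Affine F G n →ₐ[F] B) {b : B} (hg : ∀ a, Commute (f (ofG F a)) b)
    (hs : ∀ i, Commute (f (s F G i)) b) (hx : ∀ i, Commute (f (x F G i)) b) (a : Affine F G n) :
    Commute (f a) b := by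
  induction a using Affine.induction with
  | algebraMap d => rw [AlgHom.commutes]; exact Algebra.commutes d b
  | ofG a => exact hg a
  | s i => exact hs i
  | x i => exact hx i
  | mul a b ha hb => rw [map_mul]; exact ha.mul_left hb
  | add a b ha hb => rw [map_add]; exact ha.add_left hb

theorem Affine.smul_comm_of_generators {M N : Type*} [AddCommGroup M] [AddCommGroup N]
    [Module F M] [Module F N] [Module (Affine F G n) M] [Module (Affine F G n) N]
    [IsScalarTower F (Affine F G n) M] [IsScalarTower F (Affine F G n) N] (f : M →ₗ[F] N)
    (hg : ∀ (a : Fin n → G) m, f (ofG F a • m) = ofG F a • f m)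
    (hs : ∀ (i : Fin (n - 1)) m, f (s F G i • m) = s F G i • f m)
    (hx : ∀ (i : Fin n) m, f (x F G i • m) = x F G i • f m) (a : Affine F G n) (m : M) :
    f (a • m) = a • f m := by
  induction a using Affine.induction generalizing m with
  | algebraMap d => rw [algebraMap_smul, algebraMap_smul, map_smul]
  | ofG a => exact hg a m
  | s i => exact hs i m
  | x i => exact hx i m
  | mul a b ha hb => rw [mul_smul, ha, hb, mul_smul]
  | add a b ha hb => rw [add_smul, map_add, ha, hb, add_smul]

end Presentation

/-! ### Homomorphisms from a tensor product of algebras. -/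

section TensorLift

/-- The monoid need not be commutative: sorting the factors only moves a `b k` past some `a l` with
`l ≠ k`. -/
theorem prod_ofFn_mul {C : Type*} [Monoid C] {r : ℕ} (a b : Fin r → C)
    (h : ∀ k l, k ≠ l → Commute (a k) (b l)) :
    (List.ofFn fun k => a k * b k).prod = (List.ofFn a).prod * (List.ofFn b).prod := by
  induction r with
  | zero => simp
  | succ r ih =>
    simp only [List.ofFn_succ, List.prod_cons]
    rw [ih _ _ fun k l hkl => h _ _ fun h' => hkl (Fin.succ_injective _ h')]
    have : Commute (b 0) (List.ofFn fun i => a (Fin.succ i)).prod := by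
      refine Commute.list_prod_right _ _ fun y hy => ?_
      obtain ⟨i, rfl⟩ := (List.mem_ofFn' _ _).1 hy
      exact (h _ _ (Fin.succ_ne_zero i)).symm
    rw [mul_assoc, mul_assoc, ← mul_assoc (b 0), this.eq, mul_assoc]

theorem prod_ofFn_eq {C : Type*} [Monoid C] {r : ℕ} (a : Fin r → C) (k : Fin r)
    (h : ∀ l, l ≠ k → a l = 1) : (List.ofFn a).prod = a k := by
  induction r with
  | zero => exact k.elim0
  | succ r ih =>
    simp only [List.ofFn_succ, List.prod_cons]
    cases k using Fin.cases with
    | zero =>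
      rw [List.prod_eq_one, mul_one]
      intro y hy
      obtain ⟨i, rfl⟩ := (List.mem_ofFn' _ _).1 hy
      exact h _ (Fin.succ_ne_zero i)
    | succ k =>
      rw [h 0 (Fin.succ_ne_zero k).symm, one_mul,
        ih _ k fun l hl => h _ fun h' => hl (Fin.succ_injective _ h')]

variable {F : Type u} [Field F] {r : ℕ} {B : Fin r → Type u} [∀ k, Ring (B k)]
  [∀ k, Algebra F (B k)] {C : Type*} [Ring C] [Algebra F C]

/-- The homomorphism from a tensor product of algebras defined by homomorphisms of the factors
whose images commute. -/
def liftCommuting (f : ∀ k, B k →ₐ[F] C)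
    (h : ∀ k l, k ≠ l → ∀ a b, Commute (f k a) (f l b)) : (⨂[F] k, B k) →ₐ[F] C :=
  PiTensorProduct.liftAlgHom
    ((MultilinearMap.mkPiAlgebraFin F r C).compLinearMap fun k => (f k).toLinearMap)
    (by
      rw [MultilinearMap.compLinearMap_apply, MultilinearMap.mkPiAlgebraFin_apply]
      simp)
    (by
      intro a b
      simp only [MultilinearMap.compLinearMap_apply, MultilinearMap.mkPiAlgebraFin_apply,
        Pi.mul_apply, AlgHom.toLinearMap_apply, map_mul]
      exact prod_ofFn_mul _ _ fun k l hkl => h k l hkl _ _)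

@[simp] theorem liftCommuting_single (f : ∀ k, B k →ₐ[F] C)
    (h : ∀ k l, k ≠ l → ∀ a b, Commute (f k a) (f l b)) (k : Fin r) (a : B k) :
    liftCommuting f h (PiTensorProduct.singleAlgHom k a) = f k a := by
  rw [liftCommuting, PiTensorProduct.singleAlgHom_apply, PiTensorProduct.liftAlgHom_apply,
    PiTensorProduct.lift.tprod, MultilinearMap.compLinearMap_apply,
    MultilinearMap.mkPiAlgebraFin_apply, prod_ofFn_eq _ k]
  · simp
  · intro l hl
    simp [Pi.mulSingle_eq_of_ne hl]

theorem commute_single {k l : Fin r} (h : k ≠ l) (a : B k) (b : B l) :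
    Commute (PiTensorProduct.singleAlgHom (R := F) (A := B) k a)
      (PiTensorProduct.singleAlgHom (R := F) (A := B) l b) := by
  simp only [PiTensorProduct.singleAlgHom_apply]
  exact Commute.tprod (Pi.mulSingle_commute h a b)

end TensorLift

/-! ### Equivariant maps and changes of labelling. -/

section Equivariant

variable {F : Type u} [Field F] {G : Type u} [Group G] [Fintype G] {r n : ℕ}
  {V : Fin r → Type u} [∀ k, AddCommGroup (V k)] [∀ k, Module F (V k)]
  [∀ k, FiniteDimensional F (V k)]
  (ρ : ∀ k, Representation F G (V k)) (c : Fin r → F)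
  {M : Type u} [AddCommGroup M] [Module F M] [Module (Affine F G n) M]
  [IsScalarTower F (Affine F G n) M]

/-- Equivariance of a linear map `V(n̂) → M` with respect to a labelling. -/
def LabelEquivariant {nh : Comp r n} (α : (Σ k, Fin (nh.1 k)) ≃ Fin n)
    (φ : VHat F V nh →ₗ[F] M) : Prop :=
  ∀ (g : Fin n → G) (v : VHat F V nh), φ (labelAct ρ α g v) = ofG F g • φ v

variable (F G M n) in
/-- The operator by which an element of the wreath Hecke algebra acts. -/
abbrev actOn : Affine F G n →ₐ[F] Module.End F M := Algebra.lsmul F F M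

variable {nh nh' : Comp r n} {α : (Σ k, Fin (nh.1 k)) ≃ Fin n}
  {β : (Σ k, Fin (nh'.1 k)) ≃ Fin n}

theorem smul_smul_comm' (d : F) (a : Affine F G n) (m : M) : a • d • m = d • a • m := by
  rw [← algebraMap_smul (Affine F G n) d, ← algebraMap_smul (Affine F G n) d, ← mul_smul,
    ← mul_smul, Algebra.commutes]

section

variable {ρ} {φ : VHat F V nh →ₗ[F] M} (hφ : LabelEquivariant ρ α φ)

include hφ

/-- The relation between `s_i` and `G^n` exchanges two components of the group element, which
amounts to exchanging two labels. -/
theorem LabelEquivariant.s_smul (i : Fin (n - 1)) :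
    LabelEquivariant ρ (α.trans (simpleSwap i)) (actOn F G n M (s F G i) ∘ₗ φ) := fun g v => by
  rw [labelAct_trans]
  change s F G i • φ _ = ofG F g • s F G i • φ v
  rw [hφ, ← mul_smul, s_mul_ofG, mul_smul]
  simp

theorem LabelEquivariant.x_smul (i : Fin n) :
    LabelEquivariant ρ α (actOn F G n M (x F G i) ∘ₗ φ) := fun g v => by
  change x F G i • φ _ = ofG F g • x F G i • φ v
  rw [hφ, ← mul_smul, x_mul_ofG, mul_smul]

theorem LabelEquivariant.t_smul (i i' : Fin n) (v : VHat F V nh) :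
    (∑ h : G, ofG F (Pi.mulSingle i h * Pi.mulSingle i' h⁻¹ : Fin n → G)) • φ v =
        φ (tAct ρ α i i' v) := by
  rw [Finset.sum_smul, tAct, LinearMap.sum_apply, map_sum]
  exact Finset.sum_congr rfl fun h _ => (hφ _ _).symm

end

variable {c} (hρ : SchurRelations ρ c)

theorem isUnit_schur (hρ : SchurRelations ρ c) (nh : Comp r n) :
    (∏ a : (Σ k, Fin (nh.1 k)), c a.1) ≠ 0 := Finset.prod_ne_zero_iff.2 fun a _ => hρ.ne_zero a.1

include hρ

theorem matUnit_smul_same {φ : VHat F V nh →ₗ[F] M} (hφ : LabelEquivariant ρ α φ)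
    (q : HatIndex F V nh) (v u : VHat F V nh) :
    matUnit ρ c α q v • φ u = (hatBasis F V nh).coord q u • φ v := by
  have h := congrArg φ (sum_hat_same ρ α hρ q v u)
  rw [map_sum, map_smul, map_smul] at h
  rw [matUnit_apply, smul_assoc, Finset.sum_smul, inv_smul_eq_iff₀ (isUnit_schur ρ hρ nh), ← h]
  refine Finset.sum_congr rfl fun g _ => ?_
  rw [map_smul, hφ, smul_assoc]

theorem matUnit_smul_diff {φ : VHat F V nh' →ₗ[F] M} (hφ : LabelEquivariant ρ β φ)
    (h : colour α ≠ colour β) (q : HatIndex F V nh) (v : VHat F V nh) (u : VHat F V nh') :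
    matUnit ρ c α q v • φ u = 0 := by
  have h := congrArg φ (sum_hat_diff ρ α β hρ h q v u)
  rw [map_sum, map_zero] at h
  rw [matUnit_apply, smul_assoc, Finset.sum_smul]
  refine (congrArg _ ?_).trans (smul_zero _)
  rw [← h]
  refine Finset.sum_congr rfl fun g _ => ?_
  rw [map_smul, hφ, smul_assoc]

/-- The correction term `t_{i,i+1}` acts by zero between different colours, so `s_i` merely permutes
the polynomial generators. -/
theorem LabelEquivariant.x_s_smul {φ : VHat F V nh →ₗ[F] M} (hφ : LabelEquivariant ρ α φ)
    {i : Fin (n - 1)} (hm : Mixed α i) (b : Fin n) (v : VHat F V nh) :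
    s F G i • x F G b • φ v = x F G (simpleSwap i b) • s F G i • φ v := by
  have key : ∀ {nh : Comp r n} {α : (Σ k, Fin (nh.1 k)) ≃ Fin n} {φ : VHat F V nh →ₗ[F] M}
      (_ : LabelEquivariant ρ α φ) (_ : Mixed α i) (v : VHat F V nh),
      s F G i • x F G (lo i) • φ v = x F G (hi i) • s F G i • φ v := by
    intro nh α φ hφ hm v
    rw [← mul_smul, s_mul_x_lo, sub_smul, hφ.t_smul, tAct_of_colour_ne ρ hρ α hm, mul_smul]
    simp
  by_cases h1 : b = lo i
  · subst h1
    rw [simpleSwap_lo, key hφ hm]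
  by_cases h2 : b = hi i
  · subst h2
    rw [simpleSwap_hi]
    -- The case of `hi i` is the case of `lo i` for `s_i φ`, whose labelling is again mixed at `i`,
    -- multiplied by `s_i`. This is why `key` is stated for all labellings and maps.
    have h3 := key (hφ.s_smul i) (v := v) (by
      rw [Mixed, colour_swap, colour_swap, simpleSwap_lo, simpleSwap_hi]; exact hm.symm)
    change s F G i • x F G (lo i) • s F G i • φ v =
      x F G (hi i) • s F G i • s F G i • φ v at h3
    have hs : ∀ m : M, s F G i • s F G i • m = m := fun m => by
      rw [← mul_smul, s_coxeter.sq, one_smul]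
    rw [hs] at h3
    rw [← h3, hs]
  · rw [simpleSwap_of_ne h1 h2, ← mul_smul, s_mul_x_far i b h1 h2, mul_smul]

omit hρ
variable (c)

/-- The equivariant map determined by a vector and a coordinate. -/
def matUnitHom (α : (Σ k, Fin (nh.1 k)) ≃ Fin n) (q : HatIndex F V nh) (m : M) :
    VHat F V nh →ₗ[F] M :=
  { toFun := fun v => matUnit ρ c α q v • m
    map_add' := fun v w => by rw [map_add, add_smul]
    map_smul' := fun d v => by rw [map_smul, RingHom.id_apply, smul_assoc] }

theorem matUnitHom_equivariant (q : HatIndex F V nh) (m : M) :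
    LabelEquivariant ρ α (matUnitHom ρ c α q m) := fun g v => by
  change matUnit ρ c α q _ • m = ofG F g • matUnit ρ c α q v • m
  rw [← mul_smul, ofG_mul_matUnit]

variable {c}

include hρ in
-- This is the simplicity of `V(n̂)`: a nonzero `w` in the kernel has a nonzero coordinate `q`, and
-- the matrix unit sending `w` to that coordinate times `v` forces `φ v = 0`.
theorem LabelEquivariant.injective_or_eq_zero {φ : VHat F V nh →ₗ[F] M}
    (hφ : LabelEquivariant ρ α φ) : Function.Injective φ ∨ φ = 0 := by
  by_cases h : Function.Injective φ
  · exact Or.inl h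
  right
  rw [← LinearMap.ker_eq_bot, Submodule.eq_bot_iff] at h
  push Not at h
  obtain ⟨w, hw, hw0⟩ := h
  obtain ⟨q, hq⟩ : ∃ q, (hatBasis F V nh).coord q w ≠ 0 := by
    by_contra h
    push Not at h
    exact hw0 ((hatBasis F V nh).forall_coord_eq_zero_iff.1 h)
  ext1
  ext v
  have h1 := matUnit_smul_same ρ hρ hφ q (PiTensorProduct.tprod F v) w
  rw [LinearMap.mem_ker.1 hw, smul_zero] at h1
  exact (smul_eq_zero.1 h1.symm).resolve_left hq

include hρ in
-- The isotypical condition is automatic: a nonzero equivariant map is injective, so its image is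
-- one of the submodules whose sum is `I_{n̂} M`.
theorem mem_homHat_iff (φ : VHat F V nh →ₗ[F] M) :
    φ ∈ HomHat ρ M nh ↔ LabelEquivariant ρ (place nh) φ := by
  refine ⟨fun h => h.1, fun h => ⟨h, fun v => ?_⟩⟩
  rcases LabelEquivariant.injective_or_eq_zero ρ hρ h with h1 | h1
  · have h2 : LinearMap.range φ ≤ isotypical ρ M nh := le_sSup ⟨φ, h, h1, rfl⟩
    exact h2 (LinearMap.mem_range_self φ v)
  · rw [h1]
    exact Submodule.zero_mem _

end Equivariant

/-! ### The action of `A_{n̂,r}` on the spaces of homomorphisms. -/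

section BlockAction

variable {F : Type u} [Field F] {G : Type u} [Group G] [Fintype G] {r n : ℕ}
  {V : Fin r → Type u} [∀ k, AddCommGroup (V k)] [∀ k, Module F (V k)]
  [∀ k, FiniteDimensional F (V k)]
  (ρ : ∀ k, Representation F G (V k)) {c : Fin r → F} (hρ : SchurRelations ρ c)
  (M : Type u) [AddCommGroup M] [Module F M] [Module (Affine F G n) M]
  [IsScalarTower F (Affine F G n) M] (nh : Comp r n)

/-- Multiplication by `s` exchanges two labels of the standard labelling, and the place permutation
exchanges them back. -/
theorem homHat_permV {φ : VHat F V nh →ₗ[F] M} (hφ : LabelEquivariant ρ (place nh) φ) (k : Fin r)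
    (j : Fin (nh.1 k - 1)) : LabelEquivariant ρ (place nh)
      (actOn F G n M (s F G (simplePlace nh k j)) ∘ₗ φ ∘ₗ permV F V (blockSwap nh k j)) := by
  intro g v
  change (actOn F G n M (s F G (simplePlace nh k j)) ∘ₗ φ)
      (permV F V (blockSwap nh k j) (labelAct ρ (place nh) g v)) =
    ofG F g • (actOn F G n M (s F G (simplePlace nh k j)) ∘ₗ φ) (permV F V (blockSwap nh k j) v)
  rw [permV_labelAct,
    sigmaCongrRight_blockSwap_trans (place nh) (place_lo nh k j) (place_hi' nh k j)]
  exact hφ.s_smul _ g _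

/-- The action of the simple transpositions of the Young subgroup on the space of
homomorphisms. -/
def homS (k : Fin r) (j : Fin (nh.1 k - 1)) : Module.End F (HomHat ρ M nh) :=
  LinearMap.restrict
    (LinearMap.compRight F (actOn F G n M (s F G (simplePlace nh k j))) ∘ₗ
      LinearMap.lcomp F M (permV F V (blockSwap nh k j)))
    fun φ hφ => (mem_homHat_iff ρ hρ _).2
      (homHat_permV ρ M nh ((mem_homHat_iff ρ hρ φ).1 hφ) k j)

theorem homS_apply (k : Fin r) (j : Fin (nh.1 k - 1)) (φ : HomHat ρ M nh) (v : VHat F V nh) :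
    (homS ρ hρ M nh k j φ).1 v =
      s F G (simplePlace nh k j) • φ.1 (permV F V (blockSwap nh k j) v) := rfl

/-- The action of the polynomial generators on the space of homomorphisms. -/
def homY (k : Fin r) (j : Fin (nh.1 k)) : Module.End F (HomHat ρ M nh) :=
  (c k)⁻¹ • LinearMap.restrict
    (LinearMap.compRight F (actOn F G n M (x F G (place nh ⟨k, j⟩))))
    fun φ hφ => (mem_homHat_iff ρ hρ _).2 (((mem_homHat_iff ρ hρ φ).1 hφ).x_smul _)

theorem homY_apply (k : Fin r) (j : Fin (nh.1 k)) (φ : HomHat ρ M nh) (v : VHat F V nh) :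
    (homY ρ hρ M nh k j φ).1 v = (c k)⁻¹ • x F G (place nh ⟨k, j⟩) • φ.1 v := rfl

theorem place_val (k : Fin r) (j : Fin (nh.1 k)) :
    (place nh ⟨k, j⟩ : ℕ) = (∑ i : Fin k, nh.1 (Fin.castLE k.2.le i)) + j := by
  simp [place, finSigmaFinEquiv_apply]

theorem simplePlace_far {k : Fin r} {j j' : Fin (nh.1 k - 1)}
    (h : j.1 + 1 < j'.1 ∨ j'.1 + 1 < j.1) :
    (simplePlace nh k j).1 + 1 < (simplePlace nh k j').1 ∨
      (simplePlace nh k j').1 + 1 < (simplePlace nh k j).1 := by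
  simp only [simplePlace, place_val, lo]
  omega

theorem simplePlace_succ {k : Fin r} {j j' : Fin (nh.1 k - 1)} (h : j.1 + 1 = j'.1) :
    (simplePlace nh k j).1 + 1 = (simplePlace nh k j').1 := by
  simp only [simplePlace, place_val, lo]
  omega

/-- Otherwise two places of different blocks would receive the same number, contrary to the
injectivity of `place`. -/
theorem simplePlace_far_of_ne {k k' : Fin r} (h : k ≠ k') (j : Fin (nh.1 k - 1))
    (j' : Fin (nh.1 k' - 1)) :
    (simplePlace nh k j).1 + 1 < (simplePlace nh k' j').1 ∨
      (simplePlace nh k' j').1 + 1 < (simplePlace nh k j).1 := by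
  have h1 : (place nh ⟨k, lo j⟩).1 ≠ (place nh ⟨k', lo j'⟩).1 := fun e =>
    h (congrArg Sigma.fst ((place nh).injective (Fin.ext e)))
  have h2 : (place nh ⟨k, hi j⟩).1 ≠ (place nh ⟨k', lo j'⟩).1 := fun e =>
    h (congrArg Sigma.fst ((place nh).injective (Fin.ext e)))
  have h3 : (place nh ⟨k, lo j⟩).1 ≠ (place nh ⟨k', hi j'⟩).1 := fun e =>
    h (congrArg Sigma.fst ((place nh).injective (Fin.ext e)))
  rw [place_hi] at h2 h3
  simp only [simplePlace]
  omega

theorem blockSwap_mul (k : Fin r) (j j' : Fin (nh.1 k - 1)) :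
    blockSwap nh k j * blockSwap nh k j' =
      Pi.mulSingle (M := fun k => Equiv.Perm (Fin (nh.1 k))) k (simpleSwap j * simpleSwap j') :=
  (Pi.mulSingle_mul (f := fun k => Equiv.Perm (Fin (nh.1 k))) k _ _).symm

theorem permV_coxeter (k : Fin r) :
    CoxeterRelations fun j : Fin (nh.1 k - 1) => permV F V (blockSwap nh k j) where
  sq j := by
    rw [permV_mul, blockSwap_mul, simpleSwap_mul_self, Pi.mulSingle_one, permV_one]
  comm i j h := by
    rw [permV_mul, permV_mul, blockSwap_mul, blockSwap_mul, simpleSwap_mul_comm h]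
  braid i j h := by
    simp only [permV_mul, blockSwap]
    simp only [← Pi.mulSingle_mul, ← mul_assoc]
    rw [simpleSwap_braid h]

theorem permV_comm_of_ne {k k' : Fin r} (h : k ≠ k') (j : Fin (nh.1 k - 1))
    (j' : Fin (nh.1 k' - 1)) : permV F V (blockSwap nh k j) * permV F V (blockSwap nh k' j') =
      permV F V (blockSwap nh k' j') * permV F V (blockSwap nh k j) := by
  rw [permV_mul, permV_mul]
  exact congrArg _ (Pi.mulSingle_commute (f := fun k => Equiv.Perm (Fin (nh.1 k))) h.symm _ _)

theorem homS_coxeter (k : Fin r) : CoxeterRelations (homS ρ hρ M nh k) where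
  sq j := by
    refine LinearMap.ext fun φ => Subtype.ext (LinearMap.ext fun v => ?_)
    simp only [Module.End.mul_apply, homS_apply, Module.End.one_apply]
    rw [← Module.End.mul_apply (permV F V _), (permV_coxeter nh k).sq, ← mul_smul, s_coxeter.sq,
      one_smul, Module.End.one_apply]
  comm i j h := by
    refine LinearMap.ext fun φ => Subtype.ext (LinearMap.ext fun v => ?_)
    simp only [Module.End.mul_apply, homS_apply]
    rw [← Module.End.mul_apply (permV F V _), (permV_coxeter nh k).comm _ _ h.symm, ← mul_smul,
      s_coxeter.comm _ _ (simplePlace_far nh h), mul_smul, Module.End.mul_apply]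
  braid i j h := by
    refine LinearMap.ext fun φ => Subtype.ext (LinearMap.ext fun v => ?_)
    simp only [Module.End.mul_apply, homS_apply]
    have h1 := LinearMap.congr_fun ((permV_coxeter (F := F) (V := V) nh k).braid i j h) v
    simp only [Module.End.mul_apply] at h1
    rw [h1]
    simp only [← mul_smul, ← mul_assoc]
    rw [s_coxeter.braid _ _ (simplePlace_succ nh h)]

theorem homY_comm (k k' : Fin r) (j : Fin (nh.1 k)) (j' : Fin (nh.1 k')) :
    homY ρ hρ M nh k j * homY ρ hρ M nh k' j' = homY ρ hρ M nh k' j' * homY ρ hρ M nh k j := by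
  refine LinearMap.ext fun φ => Subtype.ext (LinearMap.ext fun v => ?_)
  simp only [Module.End.mul_apply, homY_apply, smul_smul_comm']
  rw [smul_comm, ← mul_smul (x F G _), x_comm, mul_smul]

theorem homS_homY_far {k k' : Fin r} (j : Fin (nh.1 k - 1)) (j' : Fin (nh.1 k'))
    (h1 : place nh ⟨k', j'⟩ ≠ place nh ⟨k, lo j⟩) (h2 : place nh ⟨k', j'⟩ ≠ place nh ⟨k, hi j⟩) :
    homS ρ hρ M nh k j * homY ρ hρ M nh k' j' = homY ρ hρ M nh k' j' * homS ρ hρ M nh k j := by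
  rw [place_lo] at h1
  rw [place_hi'] at h2
  refine LinearMap.ext fun φ => Subtype.ext (LinearMap.ext fun v => ?_)
  simp only [Module.End.mul_apply, homY_apply, homS_apply, smul_smul_comm']
  rw [← mul_smul (s F G _), s_mul_x_far _ _ h1 h2, mul_smul]

/-- The correction `t` acts as `c k` times the flip. The flip cancels the one built into `homS`, and
`c k` cancels the normalisation of `homY`, which leaves the correction `1` of the degenerate
relation. -/
theorem homS_homY_lo (k : Fin r) (j : Fin (nh.1 k - 1)) :
    homS ρ hρ M nh k j * homY ρ hρ M nh k (lo j) =
      homY ρ hρ M nh k (hi j) * homS ρ hρ M nh k j - 1 := by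
  refine LinearMap.ext fun φ => Subtype.ext (LinearMap.ext fun v => ?_)
  have hφ := (mem_homHat_iff ρ hρ φ.1).1 φ.2
  have ht := hφ.t_smul (lo (simplePlace nh k j)) (hi (simplePlace nh k j))
    (permV F V (blockSwap nh k j) v)
  rw [← place_lo, ← place_hi', tAct_of_block ρ hρ (place nh) k (lo_ne_hi j)] at ht
  have hs : permV F V (Pi.mulSingle k (Equiv.swap (lo j) (hi j)))
      (permV F V (blockSwap nh k j) v) = v := by
    change permV F V (blockSwap nh k j) (permV F V (blockSwap nh k j) v) = v
    rw [← Module.End.mul_apply, (permV_coxeter nh k).sq, Module.End.one_apply]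
  rw [LinearMap.smul_apply, hs, map_smul] at ht
  change (homS ρ hρ M nh k j (homY ρ hρ M nh k (lo j) φ)).1 v =
    (homY ρ hρ M nh k (hi j) (homS ρ hρ M nh k j φ)).1 v - φ.1 v
  simp only [homY_apply, homS_apply, smul_smul_comm']
  rw [← mul_smul (s F G _), place_lo, s_mul_x_lo, sub_smul, ← place_lo, ← place_hi', ht, smul_sub,
    inv_smul_smul₀ (hρ.ne_zero k), mul_smul]

/-- The action of a degenerate affine Hecke algebra on the space of homomorphisms. -/
def homBlock (k : Fin r) : DegAffine F (nh.1 k) →ₐ[F] Module.End F (HomHat ρ M nh) :=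
  liftAffine F (G := PUnit.{u + 1}) (n := nh.1 k) (gB := fun _ => 1) (sB := homS ρ hρ M nh k)
    (xB := homY ρ hρ M nh k)
    { g_one := rfl
      g_mul := fun _ _ => (mul_one _).symm
      x_comm := homY_comm ρ hρ M nh k k
      x_g := fun _ _ => by rw [mul_one, one_mul]
      coxeter := homS_coxeter ρ hρ M nh k
      s_x := fun j => by simp [homS_homY_lo]
      s_x_far := fun j j' h₁ h₂ => homS_homY_far ρ hρ M nh j j'
        (fun h => h₁ (by simpa using h)) (fun h => h₂ (by simpa using h))
      s_g := fun _ _ => by rw [mul_one, one_mul] }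

theorem homBlock_commute {k k' : Fin r} (h : k ≠ k') (a : DegAffine F (nh.1 k))
    (b : DegAffine F (nh.1 k')) :
    Commute (homBlock ρ hρ M nh k a) (homBlock ρ hρ M nh k' b) := by
  refine Affine.commute_of_generators
    (B := Module.End F (HomHat ρ M nh)) (homBlock ρ hρ M nh k) (fun a => ?_) (fun i => ?_)
    (fun i => ?_) a <;>
    refine (Affine.commute_of_generators
    (B := Module.End F (HomHat ρ M nh)) (homBlock ρ hρ M nh k') (fun a => ?_) (fun i' => ?_)
        (fun i' => ?_) b).symm <;>
    simp only [homBlock, liftAffine_ofG, liftAffine_s, liftAffine_x, Commute.one_left,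
      Commute.one_right]
  · refine LinearMap.ext fun φ => Subtype.ext (LinearMap.ext fun v => ?_)
    simp only [Module.End.mul_apply, homS_apply]
    rw [← Module.End.mul_apply (permV F V _), permV_comm_of_ne nh h, ← mul_smul,
      s_coxeter.comm _ _ (simplePlace_far_of_ne nh h.symm _ _), mul_smul, Module.End.mul_apply]
  · exact (homS_homY_far ρ hρ M nh i i' (fun e =>
      h (by simpa using congrArg Sigma.fst ((place nh).injective e.symm)))
      (fun e => h (by simpa using congrArg Sigma.fst ((place nh).injective e.symm)))).symm
  · exact homS_homY_far ρ hρ M nh i' i (fun e =>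
      h (by simpa using congrArg Sigma.fst ((place nh).injective e)))
      (fun e => h (by simpa using congrArg Sigma.fst ((place nh).injective e)))
  · exact homY_comm ρ hρ M nh _ _ _ _

/-- The action of `A_{n̂,r}` on the space of homomorphisms. -/
def homAct : AHat F nh →ₐ[F] Module.End F (HomHat ρ M nh) :=
  liftCommuting (F := F) (B := fun k => DegAffine F (nh.1 k))
    (C := Module.End F (HomHat ρ M nh)) (homBlock ρ hρ M nh) fun _ _ h =>
        homBlock_commute ρ hρ M nh h

theorem homAct_s (k : Fin r) (j : Fin (nh.1 k - 1)) :
    homAct ρ hρ M nh (PiTensorProduct.singleAlgHom k (s F PUnit.{u + 1} j)) =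
      homS ρ hρ M nh k j := by
  rw [homAct, liftCommuting_single]
  simp [homBlock]

theorem homAct_y (k : Fin r) (j : Fin (nh.1 k)) :
    homAct ρ hρ M nh (PiTensorProduct.singleAlgHom k (x F PUnit.{u + 1} j)) =
      homY ρ hρ M nh k j := by
  rw [homAct, liftCommuting_single]
  simp [homBlock]

end BlockAction

/-! ### Generators of the tensor product of the degenerate affine Hecke algebras. -/

section TensorInduction

variable {F : Type u} [Field F] {r : ℕ} {B : Fin r → Type u} [∀ k, Ring (B k)]
  [∀ k, Algebra F (B k)]

/-- By the universal property, the homomorphism lifted from the inclusions of the factors is the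
identity; it is evaluated on a pure tensor. -/
theorem tprod_eq_prod_single (a : ∀ k, B k) :
    PiTensorProduct.tprod F a =
      (List.ofFn fun k => PiTensorProduct.singleAlgHom (R := F) (A := B) k (a k)).prod := by
  have h : liftCommuting (F := F) (B := B) (C := ⨂[F] k, B k)
      (fun k => PiTensorProduct.singleAlgHom k) (fun k l h a b => commute_single h a b) =
      AlgHom.id F _ := by
    refine PiTensorProduct.algHom_ext fun k => AlgHom.ext fun a => ?_
    rw [AlgHom.comp_apply, liftCommuting_single]
    rfl
  have h2 := DFunLike.congr_fun h (PiTensorProduct.tprod F a)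
  rw [liftCommuting, PiTensorProduct.liftAlgHom_apply, PiTensorProduct.lift.tprod,
    MultilinearMap.compLinearMap_apply, MultilinearMap.mkPiAlgebraFin_apply] at h2
  exact h2.symm

theorem tensor_induction {P : (⨂[F] k, B k) → Prop}
    (single : ∀ k a, P (PiTensorProduct.singleAlgHom k a)) (smul : ∀ (d : F) a, P a → P (d • a))
    (one : P 1) (mul : ∀ a b, P a → P b → P (a * b)) (add : ∀ a b, P a → P b → P (a + b))
    (a : ⨂[F] k, B k) : P a := by
  induction a using PiTensorProduct.induction_on with
  | smul_tprod d a =>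
    refine smul d _ ?_
    rw [tprod_eq_prod_single]
    refine List.prod_induction P mul one fun y hy => ?_
    obtain ⟨k, rfl⟩ := (List.mem_ofFn' _ _).1 hy
    exact single k _
  | add a b ha hb => exact add a b ha hb

theorem ofG_punit {n : ℕ} (a : Fin n → PUnit.{u + 1}) : ofG F a = 1 := by
  rw [← ofG_one]; rfl

theorem hat_intertwine {r n : ℕ} {nh : Comp r n} {X Y : Type*} [AddCommGroup X] [Module F X]
    [AddCommGroup Y] [Module F Y] (τ : AHat F nh →ₐ[F] Module.End F X)
    (τ' : AHat F nh →ₐ[F] Module.End F Y) (f : X →ₗ[F] Y)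
    (hs : ∀ k j w, f (τ (PiTensorProduct.singleAlgHom k (s F PUnit.{u + 1} j)) w) =
      τ' (PiTensorProduct.singleAlgHom k (s F PUnit.{u + 1} j)) (f w))
    (hy : ∀ k j w, f (τ (PiTensorProduct.singleAlgHom k (x F PUnit.{u + 1} j)) w) =
      τ' (PiTensorProduct.singleAlgHom k (x F PUnit.{u + 1} j)) (f w))
    (a : AHat F nh) (w : X) : f (τ a w) = τ' a (f w) := by
  induction a using tensor_induction generalizing w with
  | single k a =>
    induction a using Affine.induction generalizing w with
    | algebraMap d => simp only [AlgHom.commutes, Module.algebraMap_end_apply, map_smul]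
    | ofG a => simp only [ofG_punit, map_one, Module.End.one_apply]
    | s i => exact hs k i w
    | x i => exact hy k i w
    | mul a b ha hb => simp only [map_mul, Module.End.mul_apply, ha, hb]
    | add a b ha hb => simp only [map_add, LinearMap.add_apply, ha, hb]
  | smul d a ha => simp only [map_smul, LinearMap.smul_apply, ha]
  | one => simp only [map_one, Module.End.one_apply]
  | mul a b ha hb => simp only [map_mul, Module.End.mul_apply, ha, hb]
  | add a b ha hb => simp only [map_add, LinearMap.add_apply, ha, hb]

end TensorInduction

/-! ### The functor on modules and morphisms. -/

section Functor

variable {F : Type u} [Field F] {G : Type u} [Group G] [Fintype G] {r n : ℕ}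
  {V : Fin r → Type u} [∀ k, AddCommGroup (V k)] [∀ k, Module F (V k)]
  [∀ k, FiniteDimensional F (V k)]
  (ρ : ∀ k, Representation F G (V k)) {c : Fin r → F} (hρ : SchurRelations ρ c)

section

variable (M : Type u) [AddCommGroup M] [Module F M] [Module (Affine F G n) M]
  [IsScalarTower F (Affine F G n) M]

variable (n) in
/-- The direct sum of the spaces of homomorphisms, as a module over `A_{n,r}`. -/
@[nolint unusedArguments]
def HomSpace (_ : SchurRelations ρ c) : Type u := ∀ nh : Comp r n, HomHat ρ M nh

instance : AddCommGroup (HomSpace n ρ M hρ) :=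
  inferInstanceAs (AddCommGroup (∀ nh : Comp r n, HomHat ρ M nh))

instance : Module F (HomSpace n ρ M hρ) :=
  inferInstanceAs (Module F (∀ nh : Comp r n, HomHat ρ M nh))

instance [Module.Finite F M] : Module.Finite F (HomSpace n ρ M hρ) :=
  inferInstanceAs (Module.Finite F (∀ nh : Comp r n, HomHat ρ M nh))

instance : Module (A F r n) (HomSpace n ρ M hρ) where
  smul a u := fun nh => homAct ρ hρ M nh (a nh) (u nh)
  one_smul u := _root_.funext fun nh => by
    change homAct ρ hρ M nh 1 (u nh) = u nh
    rw [map_one, Module.End.one_apply]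
  mul_smul a b u := _root_.funext fun nh => by
    change homAct ρ hρ M nh (a nh * b nh) (u nh) = _
    rw [map_mul]; rfl
  smul_zero a := _root_.funext fun nh => map_zero _
  smul_add a u w := _root_.funext fun nh => map_add _ _ _
  add_smul a b u := _root_.funext fun nh => by
    change homAct ρ hρ M nh (a nh + b nh) (u nh) = _
    rw [map_add]; rfl
  zero_smul u := _root_.funext fun nh => by
    change homAct ρ hρ M nh 0 (u nh) = _
    rw [map_zero]; rfl

theorem homSpace_smul_apply (a : A F r n) (u : HomSpace n ρ M hρ) (nh : Comp r n) :
    (a • u) nh = homAct ρ hρ M nh (a nh) (u nh) := rfl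

instance : IsScalarTower F (A F r n) (HomSpace n ρ M hρ) :=
  IsScalarTower.of_algebraMap_smul fun d u => _root_.funext fun nh => by
    rw [homSpace_smul_apply]
    change homAct ρ hρ M nh (algebraMap F _ d) (u nh) = _
    rw [AlgHom.commutes]; rfl

end

section

variable {M N : Type u} [AddCommGroup M] [Module F M] [Module (Affine F G n) M]
  [IsScalarTower F (Affine F G n) M] [AddCommGroup N] [Module F N] [Module (Affine F G n) N]
  [IsScalarTower F (Affine F G n) N]

/-- Composition with a homomorphism of modules over the wreath Hecke algebra. -/
def homHatMap (f : M →ₗ[Affine F G n] N) (nh : Comp r n) : HomHat ρ M nh →ₗ[F] HomHat ρ N nh :=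
  LinearMap.restrict (LinearMap.compRight F (f.restrictScalars F)) fun φ hφ =>
    (mem_homHat_iff ρ hρ _).2 fun g v => by
      change f (φ _) = ofG F g • f (φ v)
      rw [(mem_homHat_iff ρ hρ _).1 hφ, map_smul]

theorem homHatMap_apply (f : M →ₗ[Affine F G n] N) (nh : Comp r n) (φ : HomHat ρ M nh)
    (v : VHat F V nh) : (homHatMap ρ hρ f nh φ).1 v = f (φ.1 v) := rfl

theorem homHatMap_homAct (f : M →ₗ[Affine F G n] N) (nh : Comp r n) (a : AHat F nh)
    (φ : HomHat ρ M nh) :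
    homHatMap ρ hρ f nh (homAct ρ hρ M nh a φ) = homAct ρ hρ N nh a (homHatMap ρ hρ f nh φ) := by
  refine hat_intertwine _ _ _ (fun k j φ => ?_) (fun k j φ => ?_) a φ
  · rw [homAct_s, homAct_s]
    refine Subtype.ext (LinearMap.ext fun v => ?_)
    rw [homHatMap_apply, homS_apply, homS_apply, map_smul, homHatMap_apply]
  · rw [homAct_y, homAct_y]
    refine Subtype.ext (LinearMap.ext fun v => ?_)
    rw [homHatMap_apply, homY_apply, homY_apply, LinearMap.map_smul_of_tower, map_smul,
      homHatMap_apply]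

/-- Composition with a homomorphism, as a homomorphism of `A_{n,r}`-modules. -/
def homSpaceMap (f : M →ₗ[Affine F G n] N) : HomSpace n ρ M hρ →ₗ[A F r n] HomSpace n ρ N hρ where
  toFun u := fun nh => homHatMap ρ hρ f nh (u nh)
  map_add' _ _ := _root_.funext fun _ => map_add _ _ _
  map_smul' a u := _root_.funext fun nh => homHatMap_homAct ρ hρ f nh (a nh) (u nh)

theorem homSpaceMap_apply (f : M →ₗ[Affine F G n] N) (u : HomSpace n ρ M hρ) (nh : Comp r n)
    (v : VHat F V nh) : (homSpaceMap ρ hρ f u nh).1 v = f ((u nh).1 v) := rfl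

end

/-- An isomorphism with an object of `ModuleCat B`, as an isomorphism of `F`-modules. -/
def restrictEquiv {B : Type u} [Ring B] [Algebra F B] {X : Type u} [AddCommGroup X]
    [Module F X] [Module B X] [IsScalarTower F B X] {M : ModuleCat.{u} B} (e : X ≃ₗ[B] M) :
    X ≃ₗ[F] M :=
  e.restrictScalars F

theorem finite_of_equiv {B : Type u} [Ring B] [Algebra F B] {X : Type u} [AddCommGroup X]
    [Module F X] [Module B X] [IsScalarTower F B X] [Module.Finite F X] {M : ModuleCat.{u} B}
    (e : X ≃ₗ[B] M) : Module.Finite F M :=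
  Module.Finite.equiv (restrictEquiv e)

/-- Modules given by types with a compatible structure of an `F`-module. -/
abbrev FDMod.of (B : Type u) [Ring B] [Algebra F B] (X : Type u) [AddCommGroup X] [Module F X]
    [Module B X] [IsScalarTower F B X] [Module.Finite F X] : FDMod F B :=
  ⟨ModuleCat.of B X, finite_of_equiv (F := F) (M := ModuleCat.of B X) (LinearEquiv.refl B X)⟩

/-- The functor `M ↦ ⨁_{n̂} Hom_{FG^n}(V(n̂), I_{n̂} M)`. -/
def homFunctor : FDMod F (Affine F G n) ⥤ FDMod F (A F r n) where
  obj M :=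
    haveI := M.property
    FDMod.of _ (HomSpace n ρ M.obj hρ)
  map f := ObjectProperty.homMk (ModuleCat.ofHom (homSpaceMap ρ hρ f.hom.hom))
  map_id _ := rfl
  map_comp _ _ := rfl

/-- The functor is the one described by its values and its action on morphisms. -/
def homFunctorIsHomFunctor (p : ℕ) [Fact p.Prime] [CharP F p]
    (hc : ∀ k, c k = ZMod.castHom (dvd_refl p) F (cScalar F p G V k)) :
    IsHomFunctor ρ p (homFunctor (n := n) ρ hρ) where
  act M nh := homAct ρ hρ M.obj nh
  act_s M nh k j φ v := by
    rw [homAct_s, homS_apply, permV_tprod]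
    rfl
  act_y M nh k j φ v := by
    rw [homAct_y, homY_apply, hc]
  iso M := (restrictEquiv (F := F) (X := HomSpace n ρ M.obj hρ)
    (M := ((homFunctor ρ hρ).obj M).obj) (LinearEquiv.refl (A F r n) (HomSpace n ρ M.obj hρ))).symm
  iso_smul M a u nh := rfl
  iso_map f u nh v := rfl

end Functor

/-! ### The decomposition of a module along the shuffles. -/

section Decomposition

variable {F : Type u} [Field F] {G : Type u} [Group G] [Fintype G] {r n : ℕ}
  {V : Fin r → Type u} [∀ k, AddCommGroup (V k)] [∀ k, Module F (V k)]
  [∀ k, FiniteDimensional F (V k)]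
  (ρ : ∀ k, Representation F G (V k)) {c : Fin r → F} (hρ : SchurRelations ρ c)

variable (F G) in
/-- The image of a permutation in the wreath Hecke algebra. -/
def permElt (w : Equiv.Perm (Fin n)) : Affine F G n := coxeterHom s_coxeter w

theorem permElt_one : permElt F G (1 : Equiv.Perm (Fin n)) = 1 := map_one _

theorem permElt_mul (w w' : Equiv.Perm (Fin n)) :
    permElt F G (w * w') = permElt F G w * permElt F G w' := map_mul _ _ _

theorem permElt_simpleSwap (i : Fin (n - 1)) : permElt F G (simpleSwap i) = s F G i :=
  coxeterHom_simpleSwap _ i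

variable {M : Type u} [AddCommGroup M] [Module F M] [Module (Affine F G n) M]
  [IsScalarTower F (Affine F G n) M]

@[simp] theorem permElt_inv_smul (w : Equiv.Perm (Fin n)) (m : M) :
    permElt F G w⁻¹ • permElt F G w • m = m := by
  rw [← mul_smul, ← permElt_mul, inv_mul_cancel, permElt_one, one_smul]

@[simp] theorem permElt_smul_inv (w : Equiv.Perm (Fin n)) (m : M) :
    permElt F G w • permElt F G w⁻¹ • m = m := by
  rw [← mul_smul, ← permElt_mul, mul_inv_cancel, permElt_one, one_smul]

theorem permElt_smul_injective (w : Equiv.Perm (Fin n)) :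
    Function.Injective fun m : M => permElt F G w • m :=
  Function.LeftInverse.injective (g := fun m => permElt F G w⁻¹ • m) (permElt_inv_smul w)

variable {nh : Comp r n}

theorem LabelEquivariant.permElt_smul {ρ : ∀ k, Representation F G (V k)}
    {β : (Σ k, Fin (nh.1 k)) ≃ Fin n} {φ : VHat F V nh →ₗ[F] M}
    (hφ : LabelEquivariant ρ β φ) (w : Equiv.Perm (Fin n)) :
    LabelEquivariant ρ (β.trans w) (actOn F G n M (permElt F G w) ∘ₗ φ) := by
  induction w using perm_induction with
  | one => rw [permElt_one, map_one]; exact hφ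
  | step w i _ ih =>
    have h := ih.s_smul i
    rw [← LinearMap.comp_assoc, ← Module.End.mul_eq_comp, ← map_mul, ← permElt_simpleSwap,
      ← permElt_mul, simpleSwap_mul_cancel] at h
    have e : (β.trans (simpleSwap i * w)).trans (simpleSwap i) =
        β.trans (simpleSwap i * (simpleSwap i * w)) := rfl
    rwa [e, simpleSwap_mul_cancel] at h

theorem place_trans_labelPerm (α : (Σ k, Fin (nh.1 k)) ≃ Fin n) :
    (place nh).trans (labelPerm α) = α := by
  ext1 a
  exact labelPerm_apply α a

theorem trans_labelPerm_inv (α : (Σ k, Fin (nh.1 k)) ≃ Fin n) :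
    α.trans (labelPerm α)⁻¹ = place nh := by
  ext1 a
  rw [Equiv.trans_apply, ← labelPerm_apply α a]
  exact Equiv.symm_apply_apply _ _

/-- Move a homomorphism from the standard labelling to another one. -/
theorem LabelEquivariant.move {ρ : ∀ k, Representation F G (V k)}
    {φ : VHat F V nh →ₗ[F] M} (hφ : LabelEquivariant ρ (place nh) φ)
    (α : (Σ k, Fin (nh.1 k)) ≃ Fin n) :
    LabelEquivariant ρ α (actOn F G n M (permElt F G (labelPerm α)) ∘ₗ φ) := by
  have h := hφ.permElt_smul (labelPerm α)
  rwa [place_trans_labelPerm] at h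

theorem mixed_swap {nh : Comp r n} {α : (Σ k, Fin (nh.1 k)) ≃ Fin n} {i : Fin (n - 1)}
    (h : Mixed α i) : Mixed (α.trans (simpleSwap i)) i := by
  rw [Mixed, colour_swap, colour_swap, simpleSwap_lo, simpleSwap_hi]
  exact h.symm

include hρ in
-- Every letter of a reduced word for a shuffle exchanges positions of different colours, where
-- `s_i` intertwines the polynomial generators exactly. Exchanges inside a block would contribute
-- correction terms.
theorem x_smul_permElt {φ : VHat F V nh →ₗ[F] M} (hφ : LabelEquivariant ρ (place nh) φ)
    (α : Shuffle nh) (a : Σ k, Fin (nh.1 k)) (v : VHat F V nh) :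
    x F G (α.1 a) • permElt F G (labelPerm α.1) • φ v =
      permElt F G (labelPerm α.1) • x F G (place nh a) • φ v := by
  generalize hw : labelPerm α.1 = w
  induction w using perm_induction generalizing α with
  | one =>
    rw [← labelPerm_apply, hw, permElt_one, one_smul, one_smul]
    rfl
  | step w i hi ih =>
    subst hw
    have hm := mixed_of_descent α i hi
    have hβ := hφ.move (α.swap i hm).1
    have h1 := ih (α.swap i hm) rfl
    -- The induction hypothesis concerns the shorter shuffle `α.swap i hm`; the mixed exchange `s_i`
    -- carries it over to `α`.
    have h2 := hβ.x_s_smul ρ hρ (mixed_swap hm) ((α.swap i hm).1 a) v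
    have e1 : simpleSwap i ((α.swap i hm).1 a) = α.1 a := simpleSwap_apply_self i (α.1 a)
    have e2 : labelPerm (α.swap i hm).1 = simpleSwap i * labelPerm α.1 := rfl
    rw [e1] at h2
    change s F G i • x F G ((α.swap i hm).1 a) • permElt F G (labelPerm (α.swap i hm).1) • φ v =
      x F G (α.1 a) • s F G i • permElt F G (labelPerm (α.swap i hm).1) • φ v at h2
    rw [e2] at h2
    rw [h1] at h2
    simpa only [← permElt_simpleSwap, ← mul_smul, ← mul_assoc, ← permElt_mul,
      simpleSwap_mul_self, one_mul] using h2.symm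

/-- The coordinates of a vector in the decomposition of a module into the images of the
isotypical components for the standard labellings. -/
def coordHom (α : (Σ k, Fin (nh.1 k)) ≃ Fin n) (q : HatIndex F V nh) : M →ₗ[F] HomHat ρ M nh where
  toFun m := ⟨actOn F G n M (permElt F G (labelPerm α)⁻¹) ∘ₗ matUnitHom ρ c α q m, by
    rw [mem_homHat_iff ρ hρ]
    have h := (matUnitHom_equivariant ρ c (α := α) q m).permElt_smul (labelPerm α)⁻¹
    rwa [trans_labelPerm_inv] at h⟩
  map_add' m m' := Subtype.ext (LinearMap.ext fun v => by
    change permElt F G (labelPerm α)⁻¹ • matUnit ρ c α q v • (m + m') =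
      permElt F G (labelPerm α)⁻¹ • matUnit ρ c α q v • m +
        permElt F G (labelPerm α)⁻¹ • matUnit ρ c α q v • m'
    rw [smul_add, smul_add])
  map_smul' d m := Subtype.ext (LinearMap.ext fun v => by
    change permElt F G (labelPerm α)⁻¹ • matUnit ρ c α q v • d • m =
      d • permElt F G (labelPerm α)⁻¹ • matUnit ρ c α q v • m
    rw [smul_smul_comm', smul_smul_comm'])

theorem coordHom_apply (α : (Σ k, Fin (nh.1 k)) ≃ Fin n) (q : HatIndex F V nh) (m : M)
    (v : VHat F V nh) : (coordHom ρ hρ α q m).1 v =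
      permElt F G (labelPerm α)⁻¹ • matUnit ρ c α q v • m := rfl

/-- The permutation elements cancel, leaving the diagonal matrix units, whose sum is one. -/
theorem sum_coordHom (m : M) : ∑ x : Label r n, ∑ q : HatIndex F V x.1,
    permElt F G (labelPerm x.2.1) • (coordHom ρ hρ x.2.1 q m).1 (hatBasis F V x.1 q) = m := by
  simp only [coordHom_apply, permElt_smul_inv, ← Finset.sum_smul]
  rw [sum_matUnit ρ c hρ, one_smul]

/-- Moving `φ` to the labelling `α` makes the matrix unit act as a rank one operator. Together with
`coordHom_diff` this shows that the decomposition in `sum_coordHom` is direct. -/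
theorem coordHom_same (α : (Σ k, Fin (nh.1 k)) ≃ Fin n) (q : HatIndex F V nh)
    (φ : HomHat ρ M nh) (v : VHat F V nh) :
    coordHom ρ hρ α q (permElt F G (labelPerm α) • φ.1 v) = (hatBasis F V nh).coord q v • φ := by
  refine Subtype.ext (LinearMap.ext fun u => ?_)
  have h := matUnit_smul_same ρ hρ (((mem_homHat_iff ρ hρ _).1 φ.2).move α) q u v
  rw [coordHom_apply]
  refine (congrArg (fun m : M => permElt F G (labelPerm α)⁻¹ • m) h).trans ?_
  rw [smul_smul_comm']
  change _ • permElt F G (labelPerm α)⁻¹ • permElt F G (labelPerm α) • φ.1 u = _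
  rw [permElt_inv_smul]
  rfl

theorem coordHom_diff {nh' : Comp r n} (α : (Σ k, Fin (nh.1 k)) ≃ Fin n)
    (β : (Σ k, Fin (nh'.1 k)) ≃ Fin n) (h : colour α ≠ colour β) (q : HatIndex F V nh)
    (φ : HomHat ρ M nh') (v : VHat F V nh') :
    coordHom ρ hρ α q (permElt F G (labelPerm β) • φ.1 v) = 0 := by
  refine Subtype.ext (LinearMap.ext fun u => ?_)
  have h := matUnit_smul_diff ρ hρ (((mem_homHat_iff ρ hρ _).1 φ.2).move β) h q u v
  rw [coordHom_apply]
  exact (congrArg (fun m : M => permElt F G (labelPerm α)⁻¹ • m) h).trans (smul_zero _)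

variable (n) in
include hρ in
theorem module_induction {P : M → Prop}
    (mem : ∀ (nh : Comp r n) (α : Shuffle nh) (φ : HomHat ρ M nh) (v : VHat F V nh),
      P (permElt F G (labelPerm α.1) • φ.1 v)) (zero : P 0)
    (add : ∀ m m', P m → P m' → P (m + m')) (m : M) : P m := by
  rw [← sum_coordHom (n := n) ρ hρ m]
  exact Finset.sum_induction _ P add zero fun x _ =>
    Finset.sum_induction _ P add zero fun q _ => mem x.1 x.2 _ _

/-! ### The action of the generators on the spanning vectors -/

include hρ in
theorem ofG_smul_move (α : Shuffle nh) (g : Fin n → G) (φ : HomHat ρ M nh) (v : VHat F V nh) :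
    ofG F g • permElt F G (labelPerm α.1) • φ.1 v =
      permElt F G (labelPerm α.1) • φ.1 (labelAct ρ α.1 g v) :=
  ((((mem_homHat_iff ρ hρ _).1 φ.2).move α.1) g v).symm

theorem s_smul_move_mixed (α : Shuffle nh) (i : Fin (n - 1)) (h : Mixed α.1 i)
    (φ : HomHat ρ M nh) (v : VHat F V nh) :
    s F G i • permElt F G (labelPerm α.1) • φ.1 v =
      permElt F G (labelPerm (α.swap i h).1) • φ.1 v := by
  rw [← mul_smul, ← permElt_simpleSwap, ← permElt_mul]
  rfl

/-- The simple transposition passes through `labelPerm α` into the Young subgroup; inserting the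
block exchange twice then produces `homS`. -/
theorem s_smul_move_block {α : Shuffle nh} {i : Fin (n - 1)} {k : Fin r}
    {j : Fin (nh.1 k - 1)} (h1 : α.1 ⟨k, lo j⟩ = lo i) (h2 : α.1 ⟨k, hi j⟩ = hi i)
    (φ : HomHat ρ M nh) (v : VHat F V nh) :
    s F G i • permElt F G (labelPerm α.1) • φ.1 v =
      permElt F G (labelPerm α.1) •
        (homS ρ hρ M nh k j φ).1 (permV F V (blockSwap nh k j) v) := by
  rw [homS_apply, ← Module.End.mul_apply (permV F V _), (permV_coxeter nh k).sq,
    Module.End.one_apply, ← mul_smul, ← mul_smul, ← permElt_simpleSwap, ← permElt_simpleSwap,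
    ← permElt_mul, ← permElt_mul, simpleSwap_mul_labelPerm h1 h2]

theorem x_smul_move (α : Shuffle nh) (k : Fin r) (j : Fin (nh.1 k)) (φ : HomHat ρ M nh)
    (v : VHat F V nh) :
    x F G (α.1 ⟨k, j⟩) • permElt F G (labelPerm α.1) • φ.1 v =
      permElt F G (labelPerm α.1) • (c k • homY ρ hρ M nh k j φ).1 v := by
  rw [x_smul_permElt ρ hρ ((mem_homHat_iff ρ hρ _).1 φ.2)]
  congr 1
  change _ = c k • (homY ρ hρ M nh k j φ).1 v
  rw [homY_apply, smul_inv_smul₀ (hρ.ne_zero k)]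

end Decomposition

/-! ### Full faithfulness. -/

section FullyFaithful

variable {F : Type u} [Field F] {G : Type u} [Group G] [Fintype G] {r n : ℕ}
  {V : Fin r → Type u} [∀ k, AddCommGroup (V k)] [∀ k, Module F (V k)]
  [∀ k, FiniteDimensional F (V k)]
  (ρ : ∀ k, Representation F G (V k)) {c : Fin r → F} (hρ : SchurRelations ρ c)
  {M N : Type u} [AddCommGroup M] [Module F M] [Module (Affine F G n) M]
  [IsScalarTower F (Affine F G n) M] [AddCommGroup N] [Module F N] [Module (Affine F G n) N]
  [IsScalarTower F (Affine F G n) N]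

/-- The linear map which extends given maps between the spaces of homomorphisms. -/
def extendHom (ψ : ∀ nh : Comp r n, HomHat ρ M nh →ₗ[F] HomHat ρ N nh) : M →ₗ[F] N :=
  ∑ x : Label r n, ∑ q : HatIndex F V x.1,
    actOn F G n N (permElt F G (labelPerm x.2.1)) ∘ₗ
      LinearMap.applyₗ (hatBasis F V x.1 q) ∘ₗ (HomHat ρ N x.1).subtype ∘ₗ ψ x.1 ∘ₗ
        coordHom ρ hρ x.2.1 q

/-- Only the coordinates of the label `(nh, α)` survive, and they reassemble `v`. The formula no
longer refers to the chosen bases. -/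
theorem extendHom_move (ψ : ∀ nh : Comp r n, HomHat ρ M nh →ₗ[F] HomHat ρ N nh) {nh : Comp r n}
    (α : Shuffle nh) (φ : HomHat ρ M nh) (v : VHat F V nh) :
    extendHom ρ hρ ψ (permElt F G (labelPerm α.1) • φ.1 v) =
      permElt F G (labelPerm α.1) • (ψ nh φ).1 v := by
  have h0 : ∀ m : M, extendHom ρ hρ ψ m = ∑ x : Label r n, ∑ q : HatIndex F V x.1,
      permElt F G (labelPerm x.2.1) • (ψ x.1 (coordHom ρ hρ x.2.1 q m)).1
        (hatBasis F V x.1 q) := fun m => by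
    simp only [extendHom, LinearMap.sum_apply]
    rfl
  rw [h0, Finset.sum_eq_single ⟨nh, α⟩]
  · simp only [coordHom_same, map_smul]
    conv_rhs => rw [← (hatBasis F V nh).sum_repr v, map_sum, Finset.smul_sum]
    refine Finset.sum_congr rfl fun q _ => ?_
    rw [map_smul]
    rfl
  · intro y _ hy
    refine Finset.sum_eq_zero fun q _ => ?_
    rw [coordHom_diff ρ hρ y.2.1 α.1 fun h => hy (Label.ext_colour (y := ⟨nh, α⟩) h), map_zero]
    exact smul_zero _
  · exact fun h => absurd (Finset.mem_univ _) h

/-- The homomorphism of modules which induces a given one between the direct sums of spaces of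
homomorphisms. -/
def extendLinear (ψ : ∀ nh : Comp r n, HomHat ρ M nh →ₗ[F] HomHat ρ N nh)
    (hs : ∀ nh k j φ, ψ nh (homS ρ hρ M nh k j φ) = homS ρ hρ N nh k j (ψ nh φ))
    (hy : ∀ nh k j φ, ψ nh (homY ρ hρ M nh k j φ) = homY ρ hρ N nh k j (ψ nh φ)) :
    M →ₗ[Affine F G n] N where
  toFun := extendHom ρ hρ ψ
  map_add' := map_add _
  map_smul' a m := by
    rw [RingHom.id_apply]
    -- On the spanning vectors `w_α φ(v)` a generator changes `α` or `v`, or applies `homS` or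
    -- `homY` to `φ`; `ψ` is compatible with each of these.
    refine Affine.smul_comm_of_generators _ (fun g m => ?_) (fun i m => ?_) (fun i m => ?_) a m
    · refine module_induction n ρ hρ
        (P := fun m => extendHom ρ hρ ψ (ofG F g • m) = ofG F g • extendHom ρ hρ ψ m)
        (fun nh α φ v => ?_) ?_ (fun m m' h h' => ?_) m
      · rw [ofG_smul_move ρ hρ, extendHom_move, extendHom_move, ofG_smul_move ρ hρ]
      · simp only [smul_zero, map_zero]
      · rw [smul_add, map_add, map_add, smul_add, h, h']
    · refine module_induction n ρ hρ
        (P := fun m => extendHom ρ hρ ψ (s F G i • m) = s F G i • extendHom ρ hρ ψ m)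
        (fun nh α φ v => ?_) ?_ (fun m m' h h' => ?_) m
      · by_cases h : Mixed α.1 i
        · rw [s_smul_move_mixed ρ α i h, extendHom_move, extendHom_move,
            s_smul_move_mixed ρ α i h]
        · obtain ⟨k, j, h1, h2⟩ := exists_of_not_mixed α i h
          rw [s_smul_move_block ρ hρ h1 h2, extendHom_move, extendHom_move, hs,
            s_smul_move_block ρ hρ h1 h2]
      · simp only [smul_zero, map_zero]
      · rw [smul_add, map_add, map_add, smul_add, h, h']
    · refine module_induction n ρ hρ
        (P := fun m => extendHom ρ hρ ψ (x F G i • m) = x F G i • extendHom ρ hρ ψ m)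
        (fun nh α φ v => ?_) ?_ (fun m m' h h' => ?_) m
      · obtain ⟨⟨k, j⟩, rfl⟩ := α.1.surjective i
        rw [x_smul_move ρ hρ, extendHom_move, extendHom_move, map_smul, hy, x_smul_move ρ hρ]
      · simp only [smul_zero, map_zero]
      · rw [smul_add, map_add, map_add, smul_add, h, h']

theorem homHat_eq_move {nh : Comp r n} (φ : HomHat ρ M nh) (v : VHat F V nh) :
    φ.1 v = permElt F G (labelPerm (placeShuffle nh).1) • φ.1 v := by
  change φ.1 v = permElt F G (labelPerm (place nh)) • φ.1 v
  rw [labelPerm_place, permElt_one, one_smul]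

variable (M) in
/-- The inclusion of a summand of the direct sum of the spaces of homomorphisms. -/
def homSingle (nh : Comp r n) : HomHat ρ M nh →ₗ[F] HomSpace n ρ M hρ :=
  open Classical in LinearMap.single F (fun nh : Comp r n => HomHat ρ M nh) nh

theorem homSingle_same (nh : Comp r n) (φ : HomHat ρ M nh) : homSingle ρ hρ M nh φ nh = φ := by
  classical
  exact Pi.single_eq_same (M := fun nh : Comp r n => HomHat ρ M nh) nh φ

theorem homSingle_ne {nh mh : Comp r n} (h : mh ≠ nh) (φ : HomHat ρ M nh) :
    homSingle ρ hρ M nh φ mh = 0 := by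
  classical
  exact Pi.single_eq_of_ne (M := fun nh : Comp r n => HomHat ρ M nh) h φ

theorem sum_homSingle (u : HomSpace n ρ M hρ) : ∑ nh, homSingle ρ hρ M nh (u nh) = u := by
  classical
  exact Finset.univ_sum_single (M := fun nh : Comp r n => HomHat ρ M nh) u

open Classical in
theorem single_smul_homSingle (nh : Comp r n) (a : AHat F nh) (φ : HomHat ρ M nh) :
    (Pi.single (M := fun nh : Comp r n => AHat F nh) nh a : A F r n) • homSingle ρ hρ M nh φ =
      homSingle ρ hρ M nh (homAct ρ hρ M nh a φ) := by
  refine _root_.funext fun mh => ?_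
  rw [homSpace_smul_apply]
  by_cases h : mh = nh
  · subst h
    rw [Pi.single_eq_same, homSingle_same, homSingle_same]
  · rw [homSingle_ne ρ hρ h, homSingle_ne ρ hρ h, map_zero]

theorem homSpaceMap_injective (f f' : M →ₗ[Affine F G n] N)
    (h : homSpaceMap ρ hρ f = homSpaceMap ρ hρ f') : f = f' := by
  ext m
  refine module_induction n ρ hρ (P := fun m => f m = f' m)
    (fun nh α φ v => ?_) ?_ (fun m m' h h' => ?_) m
  · rw [map_smul, map_smul]
    congr 1
    have h1 := congrArg (fun u : HomSpace n ρ N hρ => (u nh).1 v)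
      (LinearMap.congr_fun h (homSingle ρ hρ M nh φ))
    simpa only [homSpaceMap_apply, homSingle_same] using h1
  · rw [map_zero, map_zero]
  · rw [map_add, map_add, h, h']

theorem homSpaceMap_surjective (ψ : HomSpace n ρ M hρ →ₗ[A F r n] HomSpace n ρ N hρ) :
    ∃ f : M →ₗ[Affine F G n] N, homSpaceMap ρ hρ f = ψ := by
  classical
  let ψ' : ∀ nh : Comp r n, HomHat ρ M nh →ₗ[F] HomHat ρ N nh := fun nh =>
    LinearMap.proj (φ := fun nh : Comp r n => HomHat ρ N nh) nh ∘ₗ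
      (ψ.restrictScalars F : HomSpace n ρ M hρ →ₗ[F] HomSpace n ρ N hρ) ∘ₗ homSingle ρ hρ M nh
  have hψ' : ∀ nh φ, ψ' nh φ = ψ (homSingle ρ hρ M nh φ) nh := fun _ _ => rfl
  have hact : ∀ (nh : Comp r n) (a : AHat F nh) (φ : HomHat ρ M nh),
      ψ' nh (homAct ρ hρ M nh a φ) = homAct ρ hρ N nh a (ψ' nh φ) := fun nh a φ => by
    rw [hψ', ← single_smul_homSingle, map_smul, homSpace_smul_apply, Pi.single_eq_same, hψ']
  -- The central idempotent of the factor `nh` fixes the source vector and kills the component `mh`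
  -- of its image, so `ψ` is diagonal.
  have hne : ∀ (nh mh : Comp r n) (_ : mh ≠ nh) (φ : HomHat ρ M nh),
      ψ (homSingle ρ hρ M nh φ) mh = 0 := fun nh mh h φ => by
    have h1 := single_smul_homSingle ρ hρ nh 1 φ
    rw [map_one, Module.End.one_apply] at h1
    rw [← h1, map_smul, homSpace_smul_apply, Pi.single_eq_of_ne h, map_zero,
      LinearMap.zero_apply]
  have happly : ∀ (u : HomSpace n ρ M hρ) (nh : Comp r n), ψ u nh = ψ' nh (u nh) := by
    intro u nh
    conv_lhs => rw [← sum_homSingle ρ hρ u, map_sum]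
    refine (Finset.sum_apply nh _ _).trans ?_
    rw [Finset.sum_eq_single nh]
    · rfl
    · exact fun mh _ h => hne mh nh h.symm _
    · exact fun h => absurd (Finset.mem_univ _) h
  refine ⟨extendLinear ρ hρ ψ' (fun nh k j φ => ?_) (fun nh k j φ => ?_), ?_⟩
  · rw [← homAct_s, hact, homAct_s]
  · rw [← homAct_y, hact, homAct_y]
  · refine LinearMap.ext fun u => _root_.funext fun nh => Subtype.ext (LinearMap.ext fun v => ?_)
    rw [homSpaceMap_apply, happly]
    change extendHom ρ hρ ψ' ((u nh).1 v) = _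
    rw [homHat_eq_move ρ, extendHom_move, ← homHat_eq_move]

end FullyFaithful

section

variable {F : Type u} [Field F] {G : Type u} [Group G] [Fintype G] {r n : ℕ}
  {V : Fin r → Type u} [∀ k, AddCommGroup (V k)] [∀ k, Module F (V k)]
  [∀ k, FiniteDimensional F (V k)]
  (ρ : ∀ k, Representation F G (V k)) {c : Fin r → F} (hρ : SchurRelations ρ c)

instance : (homFunctor (n := n) ρ hρ).Faithful where
  map_injective {M N} f f' h := by
    refine ObjectProperty.hom_ext _ (ModuleCat.hom_ext (homSpaceMap_injective ρ hρ _ _ ?_))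
    exact congrArg (fun g : (homFunctor (n := n) ρ hρ).obj M ⟶ (homFunctor (n := n) ρ hρ).obj N =>
        g.hom.hom) h

instance : (homFunctor (n := n) ρ hρ).Full where
  map_surjective {M N} g := by
    obtain ⟨f, hf⟩ := homSpaceMap_surjective ρ hρ (M := M.obj) (N := N.obj) g.hom.hom
    refine ⟨ObjectProperty.homMk (ModuleCat.ofHom f), ?_⟩
    exact ObjectProperty.hom_ext _ (ModuleCat.hom_ext hf)

end

/-! ### The induced module for a single composition. -/

section Induced

variable {F : Type u} [Field F] {G : Type u} [Group G] [Fintype G] {r n : ℕ}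
  {V : Fin r → Type u} [∀ k, AddCommGroup (V k)] [∀ k, Module F (V k)]
  [∀ k, FiniteDimensional F (V k)]
  (ρ : ∀ k, Representation F G (V k)) (c : Fin r → F)
  {nh : Comp r n} {Y : Type u} [AddCommGroup Y] [Module F Y] (τ : AHat F nh →ₐ[F] Module.End F Y)

/-! ### The operators on a single summand -/

variable (V) in
/-- A simple transposition acting on both factors of `V(n̂) ⊗ Y`. -/
def blockS (k : Fin r) (j : Fin (nh.1 k - 1)) : Module.End F (VHat F V nh ⊗[F] Y) :=
  TensorProduct.map (permV F V (blockSwap nh k j))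
    (τ (PiTensorProduct.singleAlgHom k (s F PUnit.{u + 1} j)))

variable (V) in
/-- A polynomial generator acting on `V(n̂) ⊗ Y`. -/
def blockX (a : Σ k, Fin (nh.1 k)) : Module.End F (VHat F V nh ⊗[F] Y) :=
  TensorProduct.map 1 (c a.1 • τ (PiTensorProduct.singleAlgHom a.1 (x F PUnit.{u + 1} a.2)))

theorem blockS_coxeter (k : Fin r) : CoxeterRelations (blockS V τ k) where
  sq j := by
    simp only [blockS]
    rw [← TensorProduct.map_mul, (permV_coxeter nh k).sq, ← map_mul, ← map_mul, s_coxeter.sq,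
      map_one, map_one, TensorProduct.map_one]
  comm i j h := by
    simp only [blockS]
    rw [← TensorProduct.map_mul, ← TensorProduct.map_mul, (permV_coxeter nh k).comm _ _ h,
      ← map_mul, ← map_mul, ← map_mul, ← map_mul, s_coxeter.comm _ _ h]
  braid i j h := by
    simp only [blockS]
    simp only [← TensorProduct.map_mul, ← map_mul]
    rw [(permV_coxeter nh k).braid _ _ h, s_coxeter.braid _ _ h]

theorem blockS_comm_of_ne {k k' : Fin r} (h : k ≠ k') (j : Fin (nh.1 k - 1))
    (j' : Fin (nh.1 k' - 1)) :
    blockS V τ k j * blockS V τ k' j' = blockS V τ k' j' * blockS V τ k j := by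
  simp only [blockS]
  rw [← TensorProduct.map_mul, ← TensorProduct.map_mul, permV_comm_of_ne nh h, ← map_mul,
    ← map_mul, (commute_single h _ _).eq]

theorem single_x_comm (a b : Σ k, Fin (nh.1 k)) :
    Commute (PiTensorProduct.singleAlgHom (R := F) (A := fun k => DegAffine F (nh.1 k)) a.1
        (x F PUnit.{u + 1} a.2))
      (PiTensorProduct.singleAlgHom (R := F) (A := fun k => DegAffine F (nh.1 k)) b.1
        (x F PUnit.{u + 1} b.2)) := by
  obtain ⟨k, j⟩ := a
  obtain ⟨k', j'⟩ := b
  by_cases h : k = k'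
  · subst h
    rw [Commute, SemiconjBy, ← map_mul, ← map_mul, x_comm]
  · exact commute_single h _ _

theorem blockX_comm (a b : Σ k, Fin (nh.1 k)) :
    blockX V c τ a * blockX V c τ b = blockX V c τ b * blockX V c τ a := by
  simp only [blockX]
  rw [← TensorProduct.map_mul, ← TensorProduct.map_mul, smul_mul_smul_comm, smul_mul_smul_comm,
    ← map_mul, ← map_mul, (single_x_comm a b).eq, mul_comm (c a.1)]

/-- The degenerate relation is applied in the second factor, and the flip on the first factor
survives in the correction. The result, `c k` times the flip, is exactly the action of `t` within a
block. -/
theorem blockS_mul_blockX_lo (k : Fin r) (j : Fin (nh.1 k - 1)) :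
    blockS V τ k j * blockX V c τ ⟨k, lo j⟩ = blockX V c τ ⟨k, hi j⟩ * blockS V τ k j -
      TensorProduct.map (c k • permV F V (blockSwap nh k j)) 1 := by
  have h : s F PUnit.{u + 1} j * x F PUnit.{u + 1} (lo j) =
      x F PUnit.{u + 1} (hi j) * s F PUnit.{u + 1} j - 1 := by
    rw [s_mul_x_lo]
    simp [ofG_punit]
  simp only [blockS, blockX]
  rw [← TensorProduct.map_mul, ← TensorProduct.map_mul, mul_smul_comm, smul_mul_assoc,
    ← map_mul, ← map_mul, ← map_mul, ← map_mul, h, map_sub, map_sub, map_one, map_one, smul_sub,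
    mul_one, one_mul, TensorProduct.map_smul_left, ← TensorProduct.map_smul_right]
  refine @eq_sub_of_add_eq (VHat F V nh ⊗[F] Y →ₗ[F] VHat F V nh ⊗[F] Y) _ _ _ _ ?_
  rw [← TensorProduct.map_add_right, sub_add_cancel]

theorem blockS_mul_blockX_far (k : Fin r) (j : Fin (nh.1 k - 1)) {a : Σ k, Fin (nh.1 k)}
    (h₁ : a ≠ ⟨k, lo j⟩) (h₂ : a ≠ ⟨k, hi j⟩) :
    blockS V τ k j * blockX V c τ a = blockX V c τ a * blockS V τ k j := by
  obtain ⟨k', j'⟩ := a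
  simp only [blockS, blockX]
  rw [← TensorProduct.map_mul, ← TensorProduct.map_mul, mul_smul_comm, smul_mul_assoc,
    ← map_mul, ← map_mul, mul_one, one_mul]
  by_cases h : k = k'
  · subst h
    rw [← map_mul, ← map_mul, s_mul_x_far j j' (fun h => h₁ (by rw [h])) fun h => h₂ (by rw [h])]
  · rw [(commute_single h _ _).eq]

/-! ### The operators on the induced module -/

variable (F V Y nh) in
/-- The space of the module over the wreath Hecke algebra induced from `V(n̂) ⊗ Y`. -/
abbrev Induced : Type u := Shuffle nh → VHat F V nh ⊗[F] Y

/-- The action of `G^n` on the induced module. -/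
def indG (g : Fin n → G) : Module.End F (Induced F V nh Y) :=
  LinearMap.pi fun α => TensorProduct.map (labelAct ρ α.1 g) 1 ∘ₗ LinearMap.proj α

variable (V) in
open Classical in
/-- The action of the simple transpositions on the induced module. -/
def indS (i : Fin (n - 1)) : Module.End F (Induced F V nh Y) :=
  LinearMap.pi fun α =>
    if h : Mixed α.1 i then LinearMap.proj (α.swap i h)
    else blockS V τ (exists_of_not_mixed α i h).choose
      (exists_of_not_mixed α i h).choose_spec.choose ∘ₗ LinearMap.proj α

variable (V) in
/-- The action of the polynomial generators on the induced module. -/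
def indX (b : Fin n) : Module.End F (Induced F V nh Y) :=
  LinearMap.pi fun α => blockX V c τ (α.1.symm b) ∘ₗ LinearMap.proj α

theorem indG_apply (g : Fin n → G) (f : Induced F V nh Y) (α : Shuffle nh) :
    indG ρ g f α = TensorProduct.map (labelAct ρ α.1 g) 1 (f α) := rfl

theorem indX_apply (b : Fin n) (f : Induced F V nh Y) (α : Shuffle nh) :
    indX V c τ b f α = blockX V c τ (α.1.symm b) (f α) := rfl

theorem indS_mixed {i : Fin (n - 1)} {α : Shuffle nh} (h : Mixed α.1 i) (f : Induced F V nh Y) :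
    indS V τ i f α = f (α.swap i h) := by
  simp only [indS, LinearMap.pi_apply, dif_pos h, LinearMap.proj_apply]

/-- The block and place in the definition of `indS` are chosen, but `α` is injective, so the label
`lo i` determines both. -/
theorem indS_block {i : Fin (n - 1)} {α : Shuffle nh} {k : Fin r} {j : Fin (nh.1 k - 1)}
    (h1 : α.1 ⟨k, lo j⟩ = lo i) (h2 : α.1 ⟨k, hi j⟩ = hi i) (f : Induced F V nh Y) :
    indS V τ i f α = blockS V τ k j (f α) := by
  have h := not_mixed_of h1 h2
  simp only [indS, LinearMap.pi_apply, dif_neg h, LinearMap.coe_comp, Function.comp_apply,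
    LinearMap.proj_apply]
  have h3 := (exists_of_not_mixed α i h).choose_spec.choose_spec.1
  generalize (exists_of_not_mixed α i h).choose_spec.choose = j' at h3 ⊢
  revert j'
  generalize (exists_of_not_mixed α i h).choose = k'
  intro j' h3
  have h4 := α.1.injective (h3.trans h1.symm)
  obtain rfl : k' = k := congrArg Sigma.fst h4
  have h5 : lo j' = lo j := by simpa using h4
  obtain rfl : j' = j := Fin.ext (by simpa [lo] using h5)
  rfl

theorem colour_shuffle_swap (α : Shuffle nh) {i : Fin (n - 1)} (h : Mixed α.1 i) (b : Fin n) :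
    colour (α.swap i h).1 b = colour α.1 (simpleSwap i b) := colour_swap _ _ _

theorem mixed_shuffle_swap {α : Shuffle nh} {i : Fin (n - 1)} (h : Mixed α.1 i) :
    Mixed (α.swap i h).1 i := mixed_swap h

theorem swap_swap (α : Shuffle nh) {i : Fin (n - 1)} (h : Mixed α.1 i) :
    (α.swap i h).swap i (mixed_shuffle_swap h) = α :=
  Subtype.ext (Equiv.ext fun a => simpleSwap_apply_self i (α.1 a))

theorem swap_apply (α : Shuffle nh) {i : Fin (n - 1)} (h : Mixed α.1 i) (a : Σ k, Fin (nh.1 k)) :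
    (α.swap i h).1 a = simpleSwap i (α.1 a) := rfl

theorem indS_sq (i : Fin (n - 1)) : indS V τ i * indS V τ i = 1 := by
  refine LinearMap.ext fun f => _root_.funext fun α => ?_
  rw [Module.End.mul_apply, Module.End.one_apply]
  by_cases h : Mixed α.1 i
  · rw [indS_mixed τ h, indS_mixed τ (mixed_shuffle_swap h), swap_swap]
  · obtain ⟨k, j, h1, h2⟩ := exists_of_not_mixed α i h
    rw [indS_block τ h1 h2, indS_block τ h1 h2, ← Module.End.mul_apply, (blockS_coxeter τ k).sq,
      Module.End.one_apply]

theorem mixed_swap_far {α : Shuffle nh} {i j : Fin (n - 1)} (h : i.1 + 1 < j.1 ∨ j.1 + 1 < i.1)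
    (hi' : Mixed α.1 i) : Mixed (α.swap i hi').1 j ↔ Mixed α.1 j := by
  rw [Mixed, colour_shuffle_swap, colour_shuffle_swap, (simpleSwap_far h).1, (simpleSwap_far h).2]

theorem indS_comm_of_mixed {i i' : Fin (n - 1)} (h : i.1 + 1 < i'.1 ∨ i'.1 + 1 < i.1)
    {α : Shuffle nh} (hm : Mixed α.1 i) (f : Induced F V nh Y) :
    indS V τ i (indS V τ i' f) α = indS V τ i' (indS V τ i f) α := by
  rw [indS_mixed τ hm]
  by_cases hm' : Mixed α.1 i'
  · rw [indS_mixed τ hm', indS_mixed τ ((mixed_swap_far h.symm hm').2 hm),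
      indS_mixed τ ((mixed_swap_far h hm).2 hm')]
    congr 1
    refine Subtype.ext (Equiv.ext fun a => ?_)
    exact (Equiv.congr_fun (simpleSwap_mul_comm h) (α.1 a)).symm
  · obtain ⟨k, j, h1, h2⟩ := exists_of_not_mixed α i' hm'
    rw [indS_block τ h1 h2, indS_mixed τ hm, indS_block τ (α := α.swap i hm) (k := k) (j := j)]
    · rw [swap_apply, h1, (simpleSwap_far h).1]
    · rw [swap_apply, h2, (simpleSwap_far h).2]

theorem indS_comm {i i' : Fin (n - 1)} (h : i.1 + 1 < i'.1 ∨ i'.1 + 1 < i.1) :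
    indS V τ i * indS V τ i' = indS V τ i' * indS V τ i := by
  refine LinearMap.ext fun f => _root_.funext fun α => ?_
  rw [Module.End.mul_apply, Module.End.mul_apply]
  by_cases hm : Mixed α.1 i
  · exact indS_comm_of_mixed τ h hm f
  by_cases hm' : Mixed α.1 i'
  · exact (indS_comm_of_mixed τ h.symm hm' f).symm
  obtain ⟨k, j, h1, h2⟩ := exists_of_not_mixed α i hm
  obtain ⟨k', j', h1', h2'⟩ := exists_of_not_mixed α i' hm'
  rw [indS_block τ h1 h2, indS_block τ h1' h2' f, indS_block τ h1' h2', indS_block τ h1 h2,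
    ← Module.End.mul_apply, ← Module.End.mul_apply]
  congr 1
  by_cases hk : k = k'
  · subst hk
    refine (blockS_coxeter τ k).comm _ _ ?_
    have e1 : j.1 ≠ j'.1 := fun e => by
      obtain rfl := Fin.ext e
      have := congrArg Fin.val (h1.symm.trans h1')
      simp only [lo] at this
      omega
    have e2 : j.1 + 1 ≠ j'.1 := fun e => by
      have e' : hi j = lo j' := Fin.ext e
      rw [e'] at h2
      have := congrArg Fin.val (h2.symm.trans h1')
      simp only [lo, hi] at this
      omega
    have e3 : j'.1 + 1 ≠ j.1 := fun e => by
      have e' : hi j' = lo j := Fin.ext e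
      rw [e'] at h2'
      have := congrArg Fin.val (h2'.symm.trans h1)
      simp only [lo, hi] at this
      omega
    omega
  · exact blockS_comm_of_ne τ hk _ _

theorem simpleSwap_adjacent {i j : Fin (n - 1)} (h : i.1 + 1 = j.1) :
    simpleSwap i (hi j) = hi j ∧ simpleSwap j (lo i) = lo i :=
  ⟨simpleSwap_of_ne (lo_ne_of_adjacent h).2.symm (by rw [hi_eq_lo h]; exact (lo_ne_hi j).symm),
    simpleSwap_of_ne (lo_ne_of_adjacent h).1 (lo_ne_of_adjacent h).2⟩

/-- The argument depends on the colours of three consecutive positions. Only three equal colours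
require the braid relation of the given module; the other patterns compare shuffles. -/
theorem indS_braid {i j : Fin (n - 1)} (h : i.1 + 1 = j.1) :
    indS V τ i * indS V τ j * indS V τ i = indS V τ j * indS V τ i * indS V τ j := by
  refine LinearMap.ext fun f => _root_.funext fun α => ?_
  simp only [Module.End.mul_apply]
  have hij := hi_eq_lo h
  obtain ⟨e1, e2⟩ := simpleSwap_adjacent h
  have e3 : simpleSwap i (lo j) = lo i := by rw [← hij, simpleSwap_hi]
  have e4 : simpleSwap j (hi i) = hi j := by rw [hij, simpleSwap_lo]
  by_cases hi' : Mixed α.1 i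
  · by_cases hj' : Mixed α.1 j
    · have hi2 : Mixed (α.swap i hi').1 j ↔ colour α.1 (lo i) ≠ colour α.1 (hi j) := by
        rw [Mixed, colour_shuffle_swap, colour_shuffle_swap, e1, e3]
      have hj2 : Mixed (α.swap j hj').1 i ↔ colour α.1 (lo i) ≠ colour α.1 (hi j) := by
        rw [Mixed, colour_shuffle_swap, colour_shuffle_swap, e2, e4]
      rw [indS_mixed τ hi', indS_mixed τ hj']
      by_cases hc : colour α.1 (lo i) = colour α.1 (hi j)
      -- Colours `a b a`: the first exchange brings the equal colours together, one block operator
      -- acts, and the last exchange undoes the first.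
      · obtain ⟨k, m, h1, h2⟩ := exists_of_not_mixed _ j (mt hi2.1 (not_not.2 hc))
        rw [indS_block τ h1 h2, indS_mixed τ (mixed_shuffle_swap hi'), swap_swap]
        rw [swap_apply, ← (simpleSwap i).injective.eq_iff, simpleSwap_apply_self] at h1 h2
        rw [e3] at h1
        rw [e1] at h2
        rw [indS_block τ (α := α.swap j hj') (k := k) (j := m),
            indS_mixed τ (mixed_shuffle_swap hj'),
          swap_swap]
        · rw [swap_apply, h1, e2]
        · rw [swap_apply, h2, simpleSwap_hi, hij]
      -- Three different colours: both sides evaluate `f` at the same shuffle.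
      · have h1 := hi2.2 hc
        have h2 := hj2.2 hc
        have h3 : Mixed ((α.swap i hi').swap j h1).1 i := by
          rw [Mixed, colour_shuffle_swap, colour_shuffle_swap, colour_shuffle_swap,
            colour_shuffle_swap, e2, e4, e1, simpleSwap_lo, hij]
          exact hj'
        have h4 : Mixed ((α.swap j hj').swap i h2).1 j := by
          rw [Mixed, colour_shuffle_swap, colour_shuffle_swap, colour_shuffle_swap,
            colour_shuffle_swap, e1, e3, e2, simpleSwap_hi, ← hij]
          exact hi'
        rw [indS_mixed τ h1, indS_mixed τ h2, indS_mixed τ h3, indS_mixed τ h4]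
        congr 1
        refine Subtype.ext (Equiv.ext fun a => ?_)
        exact Equiv.congr_fun (simpleSwap_braid h) (α.1 a)
    -- Colours `a b b`: the same block operator acts before or after two exchanges that move the
    -- pair as a whole; `a a b` below is symmetric.
    · obtain ⟨k, m, h1, h2⟩ := exists_of_not_mixed α j hj'
      have h3 : Mixed (α.swap i hi').1 j := by
        rw [Mixed, colour_shuffle_swap, colour_shuffle_swap, e1, e3]
        rw [not_not] at hj'
        rw [← hj', ← hij]
        exact hi'
      rw [indS_mixed τ hi', indS_mixed τ h3, indS_block τ h1 h2, indS_mixed τ hi', indS_mixed τ h3,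
        indS_block τ (α := (α.swap i hi').swap j h3) (k := k) (j := m)]
      · rw [swap_apply, swap_apply, h1, e3, e2]
      · rw [swap_apply, swap_apply, h2, e1, simpleSwap_hi, hij]
  · obtain ⟨k, m, h1, h2⟩ := exists_of_not_mixed α i hi'
    by_cases hj' : Mixed α.1 j
    · have h3 : Mixed (α.swap j hj').1 i := by
        rw [Mixed, colour_shuffle_swap, colour_shuffle_swap, e2, e4]
        rw [not_not] at hi'
        rw [hi', hij]
        exact hj'
      rw [indS_mixed τ hj', indS_mixed τ h3, indS_block τ h1 h2, indS_mixed τ hj', indS_mixed τ h3,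
        indS_block τ (α := (α.swap j hj').swap i h3) (k := k) (j := m)]
      · rw [swap_apply, swap_apply, h1, e2, simpleSwap_lo, hij]
      · rw [swap_apply, swap_apply, h2, e4, e1]
    · obtain ⟨k', m', h1', h2'⟩ := exists_of_not_mixed α j hj'
      have h3 := α.1.injective ((h2.trans hij).trans h1'.symm)
      obtain rfl : k = k' := congrArg Sigma.fst h3
      have h4 : hi m = lo m' := by simpa using h3
      have hb := LinearMap.congr_fun
        ((blockS_coxeter (V := V) τ k).braid m m' (congrArg Fin.val h4)) (f α)
      simp only [Module.End.mul_apply] at hb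
      rw [indS_block τ h1 h2, indS_block τ h1' h2', indS_block τ h1 h2, hb, indS_block τ h1' h2',
        indS_block τ h1 h2, indS_block τ h1' h2']

theorem shuffle_swap_symm (α : Shuffle nh) {i : Fin (n - 1)} (h : Mixed α.1 i) (b : Fin n) :
    (α.swap i h).1.symm b = α.1.symm (simpleSwap i b) := by
  rw [Equiv.symm_apply_eq, swap_apply, Equiv.apply_symm_apply, simpleSwap_apply_self]

variable {c} (hρ : SchurRelations ρ c)

theorem indS_mul_indG (i : Fin (n - 1)) (g : Fin n → G) :
    indS V τ i * indG ρ g = indG ρ (fun m => g (simpleSwap i m)) * indS V τ i := by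
  refine LinearMap.ext fun f => _root_.funext fun α => ?_
  rw [Module.End.mul_apply, Module.End.mul_apply, indG_apply]
  by_cases h : Mixed α.1 i
  · rw [indS_mixed τ h, indS_mixed τ h]
    rfl
  · obtain ⟨k, j, h1, h2⟩ := exists_of_not_mixed α i h
    rw [indS_block τ h1 h2, indS_block τ h1 h2, indG_apply, ← Module.End.mul_apply,
      ← Module.End.mul_apply, blockS, ← TensorProduct.map_mul, ← TensorProduct.map_mul, mul_one,
      one_mul]
    congr 2
    refine LinearMap.ext fun v => ?_
    rw [Module.End.mul_apply, permV_labelAct, sigmaCongrRight_blockSwap_trans α.1 h1 h2]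
    rfl

include hρ in
-- At a mixed position `t` acts by zero and `s_i` only exchanges labels; otherwise this is the block
-- relation `blockS_mul_blockX_lo`.
theorem indS_mul_indX (i : Fin (n - 1)) :
    indS V τ i * indX V c τ (lo i) = indX V c τ (hi i) * indS V τ i -
      ∑ h : G, indG ρ (Pi.mulSingle (lo i) h * Pi.mulSingle (hi i) h⁻¹) := by
  refine LinearMap.ext fun f => _root_.funext fun α => ?_
  have ht : (∑ h : G, indG ρ (Pi.mulSingle (lo i) h * Pi.mulSingle (hi i) h⁻¹) :
      Module.End F (Induced F V nh Y)) f α =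
      TensorProduct.map (tAct ρ α.1 (lo i) (hi i)) 1 (f α) := by
    have e := map_sum (LinearMap.rTensorHom (R := F) Y) (fun h : G => labelAct ρ α.1
      (Pi.mulSingle (lo i) h * Pi.mulSingle (hi i) h⁻¹)) Finset.univ
    refine Eq.trans ?_ (LinearMap.congr_fun e (f α)).symm
    rw [LinearMap.sum_apply, Finset.sum_apply, LinearMap.sum_apply]
    rfl
  rw [LinearMap.sub_apply, Pi.sub_apply, ht, Module.End.mul_apply, Module.End.mul_apply,
    indX_apply]
  by_cases h : Mixed α.1 i
  · rw [indS_mixed τ h, indS_mixed τ h, indX_apply, shuffle_swap_symm, simpleSwap_lo,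
      tAct_of_colour_ne ρ hρ α.1 h, TensorProduct.map_zero_left, LinearMap.zero_apply, sub_zero]
  · obtain ⟨k, j, h1, h2⟩ := exists_of_not_mixed α i h
    rw [indS_block τ h1 h2, indS_block τ h1 h2, indX_apply, ← h1, ← h2,
      Equiv.symm_apply_apply, Equiv.symm_apply_apply, tAct_of_block ρ hρ α.1 k (lo_ne_hi j),
      ← Module.End.mul_apply, blockS_mul_blockX_lo, LinearMap.sub_apply]
    rfl

theorem indS_mul_indX_far (i : Fin (n - 1)) (b : Fin n) (h₁ : b ≠ lo i) (h₂ : b ≠ hi i) :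
    indS V τ i * indX V c τ b = indX V c τ b * indS V τ i := by
  refine LinearMap.ext fun f => _root_.funext fun α => ?_
  rw [Module.End.mul_apply, Module.End.mul_apply, indX_apply]
  by_cases h : Mixed α.1 i
  · rw [indS_mixed τ h, indS_mixed τ h, indX_apply, shuffle_swap_symm, simpleSwap_of_ne h₁ h₂]
  · obtain ⟨k, j, h1, h2⟩ := exists_of_not_mixed α i h
    rw [indS_block τ h1 h2, indS_block τ h1 h2, indX_apply, ← Module.End.mul_apply,
      blockS_mul_blockX_far]
    · rfl
    · rw [ne_eq, Equiv.symm_apply_eq, h1]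
      exact h₁
    · rw [ne_eq, Equiv.symm_apply_eq, h2]
      exact h₂

include hρ in
theorem affineRelations_induced :
    AffineRelations (G := G) (n := n) (B := Module.End F (Induced F V nh Y)) (indG ρ) (indS V τ)
      (indX V c τ) where
  g_one := by
    refine LinearMap.ext fun f => _root_.funext fun α => ?_
    rw [indG_apply, labelAct_one, TensorProduct.map_one]
    rfl
  g_mul g g' := by
    refine LinearMap.ext fun f => _root_.funext fun α => ?_
    rw [Module.End.mul_apply, indG_apply, indG_apply, indG_apply, labelAct_mul,
      ← Module.End.mul_apply, ← TensorProduct.map_mul, mul_one]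
  x_comm i j := by
    refine LinearMap.ext fun f => _root_.funext fun α => ?_
    rw [Module.End.mul_apply, Module.End.mul_apply, indX_apply, indX_apply, indX_apply, indX_apply,
      ← Module.End.mul_apply, blockX_comm]
    rfl
  x_g i g := by
    refine LinearMap.ext fun f => _root_.funext fun α => ?_
    rw [Module.End.mul_apply, Module.End.mul_apply, indX_apply, indG_apply,
        indG_apply ρ g (indX V c τ i f), indX_apply,
      ← Module.End.mul_apply, ← Module.End.mul_apply, blockX, ← TensorProduct.map_mul,
      ← TensorProduct.map_mul, one_mul, one_mul, mul_one, mul_one]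
  coxeter :=
    { sq := indS_sq τ, comm := fun _ _ h => indS_comm τ h, braid := fun _ _ h => indS_braid τ h }
  s_x := indS_mul_indX ρ τ hρ
  s_x_far := indS_mul_indX_far τ
  s_g := indS_mul_indG ρ τ

/-- The action of the wreath Hecke algebra on the induced module. -/
def inducedAct : Affine F G n →ₐ[F] Module.End F (Induced F V nh Y) :=
  liftAffine F (affineRelations_induced ρ τ hρ)

end Induced

/-! ### The induced module of a family and the homomorphisms into it. -/

section InducedModule

variable {F : Type u} [Field F] {G : Type u} [Group G] [Fintype G] {r n : ℕ}
  {V : Fin r → Type u} [∀ k, AddCommGroup (V k)] [∀ k, Module F (V k)]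
  [∀ k, FiniteDimensional F (V k)]
  (ρ : ∀ k, Representation F G (V k)) {c : Fin r → F} (hρ : SchurRelations ρ c)
  {Y : Comp r n → Type u} [∀ nh, AddCommGroup (Y nh)] [∀ nh, Module F (Y nh)]
  (τ : ∀ nh, AHat F nh →ₐ[F] Module.End F (Y nh))

/-- The module over the wreath Hecke algebra induced from a family of modules over the algebras
`A_{n̂,r}`. -/
@[nolint unusedArguments]
def InducedModule (_ : SchurRelations ρ c) (_ : ∀ nh, AHat F nh →ₐ[F] Module.End F (Y nh)) :
    Type u := ∀ nh, Induced F V nh (Y nh)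

instance : AddCommGroup (InducedModule ρ hρ τ) :=
  inferInstanceAs (AddCommGroup (∀ nh, Induced F V nh (Y nh)))

instance : Module F (InducedModule ρ hρ τ) :=
  inferInstanceAs (Module F (∀ nh, Induced F V nh (Y nh)))

instance [∀ nh, Module.Finite F (Y nh)] : Module.Finite F (InducedModule ρ hρ τ) :=
  haveI : ∀ nh : Comp r n, Finite (Shuffle nh) := fun nh =>
    Finite.of_injective (fun α => (⟨nh, α⟩ : Label r n)) fun _ _ h => by simpa using h
  inferInstanceAs (Module.Finite F (∀ nh, Induced F V nh (Y nh)))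

instance : Module (Affine F G n) (InducedModule ρ hρ τ) where
  smul a u := fun nh => inducedAct ρ (τ nh) hρ a (u nh)
  one_smul u := _root_.funext fun nh => by
    change inducedAct ρ (τ nh) hρ 1 (u nh) = u nh
    rw [map_one, Module.End.one_apply]
  mul_smul a b u := _root_.funext fun nh => by
    change inducedAct ρ (τ nh) hρ (a * b) (u nh) = _
    rw [map_mul]; rfl
  smul_zero a := _root_.funext fun nh => map_zero _
  smul_add a u w := _root_.funext fun nh => map_add _ _ _
  add_smul a b u := _root_.funext fun nh => by
    change inducedAct ρ (τ nh) hρ (a + b) (u nh) = _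
    rw [map_add]; rfl
  zero_smul u := _root_.funext fun nh => by
    change inducedAct ρ (τ nh) hρ 0 (u nh) = _
    rw [map_zero]; rfl

theorem induced_smul_apply (a : Affine F G n) (u : InducedModule ρ hρ τ) (nh : Comp r n) :
    (a • u) nh = inducedAct ρ (τ nh) hρ a (u nh) := rfl

instance : IsScalarTower F (Affine F G n) (InducedModule ρ hρ τ) :=
  IsScalarTower.of_algebraMap_smul fun d u => _root_.funext fun nh => by
    rw [induced_smul_apply, AlgHom.commutes]; rfl

open Classical in
/-- The inclusion of a summand of the induced module. -/
def incl (nh : Comp r n) (α : Shuffle nh) : VHat F V nh ⊗[F] Y nh →ₗ[F] InducedModule ρ hρ τ :=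
  LinearMap.single F (fun nh => Induced F V nh (Y nh)) nh ∘ₗ
    LinearMap.single F (fun _ : Shuffle nh => VHat F V nh ⊗[F] Y nh) α

theorem incl_same (nh : Comp r n) (α : Shuffle nh) (w : VHat F V nh ⊗[F] Y nh) :
    incl ρ hρ τ nh α w nh α = w := by
  classical
  refine (congrFun (Pi.single_eq_same (M := fun nh => Induced F V nh (Y nh)) nh _) α).trans ?_
  exact Pi.single_eq_same (M := fun _ : Shuffle nh => VHat F V nh ⊗[F] Y nh) α w

theorem incl_ne {nh : Comp r n} {α β : Shuffle nh} (h : β ≠ α) (w : VHat F V nh ⊗[F] Y nh) :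
    incl ρ hρ τ nh α w nh β = 0 := by
  classical
  refine (congrFun (Pi.single_eq_same (M := fun nh => Induced F V nh (Y nh)) nh _) β).trans ?_
  exact Pi.single_eq_of_ne (M := fun _ : Shuffle nh => VHat F V nh ⊗[F] Y nh) h w

theorem incl_ne_left {nh mh : Comp r n} (h : mh ≠ nh) (α : Shuffle nh)
    (w : VHat F V nh ⊗[F] Y nh) : incl ρ hρ τ nh α w mh = 0 := by
  classical
  exact Pi.single_eq_of_ne (M := fun nh => Induced F V nh (Y nh)) h _

variable {ρ hρ τ} in
theorem eq_incl {u : InducedModule ρ hρ τ} {nh : Comp r n} {α : Shuffle nh}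
    {w : VHat F V nh ⊗[F] Y nh} (h1 : u nh α = w) (h2 : ∀ β, β ≠ α → u nh β = 0)
    (h3 : ∀ mh, mh ≠ nh → u mh = 0) : u = incl ρ hρ τ nh α w := by
  refine _root_.funext fun mh => ?_
  by_cases h : mh = nh
  · subst h
    refine _root_.funext fun β => ?_
    by_cases h : β = α
    · subst h
      rw [h1, incl_same]
    · rw [h2 β h, incl_ne ρ hρ τ h]
  · rw [h3 mh h, incl_ne_left ρ hρ τ h]

theorem sum_incl (u : InducedModule ρ hρ τ) :
    ∑ x : Label r n, incl ρ hρ τ x.1 x.2 (u x.1 x.2) = u := by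
  refine _root_.funext fun mh => _root_.funext fun β => ?_
  have h : (∑ x : Label r n, incl ρ hρ τ x.1 x.2 (u x.1 x.2)) mh β =
      ∑ x : Label r n, incl ρ hρ τ x.1 x.2 (u x.1 x.2) mh β := by
    refine (congrFun (Finset.sum_apply mh _ _) β).trans (Finset.sum_apply β _ _)
  rw [h, Finset.sum_eq_single ⟨mh, β⟩]
  · exact incl_same ρ hρ τ mh β _
  · rintro ⟨nh, α⟩ _ hne
    by_cases h : mh = nh
    · subst h
      exact incl_ne ρ hρ τ (fun h => hne (by rw [h])) _
    · rw [incl_ne_left ρ hρ τ h]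
      rfl
  · exact fun h => absurd (Finset.mem_univ _) h

theorem ofG_smul_incl (g : Fin n → G) (nh : Comp r n) (α : Shuffle nh)
    (w : VHat F V nh ⊗[F] Y nh) : ofG F g • incl ρ hρ τ nh α w =
      incl ρ hρ τ nh α (TensorProduct.map (labelAct ρ α.1 g) 1 w) := by
  refine eq_incl ?_ (fun β h => ?_) (fun mh h => ?_)
  · rw [induced_smul_apply, inducedAct, liftAffine_ofG, indG_apply, incl_same]
  · rw [induced_smul_apply, inducedAct, liftAffine_ofG, indG_apply, incl_ne ρ hρ τ h, map_zero]
  · rw [induced_smul_apply, incl_ne_left ρ hρ τ h, map_zero]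

theorem x_smul_incl (nh : Comp r n) (α : Shuffle nh) (a : Σ k, Fin (nh.1 k))
    (w : VHat F V nh ⊗[F] Y nh) : x F G (α.1 a) • incl ρ hρ τ nh α w =
      incl ρ hρ τ nh α (blockX V c (τ nh) a w) := by
  refine eq_incl ?_ (fun β h => ?_) (fun mh h => ?_)
  · rw [induced_smul_apply, inducedAct, liftAffine_x, indX_apply, incl_same,
      Equiv.symm_apply_apply]
  · rw [induced_smul_apply, inducedAct, liftAffine_x, indX_apply, incl_ne ρ hρ τ h, map_zero]
  · rw [induced_smul_apply, incl_ne_left ρ hρ τ h, map_zero]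

theorem s_smul_incl {nh : Comp r n} {α : Shuffle nh} {i : Fin (n - 1)} {k : Fin r}
    {j : Fin (nh.1 k - 1)} (h1 : α.1 ⟨k, lo j⟩ = lo i) (h2 : α.1 ⟨k, hi j⟩ = hi i)
    (w : VHat F V nh ⊗[F] Y nh) :
    s F G i • incl ρ hρ τ nh α w = incl ρ hρ τ nh α (blockS V (τ nh) k j w) := by
  refine eq_incl ?_ (fun β h => ?_) (fun mh h => ?_)
  · rw [induced_smul_apply, inducedAct, liftAffine_s, indS_block _ h1 h2, incl_same]
  · rw [induced_smul_apply, inducedAct, liftAffine_s]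
    by_cases hm : Mixed β.1 i
    · rw [indS_mixed _ hm, incl_ne ρ hρ τ]
      rintro rfl
      exact not_mixed_of h1 h2 (mixed_shuffle_swap hm)
    · obtain ⟨k', j', h1', h2'⟩ := exists_of_not_mixed β i hm
      rw [indS_block _ h1' h2', incl_ne ρ hρ τ h, map_zero]
  · rw [induced_smul_apply, incl_ne_left ρ hρ τ h, map_zero]

/-- A vector of `Y n̂` determines an equivariant map. -/
def inclHom (nh : Comp r n) (α : Shuffle nh) (y : Y nh) :
    VHat F V nh →ₗ[F] InducedModule ρ hρ τ :=
  incl ρ hρ τ nh α ∘ₗ (TensorProduct.mk F (VHat F V nh) (Y nh)).flip y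

theorem inclHom_apply (nh : Comp r n) (α : Shuffle nh) (y : Y nh) (v : VHat F V nh) :
    inclHom ρ hρ τ nh α y v = incl ρ hρ τ nh α (v ⊗ₜ y) := rfl

theorem inclHom_equivariant (nh : Comp r n) (α : Shuffle nh) (y : Y nh) :
    LabelEquivariant ρ α.1 (inclHom ρ hρ τ nh α y) := fun g v => by
  rw [inclHom_apply, inclHom_apply, ofG_smul_incl]
  rfl

variable (F V) in
/-- Contraction of the first factor by a coordinate. -/
def contract {nh : Comp r n} (q : HatIndex F V nh) (X : Type u) [AddCommGroup X] [Module F X] :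
    VHat F V nh ⊗[F] X →ₗ[F] X :=
  TensorProduct.lift ((LinearMap.lsmul F X) ∘ₗ (hatBasis F V nh).coord q)

theorem contract_tmul {nh : Comp r n} (q : HatIndex F V nh) {X : Type u} [AddCommGroup X]
    [Module F X] (v : VHat F V nh) (y : X) :
    contract F V q X (v ⊗ₜ y) = (hatBasis F V nh).coord q v • y := rfl

theorem matUnit_smul_incl_same (nh : Comp r n) (α : Shuffle nh) (q : HatIndex F V nh)
    (v : VHat F V nh) (w : VHat F V nh ⊗[F] Y nh) :
    matUnit ρ c α.1 q v • incl ρ hρ τ nh α w = incl ρ hρ τ nh α (v ⊗ₜ contract F V q (Y nh) w) := by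
  induction w using TensorProduct.induction_on with
  | zero => simp only [map_zero, smul_zero, TensorProduct.tmul_zero]
  | tmul u y =>
    rw [contract_tmul, TensorProduct.tmul_smul, map_smul]
    exact matUnit_smul_same ρ hρ (inclHom_equivariant ρ hρ τ nh α y) q v u
  | add w w' h h' => rw [map_add, smul_add, h, h', map_add, TensorProduct.tmul_add, map_add]

theorem matUnit_smul_incl_diff {nh mh : Comp r n} (α : Shuffle nh) (β : Shuffle mh)
    (hne : colour α.1 ≠ colour β.1) (q : HatIndex F V nh)
    (v : VHat F V nh) (w : VHat F V mh ⊗[F] Y mh) :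
    matUnit ρ c α.1 q v • incl ρ hρ τ mh β w = 0 := by
  induction w using TensorProduct.induction_on with
  | zero => simp only [map_zero, smul_zero]
  | tmul u y => exact matUnit_smul_diff ρ hρ (inclHom_equivariant ρ hρ τ mh β y) hne q v u
  | add w w' h h' => rw [map_add, smul_add, h, h', add_zero]

/-- The matrix unit kills all summands but that of the label `(nh, α)`, where it acts as a rank one
operator on `V(n̂)`. -/
theorem matUnit_smul_induced (nh : Comp r n) (α : Shuffle nh) (q : HatIndex F V nh)
    (v : VHat F V nh) (u : InducedModule ρ hρ τ) :
    matUnit ρ c α.1 q v • u = incl ρ hρ τ nh α (v ⊗ₜ contract F V q (Y nh) (u nh α)) := by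
  conv_lhs => rw [← sum_incl ρ hρ τ u, Finset.smul_sum]
  rw [Finset.sum_eq_single ⟨nh, α⟩]
  · exact matUnit_smul_incl_same ρ hρ τ nh α q v _
  · rintro y _ hne
    exact matUnit_smul_incl_diff ρ hρ τ α y.2
      (fun h => hne (Label.ext_colour (x := y) (y := ⟨nh, α⟩) h.symm)) q v _
  · exact fun h => absurd (Finset.mem_univ _) h

include hρ in
theorem nonempty_hatIndex (nh : Comp r n) : Nonempty (HatIndex F V nh) :=
  haveI := hρ.nontrivial
  ⟨fun _ => ⟨0, Module.finrank_pos⟩⟩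

/-- The vectors of `Y n̂` as homomorphisms into the induced module. -/
def unitHom (nh : Comp r n) : Y nh →ₗ[F] HomHat ρ (InducedModule ρ hρ τ) nh where
  toFun y := ⟨inclHom ρ hρ τ nh (placeShuffle nh) y,
    (mem_homHat_iff ρ hρ _).2 (inclHom_equivariant ρ hρ τ nh (placeShuffle nh) y)⟩
  map_add' y y' := Subtype.ext (LinearMap.ext fun v => by
    change incl ρ hρ τ nh _ (v ⊗ₜ (y + y')) = incl ρ hρ τ nh _ (v ⊗ₜ y) + incl ρ hρ τ nh _ (v ⊗ₜ y')
    rw [TensorProduct.tmul_add, map_add])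
  map_smul' d y := Subtype.ext (LinearMap.ext fun v => by
    change incl ρ hρ τ nh _ (v ⊗ₜ (d • y)) = d • incl ρ hρ τ nh _ (v ⊗ₜ y)
    rw [TensorProduct.tmul_smul, map_smul])

theorem unitHom_apply (nh : Comp r n) (y : Y nh) (v : VHat F V nh) :
    (unitHom ρ hρ τ nh y).1 v = incl ρ hρ τ nh (placeShuffle nh) (v ⊗ₜ y) := rfl

/-- Evaluation at the basis vector of index `q`, followed by contraction with `q`, is the inverse.
For surjectivity, `φ v` is a matrix unit applied to the value of `φ` at that basis vector, hence of
the form `v ⊗ y` in the standard summand. -/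
theorem unitHom_bijective (nh : Comp r n) : Function.Bijective (unitHom ρ hρ τ nh) := by
  obtain ⟨q⟩ := nonempty_hatIndex (n := n) ρ hρ nh
  have hq : (hatBasis F V nh).coord q (hatBasis F V nh q) = 1 := by simp
  constructor
  · refine (injective_iff_map_eq_zero _).2 fun y hy => ?_
    have h := congrArg (fun φ : HomHat ρ (InducedModule ρ hρ τ) nh =>
      contract F V q (Y nh) (φ.1 (hatBasis F V nh q) nh (placeShuffle nh))) hy
    simp only [unitHom_apply, incl_same] at h
    rw [contract_tmul, hq, one_smul] at h
    exact h.trans (map_zero _)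
  · intro φ
    refine ⟨contract F V q (Y nh) (φ.1 (hatBasis F V nh q) nh (placeShuffle nh)),
      Subtype.ext (LinearMap.ext fun v => ?_)⟩
    rw [unitHom_apply, ← matUnit_smul_induced]
    have h := matUnit_smul_same ρ hρ (((mem_homHat_iff ρ hρ _).1 φ.2)) q v (hatBasis F V nh q)
    rw [hq, one_smul] at h
    exact h

/-- The place permutations in `homS` and `blockS` cancel, and so do the scalars `(c k)⁻¹` in `homY`
and `c k` in `blockX`. -/
theorem unitHom_act (nh : Comp r n) (a : AHat F nh) (y : Y nh) :
    unitHom ρ hρ τ nh (τ nh a y) = homAct ρ hρ _ nh a (unitHom ρ hρ τ nh y) := by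
  refine hat_intertwine _ _ _ (fun k j y => ?_) (fun k j y => ?_) a y
  · rw [homAct_s]
    refine Subtype.ext (LinearMap.ext fun v => ?_)
    rw [homS_apply, unitHom_apply, unitHom_apply, s_smul_incl ρ hρ τ (place_lo nh k j)
      (place_hi' nh k j), blockS, TensorProduct.map_tmul, ← Module.End.mul_apply (permV F V _),
      (permV_coxeter nh k).sq, Module.End.one_apply]
  · rw [homAct_y]
    refine Subtype.ext (LinearMap.ext fun v => ?_)
    rw [homY_apply, unitHom_apply, unitHom_apply]
    refine Eq.trans ?_ (congrArg _ (x_smul_incl ρ hρ τ nh (placeShuffle nh) ⟨k, j⟩ _)).symm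
    rw [blockX, TensorProduct.map_tmul, LinearMap.smul_apply, TensorProduct.tmul_smul, map_smul,
      inv_smul_smul₀ (hρ.ne_zero k), Module.End.one_apply]

end InducedModule

/-! ### Modules over the finite product `A_{n,r}`. -/

section Summands

variable {F : Type u} [Field F] {r n : ℕ} (N : Type u) [AddCommGroup N] [Module F N]
  [Module (A F r n) N] [IsScalarTower F (A F r n) N]

open Classical in
variable (F) in
/-- An element of a factor of `A_{n,r}`. -/
def factor (nh : Comp r n) (a : AHat F nh) : A F r n :=
  Pi.single (M := fun nh : Comp r n => AHat F nh) nh a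

theorem factor_mul (nh : Comp r n) (a b : AHat F nh) :
    factor F nh (a * b) = factor F nh a * factor F nh b := Pi.single_mul _ _ _

theorem mul_factor (nh : Comp r n) (a : A F r n) (b : AHat F nh) :
    a * factor F nh b = factor F nh (a nh * b) := by
  refine _root_.funext fun mh => ?_
  by_cases h : mh = nh
  · subst h
    rw [Pi.mul_apply, factor, factor, Pi.single_eq_same, Pi.single_eq_same]
  · rw [Pi.mul_apply, factor, factor, Pi.single_eq_of_ne h, Pi.single_eq_of_ne h, mul_zero]

theorem factor_mul' (nh : Comp r n) (a : A F r n) (b : AHat F nh) :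
    factor F nh b * a = factor F nh (b * a nh) := by
  refine _root_.funext fun mh => ?_
  by_cases h : mh = nh
  · subst h
    rw [Pi.mul_apply, factor, factor, Pi.single_eq_same, Pi.single_eq_same]
  · rw [Pi.mul_apply, factor, factor, Pi.single_eq_of_ne h, Pi.single_eq_of_ne h, zero_mul]

theorem factor_mul_of_ne {nh mh : Comp r n} (h : nh ≠ mh) (a : AHat F nh) (b : AHat F mh) :
    factor F nh a * factor F mh b = 0 := by
  rw [mul_factor, factor, factor, Pi.single_eq_of_ne h.symm, zero_mul, Pi.single_zero]

theorem sum_factor : ∑ nh : Comp r n, factor F nh 1 = (1 : A F r n) := by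
  classical
  exact Finset.univ_sum_single (M := fun nh : Comp r n => AHat F nh) (1 : A F r n)

variable (F)

/-- The summand of a module over `A_{n,r}` that belongs to a factor. -/
def summand (nh : Comp r n) : Submodule F N :=
  LinearMap.range (Algebra.lsmul F F N (factor F nh 1))

theorem mem_summand {nh : Comp r n} {u : N} : u ∈ summand F N nh ↔ factor F nh 1 • u = u := by
  constructor
  · rintro ⟨w, rfl⟩
    change factor F nh 1 • factor F nh 1 • w = factor F nh 1 • w
    rw [← mul_smul, ← factor_mul, mul_one]
  · exact fun h => ⟨u, h⟩

theorem factor_smul_mem (nh : Comp r n) (a : AHat F nh) (u : N) :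
    factor F nh a • u ∈ summand F N nh := by
  rw [mem_summand, ← mul_smul, ← factor_mul, one_mul]

/-- The action of a factor of `A_{n,r}` on its summand. -/
def summandAct (nh : Comp r n) : AHat F nh →ₐ[F] Module.End F (summand F N nh) :=
  AlgHom.ofLinearMap
    { toFun := fun a => LinearMap.restrict (Algebra.lsmul F F N (factor F nh a))
        fun u _ => factor_smul_mem F N nh a u
      map_add' := fun a b => LinearMap.ext fun u => Subtype.ext (by
        change factor F nh (a + b) • u.1 = factor F nh a • u.1 + factor F nh b • u.1
        rw [factor, Pi.single_add, add_smul]; rfl)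
      map_smul' := fun d a => LinearMap.ext fun u => Subtype.ext (by
        change factor F nh (d • a) • u.1 = d • factor F nh a • u.1
        rw [factor, Pi.single_smul, smul_assoc]; rfl) }
    (LinearMap.ext fun u => Subtype.ext ((mem_summand F N).1 u.2))
    (fun a b => LinearMap.ext fun u => Subtype.ext (by
      change factor F nh (a * b) • u.1 = factor F nh a • factor F nh b • u.1
      rw [factor_mul, mul_smul]))

theorem summandAct_apply (nh : Comp r n) (a : AHat F nh) (u : summand F N nh) :
    (summandAct F N nh a u).1 = factor F nh a • u.1 := rfl

/-- The projection onto a summand. -/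
def summandProj (nh : Comp r n) : N →ₗ[F] summand F N nh :=
  (Algebra.lsmul F F N (factor F nh 1)).codRestrict _ fun u => factor_smul_mem F N nh 1 u

theorem summandProj_apply (nh : Comp r n) (u : N) :
    (summandProj F N nh u).1 = factor F nh 1 • u := rfl

theorem summandProj_smul (nh : Comp r n) (a : A F r n) (u : N) :
    summandProj F N nh (a • u) = summandAct F N nh (a nh) (summandProj F N nh u) :=
  Subtype.ext (by
    rw [summandProj_apply, summandAct_apply, summandProj_apply, ← mul_smul, ← mul_smul,
      factor_mul', ← factor_mul, one_mul, mul_one])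

/-- The units of the factors are orthogonal idempotents with sum one. -/
theorem summandProj_bijective :
    Function.Bijective (LinearMap.pi (summandProj F (r := r) (n := n) N)) := by
  constructor
  · refine (injective_iff_map_eq_zero _).2 fun u hu => ?_
    rw [← one_smul (A F r n) u, ← sum_factor, Finset.sum_smul]
    exact Finset.sum_eq_zero fun nh _ => congrArg Subtype.val (congrFun hu nh)
  · intro y
    refine ⟨∑ nh, (y nh).1, _root_.funext fun nh => Subtype.ext ?_⟩
    rw [LinearMap.pi_apply, summandProj_apply, Finset.smul_sum, Finset.sum_eq_single nh]
    · exact (mem_summand F N).1 (y nh).2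
    · intro mh _ h
      rw [← (mem_summand F N).1 (y mh).2, ← mul_smul, factor_mul_of_ne h.symm, zero_smul]
    · exact fun h => absurd (Finset.mem_univ _) h

end Summands

/-! ### Essential surjectivity. -/

section EssSurj

variable {F : Type u} [Field F] {G : Type u} [Group G] [Fintype G] {r n : ℕ}
  {V : Fin r → Type u} [∀ k, AddCommGroup (V k)] [∀ k, Module F (V k)]
  [∀ k, FiniteDimensional F (V k)]
  (ρ : ∀ k, Representation F G (V k)) {c : Fin r → F} (hρ : SchurRelations ρ c)

section

variable (n) (N : Type u) [AddCommGroup N] [Module F N]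
  [Module (A F r n) N] [IsScalarTower F (A F r n) N]

/-- The module over the wreath Hecke algebra which corresponds to a module over `A_{n,r}`. -/
abbrev inducedFrom : Type u := InducedModule ρ hρ fun nh : Comp r n => summandAct F N nh

/-- The vectors of a module over `A_{n,r}` as families of homomorphisms. -/
def unitLinear : N →ₗ[A F r n] HomSpace n ρ (inducedFrom n ρ hρ N) hρ where
  toFun u := fun nh => unitHom ρ hρ (fun nh : Comp r n => summandAct F N nh) nh
    (summandProj F N nh u)
  map_add' u w := _root_.funext fun nh => by
    rw [map_add, map_add]; rfl
  map_smul' a u := _root_.funext fun nh => by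
    rw [summandProj_smul, unitHom_act]; rfl

theorem unitLinear_bijective : Function.Bijective (unitLinear n ρ hρ N) :=
  (Function.Bijective.piMap fun nh =>
    unitHom_bijective ρ hρ (fun nh : Comp r n => summandAct F N nh) nh).comp
      (summandProj_bijective F N)

end

/-- Isomorphic modules have isomorphic spaces of homomorphisms. -/
def homSpaceEquiv {M N : Type u} [AddCommGroup M] [Module F M] [Module (Affine F G n) M]
    [IsScalarTower F (Affine F G n) M] [AddCommGroup N] [Module F N] [Module (Affine F G n) N]
    [IsScalarTower F (Affine F G n) N] (e : M ≃ₗ[Affine F G n] N) :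
    HomSpace n ρ M hρ ≃ₗ[A F r n] HomSpace n ρ N hρ :=
  LinearEquiv.ofLinearMap (homSpaceMap ρ hρ e.toLinearMap) (homSpaceMap ρ hρ e.symm.toLinearMap)
    (LinearMap.ext fun u => _root_.funext fun nh => Subtype.ext (LinearMap.ext fun v =>
      e.apply_symm_apply ((u nh).1 v)))
    (LinearMap.ext fun u => _root_.funext fun nh => Subtype.ext (LinearMap.ext fun v =>
      e.symm_apply_apply ((u nh).1 v)))

theorem homFunctor_essImage {M : Type u} [AddCommGroup M] [Module F M] [Module (Affine F G n) M]
    [IsScalarTower F (Affine F G n) M] {N : FDMod F (A F r n)} {X : FDMod F (Affine F G n)}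
    (e : M ≃ₗ[Affine F G n] X.obj) (e' : N.obj ≃ₗ[A F r n] HomSpace n ρ M hρ) :
    (homFunctor (n := n) ρ hρ).essImage N :=
  ⟨X, ⟨ObjectProperty.isoMk _ (e'.trans (homSpaceEquiv ρ hρ e)).symm.toModuleIso⟩⟩

instance : (homFunctor (n := n) ρ hρ).EssSurj where
  mem_essImage N := by
    have := N.property
    exact homFunctor_essImage ρ hρ (X := FDMod.of (Affine F G n) (inducedFrom n ρ hρ N.obj))
      (LinearEquiv.refl _ _) (LinearEquiv.ofBijective _ (unitLinear_bijective n ρ hρ N.obj))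

instance : (homFunctor (n := n) ρ hρ).IsEquivalence where

end EssSurj

/-! ### Restricting an equivalence to full subcategories. -/

section Category

universe v₁ v₂ v₃ v₄ u₁ u₂ u₃ u₄

variable {C : Type u₁} [Category.{v₁} C] {D : Type u₂} [Category.{v₂} D] {C' : Type u₃}
  [Category.{v₃} C'] {D' : Type u₄} [Category.{v₄} D']

/-- An equivalence restricts to an equivalence between full subcategories which correspond to each
other. -/
theorem exists_equivalence_of_essImage (T : C ⥤ D) [T.IsEquivalence] (I : C' ⥤ C) [I.Full]
    [I.Faithful] (J : D' ⥤ D) [J.Full] [J.Faithful]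
    (h : ∀ X : C, I.essImage X ↔ J.essImage (T.obj X)) :
    ∃ T' : C' ≌ D', Nonempty (T'.functor ⋙ J ≅ I ⋙ T) := by
  have hJ : ∀ X : C', J.essImage ((I ⋙ T).obj X) := fun X => (h _).1 (I.obj_mem_essImage X)
  let S : C' ⥤ D' := Functor.essImage.liftFunctor (I ⋙ T) J hJ
  let e : S ⋙ J ≅ I ⋙ T := Functor.essImage.liftFunctorCompIso (I ⋙ T) J hJ
  have h1 : S.Faithful := Functor.Faithful.of_comp_iso e
  have h2 : S.Full := Functor.Full.of_comp_faithful_iso e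
  have h3 : S.EssSurj := ⟨fun Y => by
    -- A preimage of `J Y` under `T` comes from `C'` by the hypothesis on essential images; `J`
    -- reflects the resulting isomorphism.
    let i := T.objObjPreimageIso (J.obj Y)
    obtain ⟨X, ⟨a⟩⟩ := (h (T.objPreimage (J.obj Y))).2
      ((J.obj_mem_essImage Y).ofIso i.symm)
    exact ⟨X, ⟨J.preimageIso (e.app X ≪≫ T.mapIso a ≪≫ i)⟩⟩⟩
  have h4 : S.IsEquivalence := { }
  exact ⟨S.asEquivalence, ⟨e⟩⟩

end Category

/-! ### Inflation along a surjective homomorphism. -/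

section Inflation

variable {F : Type u} [Field F] {B C : Type u} [Ring B] [Algebra F B] [Ring C] [Algebra F C]
  (f : B →ₐ[F] C)

instance : (inflation F f).Faithful where
  map_injective {X Y} g g' h := by
    refine ObjectProperty.hom_ext _ (ModuleCat.hom_ext (LinearMap.ext fun u => ?_))
    exact congrArg (fun k : (inflation F f).obj X ⟶ (inflation F f).obj Y => k.hom.hom u) h

variable {f}

theorem inflation_full (hf : Function.Surjective f) : (inflation F f).Full where
  map_surjective {X Y} g := by
    let g' : X.obj →ₗ[C] Y.obj :=
      { toFun := fun u => g.hom.hom u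
        map_add' := fun u w => g.hom.hom.map_add u w
        map_smul' := fun c u => by
          obtain ⟨b, rfl⟩ := hf c
          exact g.hom.hom.map_smul b u }
    exact ⟨ObjectProperty.homMk (ModuleCat.ofHom g'), rfl⟩

/-- When the kernel annihilates `N`, the action descends along the surjection without changing the
underlying space. -/
theorem inflation_essImage_iff (hf : Function.Surjective f) (N : FDMod F B) :
    (inflation F f).essImage N ↔ ∀ b, f b = 0 → ∀ u : N.obj, b • u = 0 := by
  constructor
  · rintro ⟨X, ⟨e⟩⟩ b hb u
    let i : ((inflation F f).obj X).obj ≅ N.obj := (ObjectProperty.ι _).mapIso e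
    have h0 : ∀ w : ((inflation F f).obj X).obj, b • w = 0 := fun w => by
      change f b • (show X.obj from w) = 0
      rw [hb, zero_smul]
    have h1 : u = i.hom.hom (i.inv.hom u) := (i.toLinearEquiv.apply_symm_apply u).symm
    rw [h1, ← map_smul, h0, map_zero]
  · intro h
    have hker : RingHom.ker f.toRingHom ≤ RingHom.ker (Module.toAddMonoidEnd B N.obj) := fun b hb =>
      AddMonoidHom.ext fun u => h b hb u
    let g : C →+* AddMonoid.End N.obj := f.toRingHom.liftOfSurjective hf ⟨_, hker⟩
    have hg : ∀ b u, g (f b) u = b • u := fun b u =>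
      DFunLike.congr_fun (f.toRingHom.liftOfRightInverse_comp_apply _
        (Function.rightInverse_surjInv hf) ⟨_, hker⟩ b) u
    let X : ModuleCat.{u} C := @ModuleCat.of C _ N.obj _ (Module.compHom N.obj g)
    have hX : Module.Finite F X := by
      have := N.property
      let l : N.obj →ₗ[F] X :=
        { toFun := fun u => u
          map_add' := fun _ _ => rfl
          map_smul' := fun d u => by
            change algebraMap F B d • u = g (algebraMap F C d) u
            rw [← f.commutes, hg] }
      exact Module.Finite.of_surjective l fun u => ⟨u, rfl⟩
    let e : ((inflation F f).obj ⟨X, hX⟩).obj ≃ₗ[B] N.obj :=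
      { toFun := fun u => u
        invFun := fun u => u
        left_inv := fun _ => rfl
        right_inv := fun _ => rfl
        map_add' := fun _ _ => rfl
        map_smul' := fun b u => hg b u }
    exact ⟨⟨X, hX⟩, ⟨ObjectProperty.isoMk _ e.toModuleIso⟩⟩

end Inflation

/-! ### Modules inflated from the cyclotomic quotients. -/

section Quotients

variable (F : Type u) [Field F] (p : ℕ) [Fact p.Prime] [CharP F p] (G : Type u) [Group G]
  [Fintype G]

theorem toCyc_surjective (n : ℕ) (lam : ZMod p → ℕ) : Function.Surjective (toCyc F p G n lam) :=
  RingQuot.mkAlgHom_surjective F _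

theorem tensorMap_surjective {ι : Type} {B C : ι → Type u} [∀ i, Ring (B i)] [∀ i, Algebra F (B i)]
    [∀ i, Ring (C i)] [∀ i, Algebra F (C i)] (f : ∀ i, B i →ₐ[F] C i)
    (hf : ∀ i, Function.Surjective (f i)) : Function.Surjective (tensorMap F f) := by
  intro c
  induction c using PiTensorProduct.induction_on with
  | smul_tprod d c =>
    choose b hb using fun i => hf i (c i)
    refine ⟨d • PiTensorProduct.tprod F b, ?_⟩
    rw [map_smul, tensorMap, PiTensorProduct.liftAlgHom_apply, PiTensorProduct.lift.tprod,
      MultilinearMap.compLinearMap_apply]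
    simp only [AlgHom.toLinearMap_apply, hb]
  | add c c' h h' =>
    obtain ⟨b, rfl⟩ := h
    obtain ⟨b', rfl⟩ := h'
    exact ⟨b + b', map_add _ _ _⟩

theorem tensorMap_single {ι : Type} [DecidableEq ι] {B C : ι → Type u} [∀ i, Ring (B i)]
    [∀ i, Algebra F (B i)] [∀ i, Ring (C i)] [∀ i, Algebra F (C i)] (f : ∀ i, B i →ₐ[F] C i)
    (i : ι) (b : B i) : tensorMap F f (PiTensorProduct.singleAlgHom i b) =
      PiTensorProduct.singleAlgHom i (f i b) := by
  rw [PiTensorProduct.singleAlgHom_apply, PiTensorProduct.singleAlgHom_apply, tensorMap,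
    PiTensorProduct.liftAlgHom_apply, PiTensorProduct.lift.tprod,
    MultilinearMap.compLinearMap_apply]
  congr 1
  funext j
  by_cases h : j = i
  · subst h
    simp
  · simp [Pi.mulSingle_eq_of_ne h]

theorem toACyc_surjective (r n : ℕ) (mu : Fin r → ZMod p → ℕ) :
    Function.Surjective (toACyc F r n p mu) := fun c => by
  choose b hb using fun nh : Comp r n => tensorMap_surjective F
    (fun k => toCyc F p PUnit.{u + 1} (nh.1 k) (mu k)) (fun k => toCyc_surjective F p _ _ _) (c nh)
  exact ⟨b, _root_.funext hb⟩

variable {F p G}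

/-- A homomorphism from the wreath Hecke algebra which respects the cyclotomic relation. -/
def liftCyc {n : ℕ} {lam : ZMod p → ℕ} {B : Type*} [Ring B] [Algebra F B]
    (f : Affine F G n →ₐ[F] B)
    (h : ∀ i : Fin n, i.1 = 0 → f (aeval (x F G i) (cycPoly F p lam)) = 0) :
    Cyc F p G n lam →ₐ[F] B :=
  RingQuot.liftAlgHom F ⟨f, by
    rintro _ _ ⟨i, hi⟩
    rw [h i hi, map_zero]⟩

theorem liftCyc_toCyc {n : ℕ} {lam : ZMod p → ℕ} {B : Type*} [Ring B] [Algebra F B]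
    (f : Affine F G n →ₐ[F] B)
    (h : ∀ i : Fin n, i.1 = 0 → f (aeval (x F G i) (cycPoly F p lam)) = 0)
    (a : Affine F G n) : liftCyc f h (toCyc F p G n lam a) = f a :=
  RingQuot.liftAlgHom_mkAlgHom_apply _ _ _ _

theorem toCyc_cycPoly {n : ℕ} (lam : ZMod p → ℕ) (i : Fin n) (h : i.1 = 0) :
    toCyc F p G n lam (aeval (x F G i) (cycPoly F p lam)) = 0 :=
  (RingQuot.mkAlgHom_rel F (CycRel.g_lam i h)).trans (map_zero _)

/-- The action map factors through the quotient as soon as the generator of the ideal acts by zero,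
so the kernel need not be described. -/
theorem inflation_cyc_essImage_iff {n : ℕ} (lam : ZMod p → ℕ) (M : FDMod F (Affine F G n)) :
    (inflation F (toCyc F p G n lam)).essImage M ↔ ∀ i : Fin n, i.1 = 0 → ∀ m : M.obj,
      aeval (x F G i) (cycPoly F p lam) • m = 0 := by
  rw [inflation_essImage_iff (toCyc_surjective F p G n lam)]
  refine ⟨fun h i hi => h _ (toCyc_cycPoly lam i hi), fun h b hb m => ?_⟩
  have h1 := liftCyc_toCyc (lam := lam) (Algebra.lsmul F F M.obj)
    (fun i hi => LinearMap.ext fun m => h i hi m) b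
  rw [hb, map_zero] at h1
  exact (LinearMap.congr_fun h1 m).symm

/-- The restrictions of `τ` to the factors descend to the cyclotomic quotients and still commute, so
`τ` factors through their tensor product. -/
theorem eq_zero_of_tensorMap_eq_zero {r n : ℕ} {mu : Fin r → ZMod p → ℕ} {nh : Comp r n}
    {B : Type*} [Ring B] [Algebra F B] (τ : AHat F nh →ₐ[F] B)
    (h : ∀ (k : Fin r) (j : Fin (nh.1 k)), j.1 = 0 → τ (PiTensorProduct.singleAlgHom k
      (aeval (x F PUnit.{u + 1} j) (cycPoly F p (mu k)))) = 0)
    {b : AHat F nh}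
    (hb : tensorMap F (fun k => toCyc F p PUnit.{u + 1} (nh.1 k) (mu k)) b = 0) : τ b = 0 := by
  let f : ∀ k, DegCyc F p (nh.1 k) (mu k) →ₐ[F] B := fun k =>
    liftCyc (τ.comp (PiTensorProduct.singleAlgHom (A := fun k => DegAffine F (nh.1 k)) k)) (h k)
  have hf : ∀ k a, f k (toCyc F p PUnit.{u + 1} (nh.1 k) (mu k) a) =
    τ (PiTensorProduct.singleAlgHom k a) := fun k a => liftCyc_toCyc _ _ a
  have hcomm : ∀ k l, k ≠ l → ∀ a b, Commute (f k a) (f l b) := fun k l hkl a b => by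
    obtain ⟨a, rfl⟩ := toCyc_surjective F p _ _ _ a
    obtain ⟨b, rfl⟩ := toCyc_surjective F p _ _ _ b
    rw [hf, hf]
    exact (commute_single hkl a b).map τ
  have h1 : (liftCommuting f hcomm).comp
      (tensorMap F fun k => toCyc F p PUnit.{u + 1} (nh.1 k) (mu k)) = τ := by
    refine PiTensorProduct.algHom_ext fun k => AlgHom.ext fun a => ?_
    rw [AlgHom.comp_apply, AlgHom.comp_apply, tensorMap_single, liftCommuting_single, hf]
    rfl
  rw [← h1, AlgHom.comp_apply, hb, map_zero]

theorem inflation_aCyc_essImage_iff {r n : ℕ} (mu : Fin r → ZMod p → ℕ) (N : FDMod F (A F r n)) :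
    (inflation F (toACyc F r n p mu)).essImage N ↔
      ∀ (nh : Comp r n) (k : Fin r) (j : Fin (nh.1 k)), j.1 = 0 → ∀ u : N.obj,
        factor F nh (PiTensorProduct.singleAlgHom k
          (aeval (x F PUnit.{u + 1} j) (cycPoly F p (mu k)))) • u = 0 := by
  rw [inflation_essImage_iff (toACyc_surjective F p r n mu)]
  constructor
  · intro h nh k j hj
    refine h _ (_root_.funext fun mh => ?_)
    change tensorMap F _ (factor F nh _ mh) = 0
    by_cases h : mh = nh
    · subst h
      rw [factor, Pi.single_eq_same, tensorMap_single, toCyc_cycPoly _ _ hj, map_zero]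
    · rw [factor, Pi.single_eq_of_ne h, map_zero]
  · intro h b hb u
    have h0 : ∀ nh : Comp r n, summandAct F N.obj nh (b nh) = 0 := fun nh =>
      eq_zero_of_tensorMap_eq_zero _
        (fun k j hj => LinearMap.ext fun u => Subtype.ext (h nh k j hj u.1)) (congrFun hb nh)
    refine (summandProj_bijective F (r := r) (n := n) N.obj).1 (_root_.funext fun nh => ?_)
    rw [LinearMap.pi_apply, summandProj_smul, h0, LinearMap.zero_apply, map_zero]
    rfl

end Quotients

/-! ### Rescaling the cyclotomic polynomial. -/

section Polynomials

variable {F : Type u} [Field F] {p : ℕ} [Fact p.Prime] [CharP F p]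

/-- Multiplication by `d` permutes the residues, and `X - i d = d (d⁻¹ X - i)`. -/
theorem cycPoly_eq_comp (lam : ZMod p → ℕ) {d : ZMod p} (hd : d ≠ 0) :
    cycPoly F p lam = C (ZMod.castHom (dvd_refl p) F d ^ ∑ i, lam (i * d)) *
      (cycPoly F p fun i => lam (i * d)).comp (C (ZMod.castHom (dvd_refl p) F d)⁻¹ * X) := by
  have h0 : ZMod.castHom (dvd_refl p) F d ≠ 0 := (_root_.map_ne_zero _).2 hd
  rw [cycPoly, cycPoly, Polynomial.prod_comp, ← Finset.prod_pow_eq_pow_sum, map_prod,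
      ← Finset.prod_mul_distrib]
  refine (Fintype.prod_equiv (Equiv.mulRight₀ d hd) _ _ fun i => ?_).symm
  rw [Equiv.mulRight₀_apply, pow_comp, sub_comp, X_comp, C_comp, map_pow, ← mul_pow, mul_sub,
    ← mul_assoc, ← C_mul, mul_inv_cancel₀ h0, C_1, one_mul, ← C_mul]
  change _ = (X - C (ZMod.castHom (dvd_refl p) F (i * d))) ^ lam (i * d)
  rw [map_mul (ZMod.castHom (dvd_refl p) F), mul_comm (ZMod.castHom (dvd_refl p) F i)]

theorem aeval_cycPoly_smul_eq_zero_iff {B M : Type*} [Ring B] [Algebra F B] [AddCommGroup M]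
    [Module F M] [Module B M] [IsScalarTower F B M] (lam : ZMod p → ℕ) {d : ZMod p} (hd : d ≠ 0)
    (b : B) (m : M) : aeval b (cycPoly F p lam) • m = 0 ↔
      aeval ((ZMod.castHom (dvd_refl p) F d)⁻¹ • b) (cycPoly F p fun i => lam (i * d)) • m = 0 := by
  have h0 : ZMod.castHom (dvd_refl p) F d ≠ 0 := (_root_.map_ne_zero _).2 hd
  rw [cycPoly_eq_comp lam hd, map_mul, aeval_C, aeval_comp, map_mul, aeval_C, aeval_X,
    ← Algebra.smul_def, ← Algebra.smul_def, smul_assoc]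
  exact smul_eq_zero_iff_right (pow_ne_zero _ h0)

end Polynomials

/-! ### Matching the cyclotomic conditions. -/

section Cyclotomic

variable {F : Type u} [Field F] {G : Type u} [Group G] [Fintype G] {r n : ℕ}
  {V : Fin r → Type u} [∀ k, AddCommGroup (V k)] [∀ k, Module F (V k)]
  [∀ k, FiniteDimensional F (V k)]
  (ρ : ∀ k, Representation F G (V k)) {c : Fin r → F} (hρ : SchurRelations ρ c)

/-- The place is moved down one position at a time. It is the first of its block, so the preceding
position has another colour and the exchange is mixed. -/
theorem exists_shuffle_first {nh : Comp r n} (k : Fin r) (j : Fin (nh.1 k)) (hj : j.1 = 0) :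
    ∃ α : Shuffle nh, (α.1 ⟨k, j⟩).1 = 0 := by
  suffices h : ∀ (b : ℕ) (α : Shuffle nh), (α.1 ⟨k, j⟩).1 = b →
      ∃ α : Shuffle nh, (α.1 ⟨k, j⟩).1 = 0 from h _ (placeShuffle nh) rfl
  intro b
  induction b with
  | zero => exact fun α h => ⟨α, h⟩
  | succ b ih =>
    intro α h
    have hb := (α.1 ⟨k, j⟩).2
    let i : Fin (n - 1) := ⟨b, by omega⟩
    have h1 : α.1 ⟨k, j⟩ = hi i := Fin.ext h
    have hm : Mixed α.1 i := by
      by_contra hm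
      obtain ⟨k', j', h2, h3⟩ := exists_of_not_mixed α i (not_not.2 hm)
      have h4 := α.1.injective (h1.trans h3.symm)
      obtain rfl : k = k' := congrArg Sigma.fst h4
      have h5 : j = hi j' := by simpa using h4
      rw [h5] at hj
      simp [hi] at hj
    refine ih (α.swap i hm) ?_
    rw [swap_apply, h1, simpleSwap_hi]
    rfl

section

variable {M : Type u} [AddCommGroup M] [Module F M] [Module (Affine F G n) M]
  [IsScalarTower F (Affine F G n) M] {nh : Comp r n}

include hρ in
-- Iterates `x_smul_permElt`, which applies again because multiplying `φ` by a polynomial generator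
-- keeps it equivariant.
theorem aeval_x_smul_permElt (P : F[X]) {φ : VHat F V nh →ₗ[F] M}
    (hφ : LabelEquivariant ρ (place nh) φ) (α : Shuffle nh) (a : Σ k, Fin (nh.1 k))
    (v : VHat F V nh) :
    aeval (x F G (α.1 a)) P • permElt F G (labelPerm α.1) • φ v =
      permElt F G (labelPerm α.1) • aeval (x F G (place nh a)) P • φ v := by
  induction P using Polynomial.induction_on' with
  | add P Q hP hQ => rw [map_add, map_add, add_smul, add_smul, smul_add, hP, hQ]
  | monomial m d =>
    rw [aeval_monomial, aeval_monomial, ← Algebra.smul_def, ← Algebra.smul_def, smul_assoc,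
      smul_assoc, smul_smul_comm']
    congr 1
    induction m generalizing φ with
    | zero => rw [pow_zero, pow_zero, one_smul, one_smul]
    | succ m ih =>
      rw [pow_succ, pow_succ, mul_smul, mul_smul, x_smul_permElt ρ hρ hφ]
      exact ih (hφ.x_smul (place nh a))

theorem homAct_aeval_apply (P : F[X]) (k : Fin r) (j : Fin (nh.1 k)) (φ : HomHat ρ M nh)
    (v : VHat F V nh) :
    (homAct ρ hρ M nh (PiTensorProduct.singleAlgHom k (aeval (x F PUnit.{u + 1} j) P)) φ).1 v =
      aeval ((c k)⁻¹ • x F G (place nh ⟨k, j⟩)) P • φ.1 v := by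
  rw [← aeval_algHom_apply, ← aeval_algHom_apply, homAct_y]
  induction P using Polynomial.induction_on' with
  | add P Q hP hQ =>
    rw [map_add, map_add, add_smul, ← hP, ← hQ]
    rfl
  | monomial m d =>
    rw [aeval_monomial, aeval_monomial, ← Algebra.smul_def, ← Algebra.smul_def, smul_assoc]
    change d • ((homY ρ hρ M nh k j ^ m) φ).1 v = _
    congr 1
    induction m with
    | zero => rw [pow_zero, pow_zero, one_smul, Module.End.one_apply]
    | succ m ih =>
      rw [pow_succ', pow_succ', mul_smul, ← ih, Module.End.mul_apply, homY_apply, smul_assoc]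

end

/-- Both conditions are compared on the vectors `w_α φ(v)`: there `x_1` is conjugate to the
generator at the first place of some block `k`, which acts on `φ` as `c k` times the corresponding
`y`, and the polynomials match by rescaling. -/
theorem essImage_iff (p : ℕ) [Fact p.Prime] [CharP F p]
    (hc : ∀ k, c k = ZMod.castHom (dvd_refl p) F (cScalar F p G V k)) (lam : ZMod p → ℕ)
    (M : FDMod F (Affine F G n)) :
    (inflation F (toCyc F p G n lam)).essImage M ↔
      (inflation F (toACyc F r n p (scaledWeight F G V lam))).essImage
        ((homFunctor ρ hρ).obj M) := by
  rw [inflation_cyc_essImage_iff, inflation_aCyc_essImage_iff]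
  have hc0 : ∀ k, cScalar F p G V k ≠ 0 := fun k h =>
    hρ.ne_zero k (by rw [hc, h, map_zero])
  have key : ∀ (nh : Comp r n) (k : Fin r) (j : Fin (nh.1 k)) (φ : HomHat ρ M.obj nh)
      (v : VHat F V nh), (homAct ρ hρ M.obj nh (PiTensorProduct.singleAlgHom k
        (aeval (x F PUnit.{u + 1} j) (cycPoly F p (scaledWeight F G V lam k)))) φ).1 v = 0 ↔
      aeval (x F G (place nh ⟨k, j⟩)) (cycPoly F p lam) • φ.1 v = 0 := fun nh k j φ v => by
    rw [homAct_aeval_apply, hc, aeval_cycPoly_smul_eq_zero_iff lam (hc0 k)]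
    rfl
  constructor
  · intro h nh k j hj u
    refine _root_.funext fun mh => ?_
    change homAct ρ hρ M.obj mh (factor F nh _ mh) (u mh) = 0
    by_cases hne : mh = nh
    · subst hne
      rw [factor, Pi.single_eq_same]
      refine Subtype.ext (LinearMap.ext fun v => (key mh k j (u mh) v).2 ?_)
      -- The relation holds for `x_1` only; a shuffle with this place in the first position
      -- transfers it to the block, since `permElt` acts injectively.
      obtain ⟨α, hα⟩ := exists_shuffle_first k j hj
      have h1 := aeval_x_smul_permElt ρ hρ (cycPoly F p lam)
        ((mem_homHat_iff ρ hρ _).1 (u mh).2) α ⟨k, j⟩ v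
      rw [h _ hα] at h1
      exact permElt_smul_injective (labelPerm α.1) (h1.symm.trans (smul_zero _).symm)
    · rw [factor, Pi.single_eq_of_ne hne, map_zero, LinearMap.zero_apply]
  · intro h i hi0 m
    refine module_induction n ρ hρ
      (P := fun m : M.obj => aeval (x F G i) (cycPoly F p lam) • m = 0)
      (fun nh α φ v => ?_) (smul_zero _) (fun m m' h h' => by rw [smul_add, h, h', add_zero]) m
    obtain ⟨⟨k, j⟩, rfl⟩ := α.1.surjective i
    -- The label `0` must fall on the first place of its block because `α` is increasing there.
    have hj : j.1 = 0 := by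
      by_contra hj
      have h1 : α.1 ⟨k, ⟨0, by have := j.2; omega⟩⟩ < α.1 ⟨k, j⟩ :=
        α.2 k (by rw [Fin.lt_def]; exact Nat.pos_of_ne_zero hj)
      rw [Fin.lt_def] at h1
      omega
    rw [aeval_x_smul_permElt ρ hρ _ ((mem_homHat_iff ρ hρ _).1 φ.2), (key nh k j φ v).1, smul_zero]
    have h1 := congrArg (fun u : HomSpace n ρ M.obj hρ => (u nh).1 v)
      (h nh k j hj (homSingle ρ hρ M.obj nh φ))
    have h2 := single_smul_homSingle ρ hρ nh (PiTensorProduct.singleAlgHom k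
        (aeval (x F PUnit.{u + 1} j) (cycPoly F p (scaledWeight F G V lam k)))) φ
    have h3 := (congrArg (fun u : HomSpace n ρ M.obj hρ => (u nh).1 v) h2).symm.trans h1
    simp only [homSingle_same] at h3
    exact h3

end Cyclotomic

end WreathHecke

end

theorem mainTheorem5 (p : ℕ) [Fact p.Prime] (F : Type u) [Field F] [IsAlgClosed F] [CharP F p]
    (G : Type u) [Group G] [Fintype G] (hpG : ¬ p ∣ Fintype.card G)
    (r : ℕ) (V : Fin r → Type u) [∀ k, AddCommGroup (V k)] [∀ k, Module F (V k)]
    [∀ k, FiniteDimensional F (V k)] (ρ : ∀ k, Representation F G (V k))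
    (hsimple : ∀ k, (ρ k).IsIrreducible)
    (hdistinct : ∀ k l, k ≠ l → IsEmpty (Representation.Equiv (ρ k) (ρ l)))
    (hcomplete : ∀ (W : Type u) [AddCommGroup W] [Module F W] [FiniteDimensional F W]
      (σ : Representation F G W), σ.IsIrreducible →
        ∃ k, Nonempty (Representation.Equiv σ (ρ k)))
    (n : ℕ) (lam : ZMod p → ℕ) :
    ∃ T : WreathHecke.FDMod F (WreathHecke.Affine F G n) ≌
        WreathHecke.FDMod F (WreathHecke.A F r n),
      Nonempty (WreathHecke.IsHomFunctor ρ p T.functor) ∧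
      ∃ Tlam : WreathHecke.FDMod F (WreathHecke.Cyc F p G n lam) ≌
          WreathHecke.FDMod F
            (WreathHecke.ACyc F r n p (WreathHecke.scaledWeight F G V lam)),
        Nonempty
          (Tlam.functor ⋙
              WreathHecke.inflation F
                (WreathHecke.toACyc F r n p (WreathHecke.scaledWeight F G V lam)) ≅
            WreathHecke.inflation F (WreathHecke.toCyc F p G n lam) ⋙ T.functor) := by
  have hG : (Fintype.card G : F) ≠ 0 := fun h => hpG ((CharP.cast_eq_zero_iff F p _).1 h)
  have hρ := WreathHecke.schurRelations ρ hG hsimple hdistinct hcomplete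
  -- The Schur elements lie in the prime field, so that they can rescale weights indexed by `ZMod
  -- p`.
  have hc : ∀ k, (Fintype.card G : F) / (Module.finrank F (V k) : F) =
      ZMod.castHom (dvd_refl p) F (WreathHecke.cScalar F p G V k) := fun k => by
    rw [WreathHecke.cScalar, map_div₀, map_natCast, map_natCast]
  have h1 := WreathHecke.inflation_full (WreathHecke.toCyc_surjective F p G n lam)
  have h2 := WreathHecke.inflation_full
    (WreathHecke.toACyc_surjective F p r n (WreathHecke.scaledWeight F G V lam))
  exact ⟨(WreathHecke.homFunctor (n := n) ρ hρ).asEquivalence,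
    ⟨WreathHecke.homFunctorIsHomFunctor ρ hρ p hc⟩,
    WreathHecke.exists_equivalence_of_essImage (WreathHecke.homFunctor (n := n) ρ hρ) _ _
      (WreathHecke.essImage_iff ρ hρ p hc lam)⟩
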